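/- **Setting.** Let $\Gamma$ be a countable set with a metric $d$, and let $F:[0,\infty)\to(0,\infty)$ be a non-increasing function with $$\sup_{x\in\Gamma}\sum_{y\in\Gamma}F(d(x,y))<\infty ,\qquad \sup_{x,y\in\Gamma}\sum_{z\in\Gamma}\frac{F(d(x,z))F(d(y,z))}{F(d(x,y))}<\infty .$$ For $\mu>0$ put $F_\mu(r)=e^{-\mu r}F(r)$. To each $x\in\Gamma$ a non-zero complex Hilbert space $\mathcal H_x$ is attached. For finite $\Lambda\subset\Gamma$ let $\mathcal H_\Lambda=\bigotimes_{x\in\Lambda}\mathcal H_x$ and $\mathcal A_\Lambda=\bigotimes_{x\in\Lambda}\mathcal B(\mathcal H_x)=\mathcal B(\mathcal H_\Lambda)$; for $\Lambda_1\subset\Lambda_2$ identify $A\in\mathcal A_{\Lambda_1}$ with $A\otimes 1\in\mathcal A_{\Lambda_2}$. The quasi-local algebra $\mathcal A_\Gamma$ is the C*-algebra obtained by norm completion of $\bigcup_{\Lambda}\mathcal A_\Lambda$ (union over finite $\Lambda$). For every $t\in\mathbb R$ and every finite $Z\subset\Gamma$ let $\Phi(t,Z)=\Phi(t,Z)^*\in\mathcal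 A_Z$ and let $L_a(t,Z)\in\mathcal A_Z$, $1\le a\le N(Z)$ (or $a\geq 1$, if $N(Z)=\infty$), be given. For $A$ in $\mathcal A_\Lambda$, $\Lambda\supset Z$ finite, put $$\Psi_Z(t)(A)=i[\Phi(t,Z),A]+\sum_{a=1}^{N(Z)}\Big(L_a(t,Z)^*AL_a(t,Z)-\tfrac12\big(L_a(t,Z)^*L_a(t,Z)A+AL_a(t,Z)^*L_a(t,Z)\big)\Big),$$ where, if $N(Z)=\infty$, the series is assumed to converge in the strong operator topology, and let $$\mathcal L_\Lambda(t)=\sum_{Z\subset\Lambda}\Psi_Z(t)\quad\text{on }\mathcal A_\Lambda .$$ Let $\|\Psi_Z(t)\|_{\rm cb}=\sup_{n\ge1}\|\Psi_Z(t)\otimes{\rm id}_{M_n(\mathbb C)}\|$, with $\Psi_Z(t)$ regarded as a map on $\mathcal A_Z$. **Theorem.** Assume that 1. for every finite $\Lambda\subset\Gamma$ the map $t\mapsto\mathcal L_\Lambda(t)\in\mathcal B(\mathcal A_\Lambda)$ is norm-continuous on $\mathbb R$; 2. there is $\mu>0$ such that for every $t\in\mathbb R$ $$\sup_{s\in[0,t]}\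 \sup_{x,y\in\Gamma}\ \sum_{Z\ni x,y}\frac{\|\Psi_Z(s)\|_{\rm cb}}{F_\mu(d(x,y))}<\infty ,$$ where $Z$ runs over the finite subsets of $\Gamma$ (and the supremum over an empty set is $0$). For finite $\Lambda\subset\Gamma$ and $0\le s\le t$ let $\gamma^\Lambda_{t,s}:\mathcal A_\Lambda\to\mathcal A_\Lambda$ map $A$ to $A(t)$, where $A(\cdot)$ is the solution in $\mathcal A_\Lambda$ of $\frac{d}{du}A(u)=\mathcal L_\Lambda(u)A(u)$ on $[s,t]$ with $A(s)=A$. Write $\gamma^\Lambda_{t,s}$ also for its extension $\gamma^\Lambda_{t,s}\otimes{\rm id}$ to $\mathcal A_\Gamma$, i.e. the unique bounded linear map $T$ of $\mathcal A_\Gamma$ that agrees with $\gamma^\Lambda_{t,s}$ on $\mathcal A_\Lambda$ and satisfies $T(BA)=B\,T(A)$ and $T(AB)=T(A)\,B$ for all $A\in\mathcal A_\Gamma$ and all $B\in\mathcal A_Y$, $Y\subset\Gamma\setminus\Lambda$ finite. Then there are bounded linear maps $\gamma^\Gamma_{t,s}$, $0\le s\le t$, of $\mathcal A_\Gamma$ into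 itself such that * (cocycle) $\gamma^\Gamma_{s,s}={\rm id}$ for $s\ge0$, and $\gamma^\Gamma_{t,s}\circ\gamma^\Gamma_{s,r}=\gamma^\Gamma_{t,r}$ for $0\le r\le s\le t$; * (strong continuity) for every $A\in\mathcal A_\Gamma$ the map $(t,s)\mapsto\gamma^\Gamma_{t,s}(A)$ is norm-continuous on $\{(t,s):0\le s\le t\}$; * each $\gamma^\Gamma_{t,s}$ is completely positive and $\gamma^\Gamma_{t,s}(1)=1$; * for all $0\le s\le t$, every increasing sequence $\Lambda_1\subset\Lambda_2\subset\cdots$ of finite subsets of $\Gamma$ with $\bigcup_n\Lambda_n=\Gamma$, and every $A\in\mathcal A_\Gamma$, $$\lim_{n\to\infty}\big\|\gamma^{\Lambda_n}_{t,s}(A)-\gamma^\Gamma_{t,s}(A)\big\|=0 .$$ -/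

import Mathlib

open Filter Topology
open scoped ENNReal InnerProductSpace

noncomputable section

namespace OpenLattice

/-! ### Hilbert spaces of a quantum lattice system -/

section Spaces

/-- The index set of an orthonormal (Hilbert) basis of the Hilbert space `E`. -/
def BasisIndex (E : Type*) [NormedAddCommGroup E] [InnerProductSpace ℂ E] [CompleteSpace E] :
    Type _ :=
  ((exists_hilbertBasis ℂ E).choose : Set E)

variable {Γ : Type*} (H : Γ → Type*) [∀ x, NormedAddCommGroup (H x)]
  [∀ x, InnerProductSpace ℂ (H x)] [∀ x, CompleteSpace (H x)]

/-- Labels of the product basis vectors of the finite volume `Λ`: one basis label per site. -/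
abbrev LocalConfig (Λ : Finset Γ) : Type _ := ∀ x : {x // x ∈ Λ}, BasisIndex (H x)

/-- One basis label for each site outside `Λ`. -/
abbrev OuterConfig (Λ : Finset Γ) : Type _ := ∀ x : {x // x ∉ Λ}, BasisIndex (H x)

/-- One basis label for each site of `Γ`. -/
abbrev Config : Type _ := ∀ x : Γ, BasisIndex (H x)

/-- The Hilbert space `ℋ_Λ = ⨂_{x ∈ Λ} H x` of a finite volume `Λ`.  The Hilbert space tensor
product is the space of square-summable families of coefficients with respect to the orthonormal
basis of products of basis vectors of the factors. -/
abbrev LocalSpace (Λ : Finset Γ) : Type _ := lp (fun _ : LocalConfig H Λ => ℂ) 2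

/-- The square-summable families indexed by all configurations on `Γ`.  This is the Hilbert space
on which all the algebras `B(ℋ_Λ)` are represented, faithfully and compatibly with the
identifications `A ↦ A ⊗ 1`; for every finite `Λ` it is `ℋ_Λ ⊗ ℓ²(OuterConfig H Λ)`. -/
abbrev TotalSpace : Type _ := lp (fun _ : Config H => ℂ) 2

/-- Bounded operators on the common representation space. -/
abbrev Op : Type _ := TotalSpace H →L[ℂ] TotalSpace H

variable {H}

open Classical in
/-- A configuration is a configuration inside `Λ` together with one outside `Λ`. -/
def splitConfig (Λ : Finset Γ) : Config H ≃ OuterConfig H Λ × LocalConfig H Λ :=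
  (Equiv.piEquivPiSubtypeProd (fun x => x ∈ Λ) (fun x => BasisIndex (H x))).trans
    (Equiv.prodComm _ _)

theorem summable_sq {ι : Type*} (f : lp (fun _ : ι => ℂ) 2) :
    HasSum (fun i => ‖f i‖ ^ 2) (‖f‖ ^ 2) := by
  have h := lp.hasSum_norm (p := 2) (by norm_num) f
  simpa using h

theorem memlp_two {ι : Type*} {f : ι → ℂ} (h : Summable (fun i => ‖f i‖ ^ 2)) :
    Memℓp (E := fun _ : ι => ℂ) f 2 := by
  apply memℓp_gen
  simpa using h

/-- The component in `ℋ_Λ` of the vector `f` along the basis vector labelled by the outer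
configuration `η`. -/
def fiber (Λ : Finset Γ) (η : OuterConfig H Λ) (f : TotalSpace H) : LocalSpace H Λ :=
  ⟨fun ξ => f ((splitConfig Λ).symm (η, ξ)), memlp_two <|
    (((splitConfig Λ).symm.summable_iff).2 (summable_sq f).summable).prod_factor η⟩

theorem fiber_apply (Λ : Finset Γ) (η : OuterConfig H Λ) (f : TotalSpace H) (ξ) :
    fiber Λ η f ξ = f ((splitConfig Λ).symm (η, ξ)) := rfl

theorem fiber_add (Λ : Finset Γ) (η : OuterConfig H Λ) (f g : TotalSpace H) :
    fiber Λ η (f + g) = fiber Λ η f + fiber Λ η g := by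
  ext ξ; simp [fiber_apply]

theorem fiber_smul (Λ : Finset Γ) (η : OuterConfig H Λ) (c : ℂ) (f : TotalSpace H) :
    fiber Λ η (c • f) = c • fiber Λ η f := by
  ext ξ; simp [fiber_apply]

theorem hasSum_fiber (Λ : Finset Γ) (f : TotalSpace H) :
    HasSum (fun η => ‖fiber Λ η f‖ ^ 2) (‖f‖ ^ 2) := by
  have h := ((splitConfig Λ).symm.hasSum_iff).2 (summable_sq f)
  exact h.prod_fiberwise fun η => summable_sq (fiber Λ η f)

theorem summable_of_fiber (Λ : Finset Γ) (F : OuterConfig H Λ → LocalSpace H Λ)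
    (hF : Summable fun η => ‖F η‖ ^ 2) :
    Summable fun σ : Config H => ‖F (splitConfig Λ σ).1 (splitConfig Λ σ).2‖ ^ 2 := by
  have key : Summable fun p : OuterConfig H Λ × LocalConfig H Λ => ‖F p.1 p.2‖ ^ 2 := by
    refine (summable_prod_of_nonneg (fun p => sq_nonneg _)).2
      ⟨fun η => (summable_sq (F η)).summable, ?_⟩
    exact hF.congr fun η => (summable_sq (F η)).tsum_eq.symm
  exact key.comp_injective (splitConfig Λ).injective

theorem ampl_summable (Λ : Finset Γ) (A : LocalSpace H Λ →L[ℂ] LocalSpace H Λ)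
    (f : TotalSpace H) : Summable fun η => ‖A (fiber Λ η f)‖ ^ 2 := by
  refine Summable.of_nonneg_of_le (fun _ => by positivity) (fun η => ?_)
    ((hasSum_fiber Λ f).summable.mul_left (‖A‖ ^ 2))
  rw [← mul_pow]
  exact pow_le_pow_left₀ (norm_nonneg _) (A.le_opNorm _) 2

/-- The vector `(A ⊗ 1) f`. -/
def amplVec (Λ : Finset Γ) (A : LocalSpace H Λ →L[ℂ] LocalSpace H Λ) (f : TotalSpace H) :
    TotalSpace H :=
  ⟨fun σ => A (fiber Λ (splitConfig Λ σ).1 f) (splitConfig Λ σ).2,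
    memlp_two (summable_of_fiber Λ (fun η => A (fiber Λ η f)) (ampl_summable Λ A f))⟩

theorem fiber_amplVec (Λ : Finset Γ) (A : LocalSpace H Λ →L[ℂ] LocalSpace H Λ)
    (f : TotalSpace H) (η) : fiber Λ η (amplVec Λ A f) = A (fiber Λ η f) := by
  ext ξ
  simp [fiber_apply, amplVec]

theorem ext_fiber (Λ : Finset Γ) {f g : TotalSpace H} (h : ∀ η, fiber Λ η f = fiber Λ η g) :
    f = g := by
  ext σ
  have := congrArg (fun v : LocalSpace H Λ => v (splitConfig Λ σ).2) (h (splitConfig Λ σ).1)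
  simpa [fiber_apply] using this

theorem norm_amplVec_le (Λ : Finset Γ) (A : LocalSpace H Λ →L[ℂ] LocalSpace H Λ)
    (f : TotalSpace H) : ‖amplVec Λ A f‖ ≤ ‖A‖ * ‖f‖ := by
  refine le_of_sq_le_sq ?_ (by positivity)
  rw [mul_pow]
  refine hasSum_le (fun η => ?_) (hasSum_fiber Λ (amplVec Λ A f))
    ((hasSum_fiber Λ f).mul_left (‖A‖ ^ 2))
  rw [fiber_amplVec, ← mul_pow]
  exact pow_le_pow_left₀ (norm_nonneg _) (A.le_opNorm _) 2

/-- The operator `A ⊗ 1`, for `A ∈ B(ℋ_Λ)`. -/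
def amplOp (Λ : Finset Γ) (A : LocalSpace H Λ →L[ℂ] LocalSpace H Λ) : Op H :=
  LinearMap.mkContinuous
    { toFun := amplVec Λ A
      map_add' := fun f g => ext_fiber Λ fun η => by simp [fiber_amplVec, fiber_add]
      map_smul' := fun c f => ext_fiber Λ fun η => by simp [fiber_amplVec, fiber_smul] }
    ‖A‖ (norm_amplVec_le Λ A)

theorem fiber_amplOp (Λ : Finset Γ) (A : LocalSpace H Λ →L[ℂ] LocalSpace H Λ)
    (f : TotalSpace H) (η) : fiber Λ η (amplOp Λ A f) = A (fiber Λ η f) :=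
  fiber_amplVec Λ A f η

theorem hasSum_inner_fiber (Λ : Finset Γ) (f g : TotalSpace H) :
    HasSum (fun η => ⟪fiber Λ η f, fiber Λ η g⟫_ℂ) ⟪f, g⟫_ℂ := by
  have h := ((splitConfig Λ).symm.hasSum_iff).2 (lp.hasSum_inner (𝕜 := ℂ) f g)
  exact h.prod_fiberwise fun η => lp.hasSum_inner (𝕜 := ℂ) (fiber Λ η f) (fiber Λ η g)

variable (H) in
/-- The identification `A ↦ A ⊗ 1` of `B(ℋ_Λ)` with an algebra of operators on the common
representation space. -/
def ampliation (Λ : Finset Γ) : (LocalSpace H Λ →L[ℂ] LocalSpace H Λ) →⋆ₐ[ℂ] Op H where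
  toFun := amplOp Λ
  map_one' := by
    ext1 f; exact ext_fiber Λ fun η => by simp [fiber_amplOp]
  map_mul' A B := by
    ext1 f; exact ext_fiber Λ fun η => by simp [fiber_amplOp]
  map_zero' := by
    ext1 f; exact ext_fiber Λ fun η => by
      rw [fiber_amplOp]; ext ξ; simp [fiber_apply]
  map_add' A B := by
    ext1 f; exact ext_fiber Λ fun η => by simp [fiber_amplOp, fiber_add]
  commutes' c := by
    ext1 f; exact ext_fiber Λ fun η => by
      simp [fiber_amplOp, fiber_smul, Algebra.algebraMap_eq_smul_one]
  map_star' A := by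
    rw [ContinuousLinearMap.star_eq_adjoint, ContinuousLinearMap.star_eq_adjoint,
      ContinuousLinearMap.eq_adjoint_iff]
    intro f g
    have h1 := hasSum_inner_fiber Λ (amplOp Λ (ContinuousLinearMap.adjoint A) f) g
    have h2 := hasSum_inner_fiber Λ f (amplOp Λ A g)
    simp only [fiber_amplOp, ContinuousLinearMap.adjoint_inner_left] at h1 h2
    exact h1.unique h2

end Spaces

/-! ### Algebras of observables -/

section Algebras

variable {Γ : Type*} (H : Γ → Type*) [∀ x, NormedAddCommGroup (H x)]
  [∀ x, InnerProductSpace ℂ (H x)] [∀ x, CompleteSpace (H x)]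

/-- The algebra `𝒜_Λ = ⨂_{x ∈ Λ} B(H x) = B(ℋ_Λ)` of observables supported in `Λ`, with
`A ∈ B(ℋ_Λ)` identified with `A ⊗ 1`. -/
def localAlgebra (Λ : Finset Γ) : StarSubalgebra ℂ (Op H) := (ampliation H Λ).range

/-- The quasi-local C*-algebra `𝒜_Γ`: the norm closure of the (directed) union of the algebras
`𝒜_Λ` over all finite `Λ`. -/
def quasiLocalAlgebra : StarSubalgebra ℂ (Op H) :=
  (⨆ Λ : Finset Γ, localAlgebra H Λ).topologicalClosure

instance isClosed_quasiLocalAlgebra : IsClosed (quasiLocalAlgebra H : Set (Op H)) :=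
  StarSubalgebra.isClosed_topologicalClosure _

variable {H}

/-- The cb-norm of a map `ψ` of `𝒜_Z` into operators: the supremum over `n` of the norms of the
entrywise actions of `ψ` on the `n × n` matrices over `𝒜_Z`, where matrices carry their C*-norm.
Its value is `∞` if `ψ` is not completely bounded. -/
def cbNorm (Z : Finset Γ) (ψ : Op H → Op H) : ℝ≥0∞ :=
  ⨆ (n : ℕ) (M : CStarMatrix (Fin n) (Fin n) (Op H))
    (_ : ∀ i j, M i j ∈ localAlgebra H Z) (_ : ‖M‖ ≤ 1), ENNReal.ofReal ‖M.map ψ‖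

end Algebras

/-- A bounded linear map of a C*-algebra into itself is completely positive if it underlies a
completely positive map in the sense of Mathlib, where the order of the C*-algebra is the one
whose positive elements are the `star a * a`. -/
def IsCompletelyPositive {A : Type*} [CStarAlgebra A] (φ : A →L[ℂ] A) : Prop :=
  letI := CStarAlgebra.spectralOrder A
  letI := CStarAlgebra.spectralOrderedRing A
  ∃ ψ : CompletelyPositiveMap A A, ∀ a, ψ a = φ a

/-! ### Generators -/

section Generators

variable {E : Type*} [NormedAddCommGroup E] [InnerProductSpace ℂ E] [CompleteSpace E]

/-- The Lindblad term `L* A L - (1/2) {L* L, A}`. -/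
def lindbladTerm (L A : E →L[ℂ] E) : E →L[ℂ] E :=
  star L * A * L - (1 / 2 : ℂ) • (star L * L * A + A * (star L * L))

/-- The bounded operator `B` is the sum of the series `∑ T a` in the strong operator topology. -/
def HasStrongSum (T : ℕ → E →L[ℂ] E) (B : E →L[ℂ] E) : Prop :=
  ∀ v : E, Tendsto (fun n => ∑ a ∈ Finset.range n, T a v) atTop (𝓝 (B v))

open Classical in
/-- The sum of a series of operators in the strong operator topology (`0` if it diverges). -/
def strongSum (T : ℕ → E →L[ℂ] E) : E →L[ℂ] E :=
  if h : ∃ B, HasStrongSum T B then h.choose else 0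

end Generators

section Dynamics

variable {Γ : Type*} (H : Γ → Type*) [∀ x, NormedAddCommGroup (H x)]
  [∀ x, InnerProductSpace ℂ (H x)] [∀ x, CompleteSpace (H x)]

/-- A time-dependent Hamiltonian interaction `Φ` and, for every finite `Z`, a finite or infinite
sequence of time-dependent Lindblad operators `L t Z a ∈ 𝒜_Z`; a finite sequence is continued by
zeros, which changes none of the sums below. -/
structure LatticeSystem where
  Φ : ℝ → Finset Γ → Op H
  L : ℝ → Finset Γ → ℕ → Op H
  Φ_mem : ∀ t Z, Φ t Z ∈ localAlgebra H Z
  Φ_star : ∀ t Z, star (Φ t Z) = Φ t Z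
  L_mem : ∀ t Z a, L t Z a ∈ localAlgebra H Z

namespace LatticeSystem

variable {H} (S : LatticeSystem H)

/-- The series of Lindblad terms in the definition of the generators converge in the strong
operator topology on every local algebra.  There is nothing to assume where the sequences of
Lindblad operators are finite, or where `∑ a, ‖L t Z a‖ ^ 2 < ∞`. -/
def SeriesConverge : Prop :=
  ∀ (t : ℝ) (Z Λ : Finset Γ), Z ⊆ Λ → ∀ A ∈ localAlgebra H Λ,
    ∃ B, HasStrongSum (fun a => lindbladTerm (S.L t Z a) A) B

/-- `Ψ_Z(t)(A) = i [Φ(t, Z), A] + ∑ a, (L_a* A L_a - (1/2) {L_a* L_a, A})`. -/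
def Ψ (t : ℝ) (Z : Finset Γ) (A : Op H) : Op H :=
  Complex.I • (S.Φ t Z * A - A * S.Φ t Z) + strongSum fun a => lindbladTerm (S.L t Z a) A

/-- `ℒ_Λ(t) = ∑_{Z ⊆ Λ} Ψ_Z(t)`. -/
def generator (Λ : Finset Γ) (t : ℝ) (A : Op H) : Op H := ∑ Z ∈ Λ.powerset, S.Ψ t Z A

/-- For every finite `Λ` the map `t ↦ ℒ_Λ(t)` is continuous for the operator norm of linear maps
on `𝒜_Λ`. -/
def NormContinuous : Prop :=
  ∀ (Λ : Finset Γ) (t₀ : ℝ), ∀ ε > 0, ∀ᶠ t in 𝓝 t₀, ∀ A ∈ localAlgebra H Λ,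
    ‖S.generator Λ t A - S.generator Λ t₀ A‖ ≤ ε * ‖A‖

/-- The solution of `f'(u) = ℒ_Λ(u) f(u)`, `f(s) = A`, on `[s, t]` in `𝒜_Λ` (with one-sided
derivatives at the end points). -/
structure IsSolution (Λ : Finset Γ) (s t : ℝ) (A : Op H) (f : ℝ → Op H) : Prop where
  mem : ∀ u ∈ Set.Icc s t, f u ∈ localAlgebra H Λ
  init : f s = A
  deriv : ∀ u ∈ Set.Icc s t, HasDerivWithinAt f (S.generator Λ u (f u)) (Set.Icc s t) u

/-- `T` is the finite volume evolution `γ^Λ_{t,s}`, acting on `𝒜_Γ` as `γ^Λ_{t,s} ⊗ id`: on `𝒜_Λ`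
it maps `A` to the value at `t` of the solution which starts from `A` at time `s`, and it is a
bimodule map over all local algebras `𝒜_Y` with `Y` disjoint from `Λ`.  The compressions of
an element of `𝒜_X`, `Λ ⊆ X`, by matrix units of `𝒜_{X \ Λ}` are products of elements of `𝒜_Λ`
and matrix units, so that there is at most one such bounded linear map. -/
structure IsFiniteVolumeEvolution (Λ : Finset Γ) (t s : ℝ)
    (T : quasiLocalAlgebra H →L[ℂ] quasiLocalAlgebra H) : Prop where
  on_local : ∀ A : quasiLocalAlgebra H, (A : Op H) ∈ localAlgebra H Λ →
    ∃ f, S.IsSolution Λ s t A f ∧ (T A : Op H) = f t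
  left_module : ∀ Y : Finset Γ, Disjoint Y Λ → ∀ A B : quasiLocalAlgebra H,
    (B : Op H) ∈ localAlgebra H Y → T (B * A) = B * T A
  right_module : ∀ Y : Finset Γ, Disjoint Y Λ → ∀ A B : quasiLocalAlgebra H,
    (B : Op H) ∈ localAlgebra H Y → T (A * B) = T A * B

open Classical in
/-- The finite volume evolution `γ^Λ_{t,s}`, acting on `𝒜_Γ` as `γ^Λ_{t,s} ⊗ id`. -/
def finiteVolumeEvolution (Λ : Finset Γ) (t s : ℝ) :
    quasiLocalAlgebra H →L[ℂ] quasiLocalAlgebra H :=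
  if h : ∃ T, S.IsFiniteVolumeEvolution Λ t s T then h.choose else 0

end LatticeSystem

end Dynamics

/-! ### Decay conditions -/

section Decay

variable {Γ : Type*} [MetricSpace Γ]

/-- `F : [0, ∞) → (0, ∞)` is non-increasing, uniformly integrable over `Γ`, and satisfies the
convolution condition. -/
structure IsDecayFunction (Γ : Type*) [MetricSpace Γ] (F : ℝ → ℝ) : Prop where
  pos : ∀ r, 0 ≤ r → 0 < F r
  antitone : AntitoneOn F (Set.Ici 0)
  integrable : ⨆ x : Γ, ∑' y : Γ, ENNReal.ofReal (F (dist x y)) < ∞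
  convolution : ⨆ (x : Γ) (y : Γ),
    ∑' z : Γ, ENNReal.ofReal (F (dist x z) * F (dist y z) / F (dist x y)) < ∞

/-- `F_μ(r) = e^{-μ r} F(r)`. -/
def weighted (F : ℝ → ℝ) (μ r : ℝ) : ℝ := Real.exp (-μ * r) * F r

variable {H : Γ → Type*} [∀ x, NormedAddCommGroup (H x)]
  [∀ x, InnerProductSpace ℂ (H x)] [∀ x, CompleteSpace (H x)]

/-- `‖Ψ‖_{t,μ} = sup_{s ∈ [0,t]} sup_{x,y ∈ Γ} ∑_{Z ∋ x,y} ‖Ψ_Z(s)‖_cb / F_μ(d(x,y))`, where `Z`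
runs over the finite subsets of `Γ`. -/
def LatticeSystem.decayNorm (S : LatticeSystem H) (F : ℝ → ℝ) (t μ : ℝ) : ℝ≥0∞ :=
  ⨆ s ∈ Set.Icc 0 t, ⨆ (x : Γ) (y : Γ), ∑' Z : {Z : Finset Γ // x ∈ Z ∧ y ∈ Z},
    cbNorm (Z : Finset Γ) (S.Ψ s Z) / ENNReal.ofReal (weighted F μ (dist x y))

end Decay

end OpenLattice

end

/-!
# Existence of the infinite volume dynamics of open quantum lattice systems

The proof compares the evolutions in different finite volumes by a Lieb–Robinson bound. In order to
avoid differential equations in spaces where the generators need not depend continuously on time,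
all estimates are made for the explicit Euler scheme, and all evolutions act on the algebra `B(ℋ)`
of all bounded operators on the common representation space.

*Generators.* Subtracting their expectations in a unit vector from the Lindblad operators brings
each `Ψ_Z(t)` into the form `A ↦ ∑ L_a* A L_a + G* A + A G`, where the drift `G` is controlled by
the norm of `Ψ_Z(t)` (`exists_isLindbladSeries`). Such a map extends to `B(ℋ)`. The extension is
weakly continuous on bounded sequences and it is a bimodule map over the commutant of `𝒜_Z`, and
its norm is at most the cb-norm of `Ψ_Z(t)`, since it acts on `A`, regarded as a matrix over
`B(ℋ_Z)`, entry by entry (`LatticeSystem.exists_localGenerator`). Consequently generators with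
disjoint supports commute (`IsLocalGenerator.commute`).

*Contractivity.* If `φ` is a finite sum of such generators with drift `K`, then `1 + δ φ` differs
by `δ² K* A K` from a completely positive map (`exists_isCPMap_near`). As the norm of a completely
positive map is its norm at the identity, `‖1 + δ φ‖ ≤ 1 + O(δ²)`. Hence the propagators of the
Euler scheme are completely positive contractions up to errors which vanish with the length of the
steps.

*Lieb–Robinson bound.* Let `A ∈ 𝒜_X` and let `A_k` arise from it by `k` Euler steps in a finite
volume. By induction on `k`, `‖ψ A_k‖` is bounded by a multiple of the bound of `ψ` times `∑ z ∈ Z,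
∑ x ∈ X, F (dist z x)`, for every generator `ψ` with support `Z`: in the step from `A_k` to
`A_{k+1}` the generators whose support is disjoint from `Z` commute with `ψ` and their Euler step
is a near contraction, and the remaining ones are summed by the convolution property of `F`
(`norm_apply_euler_le`). Therefore the evolutions of `A` in two volumes `Λ ⊆ Λ'` differ by at most
a multiple of `∑ y ∈ Λ' \ Λ, ∑ x ∈ X, F (dist y x)` (`norm_euler_sub_euler_le`), which is the tail
of a convergent series. The exponential weight is not needed for this, because `F_μ ≤ F`.

*Finite volumes.* The Euler scheme in the volume `Λ` acts on each block of an operator, that is, on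
each entry of its matrix over `B(ℋ_Λ)`, as the Euler scheme of the linear equation in `B(ℋ_Λ)`,
where the generators are norm continuous. So it converges weakly to a completely positive unital
bimodule map, whose blocks solve this equation (`IsGeneratorFamily.block_evolution`). Its
restriction to the quasi-local algebra is the finite volume evolution: two bounded bimodule maps
which agree on `𝒜_Λ` agree on `𝒜_X` for all `X ⊇ Λ`, as is seen from their compressions by matrix
units of `𝒜_{X \ Λ}` (`IsGeneratorFamily.eq_evolution`).

*Infinite volume.* By the comparison of volumes, density of the local observables and
contractivity, the finite volume evolutions converge, uniformly for bounded times
(`IsGeneratorFamily.exists_volume`), and the limit inherits the cocycle property, strong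
continuity, complete positivity and preservation of the identity.
-/

noncomputable section

namespace OpenLattice

/-! ### Weak operator convergence -/

section WeakConvergence

variable {E : Type*} [NormedAddCommGroup E] [InnerProductSpace ℂ E]

/-- Sequential convergence in the weak operator topology. -/
def WeakTendsto (T : ℕ → E →L[ℂ] E) (B : E →L[ℂ] E) : Prop :=
  ∀ v w : E, Tendsto (fun n => ⟪v, T n w⟫_ℂ) atTop (𝓝 ⟪v, B w⟫_ℂ)

namespace WeakTendsto

variable {T U : ℕ → E →L[ℂ] E} {B C : E →L[ℂ] E}

theorem const (B : E →L[ℂ] E) : WeakTendsto (fun _ => B) B := fun _ _ => tendsto_const_nhds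

theorem add (hT : WeakTendsto T B) (hU : WeakTendsto U C) :
    WeakTendsto (fun n => T n + U n) (B + C) := fun v w => by
  simpa [inner_add_right] using (hT v w).add (hU v w)

theorem sub (hT : WeakTendsto T B) (hU : WeakTendsto U C) :
    WeakTendsto (fun n => T n - U n) (B - C) := fun v w => by
  simpa [inner_sub_right] using (hT v w).sub (hU v w)

theorem smul (c : ℂ) (hT : WeakTendsto T B) :
    WeakTendsto (fun n => c • T n) (c • B) := fun v w => by
  simpa [inner_smul_right] using (hT v w).const_mul c

theorem mul_right (hT : WeakTendsto T B) (A : E →L[ℂ] E) :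
    WeakTendsto (fun n => T n * A) (B * A) := fun v w => hT v (A w)

theorem mul_left [CompleteSpace E] (hT : WeakTendsto T B) (A : E →L[ℂ] E) :
    WeakTendsto (fun n => A * T n) (A * B) := fun v w => by
  simpa [ContinuousLinearMap.adjoint_inner_left] using hT (ContinuousLinearMap.adjoint A v) w

theorem star [CompleteSpace E] (hT : WeakTendsto T B) :
    WeakTendsto (fun n => Star.star (T n)) (Star.star B) := fun v w => by
  have h := (Complex.continuous_conj.tendsto _).comp (hT w v)
  simpa [ContinuousLinearMap.star_eq_adjoint, ContinuousLinearMap.adjoint_inner_right,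
    Function.comp_def] using h

theorem unique (hT : WeakTendsto T B) (hT' : WeakTendsto T C) : B = C :=
  ContinuousLinearMap.ext fun w => ext_inner_left ℂ fun v => tendsto_nhds_unique (hT v w) (hT' v w)

theorem norm_le {c : ℝ} (hc : 0 ≤ c) (hT : WeakTendsto T B) (h : ∀ᶠ n in atTop, ‖T n‖ ≤ c) :
    ‖B‖ ≤ c := by
  refine ContinuousLinearMap.opNorm_le_bound _ hc fun w => ?_
  have key : ∀ v, ‖⟪v, B w⟫_ℂ‖ ≤ ‖v‖ * (c * ‖w‖) := fun v => by
    refine le_of_tendsto (hT v w).norm (h.mono fun n hn => ?_)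
    refine (norm_inner_le_norm _ _).trans ?_
    gcongr
    exact (T n).le_of_opNorm_le hn w
  rcases eq_or_ne (B w) 0 with h0 | h0
  · rw [h0, norm_zero]; positivity
  · have h1 := key (B w)
    rw [inner_self_eq_norm_sq_to_K] at h1
    have : ‖B w‖ * ‖B w‖ ≤ ‖B w‖ * (c * ‖w‖) := by
      simpa [sq] using h1
    exact le_of_mul_le_mul_left this (norm_pos_iff.2 h0)

theorem of_tendsto (h : ∀ w, Tendsto (fun n => T n w) atTop (𝓝 (B w))) : WeakTendsto T B :=
  fun _ w => (continuous_const.inner continuous_id).continuousAt.tendsto.comp (h w)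

theorem of_norm_tendsto (h : Tendsto T atTop (𝓝 B)) : WeakTendsto T B :=
  of_tendsto fun w => ((ContinuousLinearMap.apply ℂ E w).continuous.tendsto B).comp h

end WeakTendsto

/-- A bounded sequence of operators all of whose matrix coefficients converge has a limit in the
weak operator topology. -/
theorem exists_weakTendsto [CompleteSpace E] {T : ℕ → E →L[ℂ] E} {c : ℝ} (hT : ∀ n, ‖T n‖ ≤ c)
    (h : ∀ v w, ∃ z, Tendsto (fun n => ⟪v, T n w⟫_ℂ) atTop (𝓝 z)) :
    ∃ B, WeakTendsto T B := by
  have h' : ∀ v w, ∃ z, Tendsto (fun n => ⟪T n v, w⟫_ℂ) atTop (𝓝 z) := fun v w => by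
    obtain ⟨z, hz⟩ := h w v
    refine ⟨(starRingEnd ℂ) z, ?_⟩
    have := (Complex.continuous_conj.tendsto _).comp hz
    simpa [Function.comp_def] using this
  choose f hf using h'
  let b : E →ₗ⋆[ℂ] E →ₗ[ℂ] ℂ := LinearMap.mk₂'ₛₗ (starRingEnd ℂ) (RingHom.id ℂ) f
    (fun v v' w => tendsto_nhds_unique (hf _ _) (by
      simpa [inner_add_left] using (hf v w).add (hf v' w)))
    (fun a v w => tendsto_nhds_unique (hf _ _) (by
      simpa [inner_smul_left, mul_comm] using (hf v w).const_mul ((starRingEnd ℂ) a)))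
    (fun v w w' => tendsto_nhds_unique (hf _ _) (by
      simpa [inner_add_right] using (hf v w).add (hf v w')))
    (fun a v w => tendsto_nhds_unique (hf _ _) (by
      simpa [inner_smul_right] using (hf v w).const_mul a))
  have hb : ∀ v w, ‖b v w‖ ≤ c * ‖v‖ * ‖w‖ := fun v w => by
    refine le_of_tendsto (hf v w).norm (Eventually.of_forall fun n => ?_)
    refine (norm_inner_le_norm _ _).trans ?_
    gcongr
    exact (T n).le_of_opNorm_le (hT n) v
  refine ⟨InnerProductSpace.continuousLinearMapOfBilin (b.mkContinuous₂ c hb), fun v w => ?_⟩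
  have h1 : ⟪InnerProductSpace.continuousLinearMapOfBilin (b.mkContinuous₂ c hb) w, v⟫_ℂ =
      f w v := by
    rw [InnerProductSpace.continuousLinearMapOfBilin_apply]; rfl
  have h2 := (Complex.continuous_conj.tendsto _).comp (hf w v)
  rw [← h1] at h2
  simpa only [Function.comp_def, inner_conj_symm] using h2

theorem norm_inner_le_add_sq {x y : E} {A : E →L[ℂ] E} {c : ℝ} (hA : ‖A‖ ≤ c) :
    ‖⟪x, A y⟫_ℂ‖ ≤ c * (‖x‖ ^ 2 + ‖y‖ ^ 2) := by
  have hc : 0 ≤ c := (norm_nonneg _).trans hA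
  calc ‖⟪x, A y⟫_ℂ‖ ≤ ‖x‖ * (c * ‖y‖) := by
        refine (norm_inner_le_norm _ _).trans ?_
        gcongr
        exact A.le_of_opNorm_le hA y
    _ ≤ c * (‖x‖ ^ 2 + ‖y‖ ^ 2) := by
        nlinarith [mul_nonneg hc (sq_nonneg (‖x‖ - ‖y‖)), mul_nonneg hc (sq_nonneg ‖x‖),
          mul_nonneg hc (sq_nonneg ‖y‖)]

end WeakConvergence

/-! ### Positive kernels and completely positive maps -/

section PositiveKernels

open scoped ComplexOrder

variable {E : Type*} [NormedAddCommGroup E] [InnerProductSpace ℂ E]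

/-- A matrix of operators on `E` is a positive kernel if it is positive as an operator on `Eⁿ`.
This is expressed by its quadratic form, so that it passes to weak limits of the entries. -/
def IsPosKernel {n : ℕ} (M : Fin n → Fin n → E →L[ℂ] E) : Prop :=
  ∀ v : Fin n → E, 0 ≤ ∑ i, ∑ j, ⟪v i, M i j (v j)⟫_ℂ

theorem IsPosKernel.of_weakTendsto {n : ℕ} {M : ℕ → Fin n → Fin n → E →L[ℂ] E}
    {M' : Fin n → Fin n → E →L[ℂ] E} (hM : ∀ k, IsPosKernel (M k))
    (h : ∀ i j, WeakTendsto (fun k => M k i j) (M' i j)) : IsPosKernel M' := fun v => by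
  refine ge_of_tendsto' (x := atTop)
    (tendsto_finsetSum _ fun i _ => tendsto_finsetSum _ fun j _ => h i j (v i) (v j))
    fun k => hM k v

theorem IsPosKernel.add {n : ℕ} {M M' : Fin n → Fin n → E →L[ℂ] E} (hM : IsPosKernel M)
    (hM' : IsPosKernel M') : IsPosKernel (fun i j => M i j + M' i j) := fun v => by
  simpa [inner_add_right, Finset.sum_add_distrib] using add_nonneg (hM v) (hM' v)

theorem IsPosKernel.smul {n : ℕ} {M : Fin n → Fin n → E →L[ℂ] E} (hM : IsPosKernel M)
    {c : ℝ} (hc : 0 ≤ c) : IsPosKernel (fun i j => (c : ℂ) • M i j) := fun v => by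
  simpa [inner_smul_right, Finset.mul_sum] using
    mul_nonneg (Complex.zero_le_real.2 hc) (hM v)

theorem IsPosKernel.conj [CompleteSpace E] {n : ℕ} {M : Fin n → Fin n → E →L[ℂ] E}
    (hM : IsPosKernel M)
    (K : E →L[ℂ] E) : IsPosKernel (fun i j => star K * M i j * K) := fun v => by
  simpa [ContinuousLinearMap.star_eq_adjoint, ContinuousLinearMap.adjoint_inner_right] using
    hM (fun i => K (v i))

/-- A linear map between operator algebras is completely positive if it preserves positive
kernels. -/
def IsCPMap (φ : (E →L[ℂ] E) →L[ℂ] (E →L[ℂ] E)) : Prop :=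
  ∀ (n : ℕ) (M : Fin n → Fin n → E →L[ℂ] E), IsPosKernel M → IsPosKernel (fun i j => φ (M i j))

namespace IsCPMap

variable {φ ψ : (E →L[ℂ] E) →L[ℂ] (E →L[ℂ] E)}

theorem id : IsCPMap (ContinuousLinearMap.id ℂ (E →L[ℂ] E)) := fun _ _ h => h

theorem zero : IsCPMap (0 : (E →L[ℂ] E) →L[ℂ] (E →L[ℂ] E)) := fun _ _ _ v => by simp

theorem comp (hφ : IsCPMap φ) (hψ : IsCPMap ψ) : IsCPMap (φ.comp ψ) :=
  fun n M hM => hφ n _ (hψ n M hM)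

theorem add (hφ : IsCPMap φ) (hψ : IsCPMap ψ) : IsCPMap (φ + ψ) :=
  fun n M hM => (hφ n M hM).add (hψ n M hM)

theorem smul (hφ : IsCPMap φ) {c : ℝ} (hc : 0 ≤ c) : IsCPMap ((c : ℂ) • φ) :=
  fun n M hM => (hφ n M hM).smul hc

theorem sum {ι : Type*} (s : Finset ι) {f : ι → (E →L[ℂ] E) →L[ℂ] (E →L[ℂ] E)}
    (h : ∀ i ∈ s, IsCPMap (f i)) : IsCPMap (∑ i ∈ s, f i) :=
  Finset.sum_induction _ _ (fun _ _ => add) zero h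

/-- Positivity of the image of the kernel `[[‖A‖, A], [A*, ‖A‖]]` bounds the matrix coefficients of
`φ A`. -/
theorem norm_inner_le (hφ : IsCPMap φ) [CompleteSpace E] (A : E →L[ℂ] E) {v w : E}
    (hv : ‖v‖ ≤ 1) (hw : ‖w‖ ≤ 1) : ‖⟪v, φ A w⟫_ℂ‖ ≤ ‖φ 1‖ * ‖A‖ := by
  have hpos : IsPosKernel (n := 2) ![![(‖A‖ : ℂ) • 1, A], ![star A, (‖A‖ : ℂ) • 1]] := fun u => by
    have e1 : ⟪u 1, star A (u 0)⟫_ℂ = (starRingEnd ℂ) ⟪u 0, A (u 1)⟫_ℂ := by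
      simp [ContinuousLinearMap.star_eq_adjoint, ContinuousLinearMap.adjoint_inner_right]
    have e2 : (∑ i, ∑ j, ⟪u i, (![![(‖A‖ : ℂ) • (1 : E →L[ℂ] E), A],
        ![star A, (‖A‖ : ℂ) • 1]] : Fin 2 → Fin 2 → E →L[ℂ] E) i j (u j)⟫_ℂ) =
        ((‖A‖ * ‖u 0‖ ^ 2 + ‖A‖ * ‖u 1‖ ^ 2 + 2 * (⟪u 0, A (u 1)⟫_ℂ).re : ℝ) : ℂ) := by
      have := Complex.add_conj ⟪u 0, A (u 1)⟫_ℂ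
      simp only [Fin.sum_univ_two, Matrix.cons_val_zero, Matrix.cons_val_one, e1,
        smul_apply, one_apply_eq_self, inner_smul_right,
        inner_self_eq_norm_sq_to_K]
      push_cast at this ⊢
      linear_combination this
    rw [e2, Complex.zero_le_real]
    have h1 : -(⟪u 0, A (u 1)⟫_ℂ).re ≤ ‖u 0‖ * (‖A‖ * ‖u 1‖) := by
      refine (neg_le_abs _).trans ((Complex.abs_re_le_norm _).trans
        ((norm_inner_le_norm _ _).trans ?_))
      gcongr
      exact A.le_opNorm _
    nlinarith [mul_nonneg (norm_nonneg A) (sq_nonneg (‖u 0‖ - ‖u 1‖))]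
  have h1 := hφ 2 _ hpos
  have key : ∀ z : ℂ, 0 ≤ (‖A‖ : ℂ) * ⟪v, φ 1 v⟫_ℂ + z * ⟪v, φ A w⟫_ℂ +
      ((starRingEnd ℂ) z * ⟪w, φ (star A) v⟫_ℂ +
        (starRingEnd ℂ z * z) * ((‖A‖ : ℂ) * ⟪w, φ 1 w⟫_ℂ)) := fun z => by
    have := h1 ![v, z • w]
    simp only [Fin.sum_univ_two, Matrix.cons_val_zero, Matrix.cons_val_one, map_smul,
        smul_apply, inner_smul_right, inner_smul_left] at this
    convert this using 1
    ring
  set s := ⟪v, φ A w⟫_ℂ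
  set s' := ⟪w, φ (star A) v⟫_ℂ
  set D := (‖A‖ : ℂ) * ⟪v, φ 1 v⟫_ℂ with hD
  set D' := (‖A‖ : ℂ) * ⟪w, φ 1 w⟫_ℂ with hD'
  -- the quadratic form is real for `z = 1, -1, I`, which makes the off-diagonal terms conjugate
  have k0 := (Complex.le_def.1 (key 1)).2
  have k1 := (Complex.le_def.1 (key (-1))).2
  have k2 := (Complex.le_def.1 (key Complex.I)).2
  simp at k0 k1 k2
  have hs' : s' = (starRingEnd ℂ) s := by
    apply Complex.ext
    · simp only [Complex.conj_re]; linarith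
    · simp only [Complex.conj_im]; linarith
  rcases eq_or_ne s 0 with h0 | h0
  · rw [h0, norm_zero]; positivity
  have hsn : (‖s‖ : ℂ) ≠ 0 := by simpa using h0
  -- the phase of `z` is chosen so that the off-diagonal terms add up to `-2 * ‖s‖`
  have k3 := (Complex.le_def.1 (key (-(starRingEnd ℂ) s / ‖s‖))).1
  have e3 : D + -(starRingEnd ℂ) s / ‖s‖ * s +
      ((starRingEnd ℂ) (-(starRingEnd ℂ) s / ‖s‖) * s' +
        (starRingEnd ℂ (-(starRingEnd ℂ) s / ‖s‖) * (-(starRingEnd ℂ) s / ‖s‖)) * D') =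
      D + D' - 2 * (‖s‖ : ℂ) := by
    have := Complex.conj_mul' s
    simp only [map_div₀, map_neg, Complex.conj_conj, Complex.conj_ofReal, hs']
    field_simp
    linear_combination (-2 * ‖s‖ + D' : ℂ) * this
  rw [e3] at k3
  have b1 : ∀ u : E, ‖u‖ ≤ 1 → ((‖A‖ : ℂ) * ⟪u, φ 1 u⟫_ℂ).re ≤ ‖φ 1‖ * ‖A‖ := fun u hu => by
    refine (Complex.re_le_norm _).trans ?_
    rw [norm_mul, Complex.norm_real, norm_norm, mul_comm]
    gcongr
    refine (norm_inner_le_norm _ _).trans ?_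
    have h1 := (φ 1).le_opNorm u
    have h2 : ‖φ 1‖ * ‖u‖ ≤ ‖φ 1‖ * 1 := by gcongr
    calc ‖u‖ * ‖φ 1 u‖ ≤ 1 * ‖φ 1 u‖ := by gcongr
      _ ≤ ‖φ 1‖ := by linarith
  have b2 := b1 v hv
  have b3 := b1 w hw
  simp at k3
  rw [← hD] at b2
  rw [← hD'] at b3
  linarith

end IsCPMap

theorem opNorm_le_of_inner {T : E →L[ℂ] E} {c : ℝ} (hc : 0 ≤ c)
    (h : ∀ v w : E, ‖v‖ ≤ 1 → ‖w‖ ≤ 1 → ‖⟪v, T w⟫_ℂ‖ ≤ c) : ‖T‖ ≤ c := by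
  refine ContinuousLinearMap.opNorm_le_of_unit_norm hc fun w hw => ?_
  rcases eq_or_ne (T w) 0 with h0 | h0
  · rwa [h0, norm_zero]
  have h1 := h (((‖T w‖⁻¹ : ℝ) : ℂ) • T w) w (by
    rw [norm_smul, Complex.norm_real, norm_inv, norm_norm, inv_mul_cancel₀ (norm_ne_zero_iff.2 h0)])
    hw.le
  rw [inner_smul_left, inner_self_eq_norm_sq_to_K] at h1
  have h2 : ‖T w‖ ≠ 0 := norm_ne_zero_iff.2 h0
  simpa [sq, h2] using h1

/-- The norm of a completely positive map is attained at the unit. -/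
theorem IsCPMap.norm_le [CompleteSpace E] {φ : (E →L[ℂ] E) →L[ℂ] (E →L[ℂ] E)} (hφ : IsCPMap φ) :
    ‖φ‖ ≤ ‖φ 1‖ :=
  φ.opNorm_le_bound (norm_nonneg _) fun A =>
    opNorm_le_of_inner (by positivity) fun _ _ hv hw => hφ.norm_inner_le A hv hw

end PositiveKernels

/-! ### Matrices over C*-algebras of operators -/

section MatrixAlgebra

open scoped ComplexOrder

variable {E : Type*} [NormedAddCommGroup E] [InnerProductSpace ℂ E]
  {A : Type*} [CStarAlgebra A] {n : ℕ}

/-- For the negative part `m` of a self-adjoint element `a` of a C*-algebra, `m * a * m = - m ^ 3`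
has the form `-(star r * r)`, and `a` is nonnegative once this element vanishes. -/
theorem exists_negPart {B : Type*} [CStarAlgebra B] [PartialOrder B] [StarOrderedRing B] {a : B}
    (ha : IsSelfAdjoint a) : ∃ m r : B, star m = m ∧ star m * a * m = -(star r * r) ∧
      (star r * r = 0 → 0 ≤ a) := by
  have hm : 0 ≤ a⁻ := CFC.negPart_nonneg a
  have hmsa : star a⁻ = a⁻ := IsSelfAdjoint.of_nonneg hm
  have hmp : a⁻ * a⁺ = 0 := CFC.negPart_mul_posPart a
  obtain ⟨q, hq⟩ := CStarAlgebra.nonneg_iff_eq_star_mul_self.1 hm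
  have hr : star (q * a⁻) * (q * a⁻) = a⁻ * a⁻ * a⁻ := by
    rw [star_mul, hmsa]
    calc a⁻ * star q * (q * a⁻) = a⁻ * (star q * q) * a⁻ := by noncomm_ring
      _ = a⁻ * a⁻ * a⁻ := by rw [← hq]
  refine ⟨a⁻, q * a⁻, hmsa, ?_, fun h0 => ?_⟩
  · rw [hr, hmsa]
    conv_lhs => enter [1, 2]; rw [← CFC.posPart_sub_negPart a ha]
    rw [mul_sub, hmp]
    noncomm_ring
  · rw [hr] at h0
    have h1 : star (a⁻ * a⁻) * (a⁻ * a⁻) = 0 := by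
      rw [star_mul, hmsa, ← mul_assoc, h0, zero_mul]
    have h2 : star a⁻ * a⁻ = 0 := by rw [hmsa]; exact (CStarRing.star_mul_self_eq_zero_iff _).1 h1
    have h3 := (CStarRing.star_mul_self_eq_zero_iff _).1 h2
    rw [← CFC.posPart_sub_negPart a ha, h3, sub_zero]
    exact CFC.posPart_nonneg a

theorem exists_eq_star_mul_self {B : Type*} [CStarAlgebra B] [PartialOrder B] [StarOrderedRing B]
    {b : B} (hb : 0 ≤ b) : ∃ r, b = star r * r := CStarAlgebra.nonneg_iff_eq_star_mul_self.1 hb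

/-- The action on `Eⁿ` of a matrix of operators. The space `Eⁿ` is the plain function space; its
Hilbert space norm is written out as a sum of squares. -/
def matAct (M : Fin n → Fin n → E →L[ℂ] E) (v : Fin n → E) (i : Fin n) : E := ∑ j, M i j (v j)

theorem sum_inner_matAct (M : Fin n → Fin n → E →L[ℂ] E) (v w : Fin n → E) :
    ∑ i, ∑ j, ⟪v i, M i j (w j)⟫_ℂ = ∑ i, ⟪v i, matAct M w i⟫_ℂ := by
  simp [matAct]

/-- A matrix of operators with vanishing quadratic form vanishes. -/
theorem eq_zero_of_quadratic_form {M : Fin n → Fin n → E →L[ℂ] E}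
    (h : ∀ v : Fin n → E, ∑ i, ∑ j, ⟪v i, M i j (v j)⟫_ℂ = 0) (i j : Fin n) : M i j = 0 := by
  classical
  have hS : ∀ v w : Fin n → E, ∑ i, ∑ j, ⟪v i, M i j (w j)⟫_ℂ = 0 := fun v w => by
    have h1 := h (v + w)
    have h2 := h (v + Complex.I • w)
    simp only [Pi.add_apply, Pi.smul_apply, map_add, map_smul, inner_add_left, inner_add_right,
      inner_smul_left, inner_smul_right, Finset.sum_add_distrib, ← Finset.mul_sum, h v, h w,
      Complex.conj_I] at h1 h2
    have h3 : Complex.I * Complex.I = -1 := Complex.I_mul_I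
    linear_combination (1 / 2 : ℂ) * h1 - (Complex.I / 2) * h2 +
      ((1/2) * (∑ i, ∑ j, ⟪v i, M i j (w j)⟫_ℂ) - (1/2) * (∑ i, ∑ j, ⟪w i, M i j (v j)⟫_ℂ)) * h3
  ext y
  refine ext_inner_left ℂ fun x => ?_
  have := hS (Pi.single i x) (Pi.single j y)
  rw [Finset.sum_eq_single i, Finset.sum_eq_single j] at this
  · simpa using this
  · intro k _ hk; simp [Pi.single_eq_of_ne hk]
  · simp
  · intro k _ hk; simp [Pi.single_eq_of_ne hk]
  · simp

variable [CompleteSpace E] (ι : A →⋆ₐ[ℂ] (E →L[ℂ] E))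

theorem matAct_mul (M N : CStarMatrix (Fin n) (Fin n) A) (v : Fin n → E) :
    matAct (fun i j => ι ((M * N) i j)) v =
      matAct (fun i j => ι (M i j)) (matAct (fun i j => ι (N i j)) v) := by
  ext i
  simp only [matAct, CStarMatrix.mul_apply, map_sum, map_mul, sum_apply,
    mul_apply_eq_comp]
  rw [Finset.sum_comm]

theorem sum_inner_matAct_star (M : CStarMatrix (Fin n) (Fin n) A) (v w : Fin n → E) :
    ∑ i, ⟪matAct (fun i j => ι (M i j)) v i, w i⟫_ℂ =
      ∑ i, ⟪v i, matAct (fun i j => ι ((star M) i j)) w i⟫_ℂ := by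
  simp only [matAct, sum_inner, inner_sum, CStarMatrix.star_apply, map_star,
    ContinuousLinearMap.star_eq_adjoint, ContinuousLinearMap.adjoint_inner_right]
  rw [Finset.sum_comm]

theorem sum_inner_star_mul_self (N : CStarMatrix (Fin n) (Fin n) A) (v : Fin n → E) :
    ∑ i, ∑ j, ⟪v i, ι ((star N * N) i j) (v j)⟫_ℂ =
      ((∑ i, ‖matAct (fun i j => ι (N i j)) v i‖ ^ 2 : ℝ) : ℂ) := by
  rw [sum_inner_matAct (fun i j => ι ((star N * N) i j)), matAct_mul, ← sum_inner_matAct_star]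
  simp [inner_self_eq_norm_sq_to_K]

variable [PartialOrder A] [StarOrderedRing A]

/-- A positive matrix over a C*-algebra of operators is a positive kernel. -/
theorem isPosKernel_of_nonneg {M : CStarMatrix (Fin n) (Fin n) A} (hM : 0 ≤ M) :
    IsPosKernel (fun i j => ι (M i j)) := fun v => by
  obtain ⟨N, rfl⟩ := exists_eq_star_mul_self hM
  rw [sum_inner_star_mul_self, Complex.zero_le_real]
  positivity

/-- Positive kernels with entries in a C*-algebra of operators are positive as matrices over this
algebra: the compression of the kernel by its negative part is both positive and negative. -/
theorem nonneg_of_isPosKernel (hι : Function.Injective ι) {M : CStarMatrix (Fin n) (Fin n) A}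
    (hM : IsPosKernel (fun i j => ι (M i j))) : 0 ≤ M := by
  have hz : ∀ N : CStarMatrix (Fin n) (Fin n) A,
      (∀ v : Fin n → E, ∑ i, ∑ j, ⟪v i, ι (N i j) (v j)⟫_ℂ = 0) → N = 0 := fun N hN => by
    ext i j
    exact hι (by rw [eq_zero_of_quadratic_form hN i j]; simp)
  have hsa : IsSelfAdjoint M := by
    refine (sub_eq_zero.1 (hz (star M - M) fun v => ?_))
    have h1 : ∑ i, ∑ j, ⟪v i, ι (star M i j) (v j)⟫_ℂ =
        (starRingEnd ℂ) (∑ i, ∑ j, ⟪v i, ι (M i j) (v j)⟫_ℂ) := by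
      rw [sum_inner_matAct (fun i j => ι (M i j)), sum_inner_matAct (fun i j => ι (star M i j)),
        ← sum_inner_matAct_star]
      simp
    have h2 := Complex.conj_eq_iff_im.2 (Complex.le_def.1 (hM v)).2.symm
    simp only [CStarMatrix.sub_apply, map_sub, sub_apply, inner_sub_right,
      Finset.sum_sub_distrib]
    rw [h1, h2, sub_self]
  -- `m` is the negative part of `M`
  obtain ⟨m, r, -, hmr, h0⟩ := exists_negPart hsa
  refine h0 (hz _ fun v => le_antisymm ?_ ?_)
  · have h1 : ∑ i, ∑ j, ⟪v i, ι ((star m * M * m) i j) (v j)⟫_ℂ =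
        ∑ i, ∑ j, ⟪matAct (fun i j => ι (m i j)) v i,
          ι (M i j) (matAct (fun i j => ι (m i j)) v j)⟫_ℂ := by
      rw [sum_inner_matAct (fun i j => ι ((star m * M * m) i j)),
        sum_inner_matAct (fun i j => ι (M i j)), matAct_mul, matAct_mul, ← sum_inner_matAct_star,
        sum_inner_matAct_star]
    have h2 := hM (matAct (fun i j => ι (m i j)) v)
    rw [← h1, hmr] at h2
    simpa using h2
  · rw [sum_inner_star_mul_self, Complex.zero_le_real]
    positivity

theorem sum_inner_smul_one_sub (N : CStarMatrix (Fin n) (Fin n) A) (c : ℝ) (v : Fin n → E) :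
    ∑ i, ∑ j, ⟪v i, ι ((algebraMap ℝ (CStarMatrix (Fin n) (Fin n) A) c - star N * N) i j) (v j)⟫_ℂ
      = ((c * ∑ i, ‖v i‖ ^ 2 - ∑ i, ‖matAct (fun i j => ι (N i j)) v i‖ ^ 2 : ℝ) : ℂ) := by
  have h1 : ∀ i j, ι ((algebraMap ℝ (CStarMatrix (Fin n) (Fin n) A) c - star N * N) i j) =
      (if i = j then (c : ℂ) • 1 else 0) - ι ((star N * N) i j) := fun i j => by
    rw [Algebra.algebraMap_eq_smul_one, CStarMatrix.sub_apply, map_sub, CStarMatrix.smul_apply,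
      CStarMatrix.one_apply]
    split_ifs
    · congr 1
      rw [← map_one ι, ← map_smul]
      congr 1
    · simp
  simp only [h1, sub_apply, inner_sub_right, Finset.sum_sub_distrib, sum_inner_star_mul_self]
  push_cast
  congr 1
  rw [Finset.mul_sum]
  refine Finset.sum_congr rfl fun i _ => ?_
  rw [Finset.sum_eq_single i]
  · simp [inner_self_eq_norm_sq_to_K]
  · intro j _ hj
    simp [hj.symm]
  · simp

/-- The norm of a matrix over a C*-algebra bounds its action. -/
theorem sum_norm_matAct_le (M : CStarMatrix (Fin n) (Fin n) A) (v : Fin n → E) :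
    ∑ i, ‖matAct (fun i j => ι (M i j)) v i‖ ^ 2 ≤ ‖M‖ ^ 2 * ∑ i, ‖v i‖ ^ 2 := by
  have h : star M * M ≤ algebraMap ℝ (CStarMatrix (Fin n) (Fin n) A) (‖M‖ ^ 2) :=
    CStarAlgebra.star_mul_le_algebraMap_norm_sq
  have h1 := isPosKernel_of_nonneg ι (sub_nonneg.2 h) v
  rw [sum_inner_smul_one_sub, Complex.zero_le_real] at h1
  linarith

/-- The action of a matrix over a C*-algebra determines its norm. -/
theorem norm_le_of_matAct (hι : Function.Injective ι) {M : CStarMatrix (Fin n) (Fin n) A} {c : ℝ}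
    (hc : 0 ≤ c) (h : ∀ v : Fin n → E,
      ∑ i, ‖matAct (fun i j => ι (M i j)) v i‖ ^ 2 ≤ c ^ 2 * ∑ i, ‖v i‖ ^ 2) : ‖M‖ ≤ c := by
  have h1 : star M * M ≤ algebraMap ℝ (CStarMatrix (Fin n) (Fin n) A) (c ^ 2) := by
    refine sub_nonneg.1 (nonneg_of_isPosKernel ι hι fun v => ?_)
    rw [sum_inner_smul_one_sub, Complex.zero_le_real]
    linarith [h v]
  have h2 : ‖star M * M‖ ≤ c ^ 2 :=
    (CStarAlgebra.norm_le_iff_le_algebraMap _ (sq_nonneg c) (star_mul_self_nonneg M)).2 h1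
  rw [CStarRing.norm_star_mul_self, ← sq] at h2
  exact le_of_sq_le_sq h2 hc

end MatrixAlgebra

/-! ### Series of Lindblad type -/

section LindbladSeries

variable {E : Type*} [NormedAddCommGroup E] [InnerProductSpace ℂ E] [CompleteSpace E]

/-- The map `A ↦ K* A K`. -/
def sandwich (K : E →L[ℂ] E) : (E →L[ℂ] E) →L[ℂ] (E →L[ℂ] E) :=
  ContinuousLinearMap.mulLeftRight ℂ _ (star K) K

@[simp]
theorem sandwich_apply (K A : E →L[ℂ] E) : sandwich K A = star K * A * K := rfl

theorem isCPMap_sandwich (K : E →L[ℂ] E) : IsCPMap (sandwich K) := fun _ _ hM => hM.conj K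

/-- The map `A ↦ G* A + A G`. -/
def driftMap (G : E →L[ℂ] E) : (E →L[ℂ] E) →L[ℂ] (E →L[ℂ] E) :=
  ContinuousLinearMap.mul ℂ _ (star G) + (ContinuousLinearMap.mul ℂ _).flip G

@[simp]
theorem driftMap_apply (G A : E →L[ℂ] E) : driftMap G A = star G * A + A * G := rfl

theorem norm_driftMap_apply_le (G A : E →L[ℂ] E) : ‖driftMap G A‖ ≤ 2 * ‖G‖ * ‖A‖ := by
  rw [driftMap_apply]
  refine (norm_add_le _ _).trans ?_
  have h1 := norm_mul_le (star G) A
  have h2 := norm_mul_le A G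
  rw [norm_star] at h1
  linarith

theorem driftMap_add (G G' : E →L[ℂ] E) : driftMap (G + G') = driftMap G + driftMap G' := by
  ext1 A
  simp only [driftMap_apply, add_apply, star_add, add_mul, mul_add]
  abel

theorem driftMap_zero : driftMap (0 : E →L[ℂ] E) = 0 := by
  ext1 A
  simp

theorem inner_sandwich (K A : E →L[ℂ] E) (v w : E) :
    ⟪v, sandwich K A w⟫_ℂ = ⟪K v, A (K w)⟫_ℂ := by
  simp [ContinuousLinearMap.star_eq_adjoint, ContinuousLinearMap.adjoint_inner_right]

/-- The maps `A ↦ ∑_{a < N} L_a* A L_a + G_N* A + A G_N`. -/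
def lindbladPartial (L G : ℕ → E →L[ℂ] E) (N : ℕ) : (E →L[ℂ] E) →L[ℂ] (E →L[ℂ] E) :=
  ∑ a ∈ Finset.range N, sandwich (L a) + driftMap (G N)

/-- Data of a series of Lindblad type: the maps `lindbladPartial L Gs N` annihilate the identity,
and the drift operators `Gs N` are bounded and converge weakly to `G`. -/
structure IsLindbladSeries (L Gs : ℕ → E →L[ℂ] E) (G : E →L[ℂ] E) : Prop where
  bounded : ∃ C, ∀ N, ‖Gs N‖ ≤ C
  tendsto : WeakTendsto Gs G
  map_one : ∀ N, lindbladPartial L Gs N 1 = 0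

/-- `φ` is the sum of the completely positive map `A ↦ ∑ L_a* A L_a` and of the drift
`A ↦ G* A + A G`, where the series converges weakly, and `φ` annihilates the identity. -/
structure IsLindbladGenerator (L : ℕ → E →L[ℂ] E) (G : E →L[ℂ] E)
    (φ : (E →L[ℂ] E) →L[ℂ] (E →L[ℂ] E)) : Prop where
  map_one : φ 1 = 0
  summable : ∀ v, Summable fun a => ‖L a v‖ ^ 2
  hasSum : ∀ A v w, HasSum (fun a => ⟪L a v, A (L a w)⟫_ℂ) ⟪v, (φ A - driftMap G A) w⟫_ℂ
  isCPMap : IsCPMap (φ - driftMap G)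

variable {L Gs : ℕ → E →L[ℂ] E} {G : E →L[ℂ] E}

namespace IsLindbladSeries

theorem sum_norm_sq_le (h : IsLindbladSeries L Gs G) {C : ℝ} (hC : ∀ N, ‖Gs N‖ ≤ C) (N : ℕ)
    (v : E) : ∑ a ∈ Finset.range N, ‖L a v‖ ^ 2 ≤ 2 * C * ‖v‖ ^ 2 := by
  have h1 := congrArg (fun T : E →L[ℂ] E => ⟪v, T v⟫_ℂ) (h.map_one N)
  simp only [lindbladPartial, add_apply, sum_apply, inner_add_right, inner_sum, inner_sandwich,
    zero_apply, inner_zero_right, one_apply_eq_self, inner_self_eq_norm_sq_to_K] at h1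
  have h2 : ‖⟪v, driftMap (Gs N) 1 v⟫_ℂ‖ ≤ 2 * C * ‖v‖ ^ 2 := by
    have h3 : ‖driftMap (Gs N) 1‖ ≤ 2 * C := by
      refine (norm_driftMap_apply_le _ _).trans ?_
      have : ‖(1 : E →L[ℂ] E)‖ ≤ 1 := ContinuousLinearMap.norm_id_le
      have h0 := norm_nonneg (Gs N)
      have := hC N
      calc 2 * ‖Gs N‖ * ‖(1 : E →L[ℂ] E)‖ ≤ 2 * ‖Gs N‖ * 1 := by gcongr
        _ ≤ 2 * C := by linarith
    calc ‖⟪v, driftMap (Gs N) 1 v⟫_ℂ‖ ≤ ‖v‖ * (2 * C * ‖v‖) := by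
          refine (norm_inner_le_norm _ _).trans ?_
          gcongr
          exact ContinuousLinearMap.le_of_opNorm_le _ h3 v
      _ = 2 * C * ‖v‖ ^ 2 := by ring
  have h4 : ((∑ a ∈ Finset.range N, ‖L a v‖ ^ 2 : ℝ) : ℂ) = -⟪v, driftMap (Gs N) 1 v⟫_ℂ := by
    push_cast
    linear_combination h1
  have h5 : ‖((∑ a ∈ Finset.range N, ‖L a v‖ ^ 2 : ℝ) : ℂ)‖ =
      ∑ a ∈ Finset.range N, ‖L a v‖ ^ 2 := by
    rw [Complex.norm_real, Real.norm_of_nonneg (by positivity)]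
  rw [← h5, h4, norm_neg]
  exact h2

theorem summable (h : IsLindbladSeries L Gs G) (v : E) : Summable fun a => ‖L a v‖ ^ 2 := by
  obtain ⟨C, hC⟩ := h.bounded
  exact summable_of_sum_range_le (fun _ => sq_nonneg _) (fun N => h.sum_norm_sq_le hC N v)

theorem summable_inner (h : IsLindbladSeries L Gs G) (A : E →L[ℂ] E) (v w : E) :
    Summable fun a => ⟪L a v, A (L a w)⟫_ℂ :=
  Summable.of_norm_bounded (((h.summable v).add (h.summable w)).mul_left ‖A‖)
    fun _ => norm_inner_le_add_sq le_rfl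

theorem tendsto_driftMap (h : IsLindbladSeries L Gs G) (A : E →L[ℂ] E) :
    WeakTendsto (fun N => driftMap (Gs N) A) (driftMap G A) := by
  simp only [driftMap_apply]
  exact (h.tendsto.star.mul_right A).add (h.tendsto.mul_left A)

/-- The completely positive part of the partial sums is bounded by its value at the identity, which
is opposite to that of the drift; hence only the drift operators need to be bounded. -/
theorem norm_lindbladPartial_apply_le (h : IsLindbladSeries L Gs G) {C : ℝ}
    (hC : ∀ N, ‖Gs N‖ ≤ C) (N : ℕ) (A : E →L[ℂ] E) :
    ‖lindbladPartial L Gs N A‖ ≤ 4 * C * ‖A‖ := by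
  set S : (E →L[ℂ] E) →L[ℂ] (E →L[ℂ] E) := ∑ a ∈ Finset.range N, sandwich (L a) with hS
  have hCP : IsCPMap S := IsCPMap.sum _ fun a _ => isCPMap_sandwich (L a)
  have h0 := norm_nonneg (Gs N)
  have hd : ∀ B : E →L[ℂ] E, ‖driftMap (Gs N) B‖ ≤ 2 * C * ‖B‖ := fun B => by
    refine (norm_driftMap_apply_le _ _).trans ?_
    gcongr
    exact hC N
  have h1 : ‖S 1‖ ≤ 2 * C := by
    have : S 1 = - driftMap (Gs N) 1 := eq_neg_of_add_eq_zero_left (h.map_one N)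
    rw [this, norm_neg]
    refine (hd 1).trans ?_
    have : ‖(1 : E →L[ℂ] E)‖ ≤ 1 := ContinuousLinearMap.norm_id_le
    have h2 : 0 ≤ 2 * C := by linarith [hC N]
    nlinarith
  have h2 : ‖S A‖ ≤ 2 * C * ‖A‖ := S.le_of_opNorm_le (hCP.norm_le.trans h1) A
  calc ‖lindbladPartial L Gs N A‖ ≤ ‖S A‖ + ‖driftMap (Gs N) A‖ := norm_add_le _ _
    _ ≤ 4 * C * ‖A‖ := by linarith [hd A]

/-- The partial sums of a series of Lindblad type converge weakly, on every bounded operator. -/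
theorem exists_generator (h : IsLindbladSeries L Gs G) :
    ∃ φ, IsLindbladGenerator L G φ ∧
      ∀ A, WeakTendsto (fun N => lindbladPartial L Gs N A) (φ A) := by
  obtain ⟨C, hC⟩ := h.bounded
  have hex : ∀ A, ∃ B, WeakTendsto (fun N => lindbladPartial L Gs N A) B := fun A => by
    refine exists_weakTendsto (h.norm_lindbladPartial_apply_le hC · A) fun v w => ?_
    refine ⟨(∑' a, ⟪L a v, A (L a w)⟫_ℂ) + ⟪v, driftMap G A w⟫_ℂ, ?_⟩
    simp only [lindbladPartial, add_apply, sum_apply, inner_add_right, inner_sum, inner_sandwich]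
    exact (h.summable_inner A v w).hasSum.tendsto_sum_nat.add (h.tendsto_driftMap A v w)
  choose f hf using hex
  let φ₀ : (E →L[ℂ] E) →ₗ[ℂ] (E →L[ℂ] E) :=
    { toFun := f
      map_add' := fun A B => (hf (A + B)).unique (by simpa using (hf A).add (hf B))
      map_smul' := fun c A => (hf (c • A)).unique (by simpa using (hf A).smul c) }
  have hC0 : 0 ≤ C := (norm_nonneg _).trans (hC 0)
  let φ := φ₀.mkContinuous (4 * C) fun A => (hf A).norm_le (by positivity)
    (Eventually.of_forall fun N => h.norm_lindbladPartial_apply_le hC N A)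
  have hφ : ∀ A, WeakTendsto (fun N => lindbladPartial L Gs N A) (φ A) := hf
  have hS : ∀ A, WeakTendsto (fun N => (∑ a ∈ Finset.range N, sandwich (L a) A))
      ((φ - driftMap G) A) := fun A => by
    have := (hφ A).sub (h.tendsto_driftMap A)
    simpa [lindbladPartial] using this
  refine ⟨φ, ⟨?_, h.summable, fun A v w => ?_, fun n M hM => ?_⟩, hφ⟩
  · refine (hφ 1).unique ?_
    simp only [h.map_one]
    exact WeakTendsto.const 0
  · have h1 := (h.summable_inner A v w).hasSum
    have h2 := hS A v w
    simp only [sum_apply, inner_sum, inner_sandwich] at h2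
    rwa [tendsto_nhds_unique h1.tendsto_sum_nat h2] at h1
  · refine IsPosKernel.of_weakTendsto (fun N => ?_) fun i j => hS (M i j)
    have := (IsCPMap.sum (Finset.range N) fun a _ => isCPMap_sandwich (L a)) n M hM
    simpa using this

end IsLindbladSeries

namespace IsLindbladGenerator

variable {φ : (E →L[ℂ] E) →L[ℂ] (E →L[ℂ] E)}

/-- Normality: generators of Lindblad type are weakly continuous on bounded sequences. -/
theorem weakTendsto (h : IsLindbladGenerator L G φ) {X : ℕ → E →L[ℂ] E} {Y : E →L[ℂ] E} {c : ℝ}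
    (hX : ∀ n, ‖X n‖ ≤ c) (hXY : WeakTendsto X Y) : WeakTendsto (fun n => φ (X n)) (φ Y) := by
  have h1 : WeakTendsto (fun n => φ (X n) - driftMap G (X n)) (φ Y - driftMap G Y) := fun v w => by
    simp only [← (h.hasSum _ v w).tsum_eq]
    exact tendsto_tsum_of_dominated_convergence (((h.summable v).add (h.summable w)).mul_left c)
      (fun a => hXY _ _) (Eventually.of_forall fun n a => norm_inner_le_add_sq (hX n))
  have h2 : WeakTendsto (fun n => driftMap G (X n)) (driftMap G Y) :=
    (hXY.mul_left _).add (hXY.mul_right _)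
  simpa using h1.add h2

/-- A generator commutes with left multiplication by operators which commute with its data. -/
theorem map_mul_left (h : IsLindbladGenerator L G φ) {B : E →L[ℂ] E}
    (hL : ∀ a, Commute (star (L a)) B) (hG : Commute (star G) B) (A : E →L[ℂ] E) :
    φ (B * A) = B * φ A := by
  have h1 : φ (B * A) - driftMap G (B * A) = B * (φ A - driftMap G A) := by
    ext1 w
    refine ext_inner_left ℂ fun v => ?_
    have e1 := h.hasSum (B * A) v w
    have e2 := h.hasSum A (star B v) w
    have hL' : ∀ a x, L a (star B x) = star B (L a x) := fun a x => by
      have := congrArg star (hL a).eq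
      rw [star_mul, star_mul, star_star] at this
      exact (congrArg (fun T : E →L[ℂ] E => T x) this).symm
    simp only [hL'] at e2
    simp only [ContinuousLinearMap.star_eq_adjoint, ContinuousLinearMap.adjoint_inner_left] at e2
    exact e1.unique e2
  have h2 : driftMap G (B * A) = B * driftMap G A := by
    rw [driftMap_apply, driftMap_apply, ← mul_assoc, hG.eq, mul_add, mul_assoc, mul_assoc]
  rw [h2, mul_sub] at h1
  exact sub_left_inj.1 h1

/-- A generator commutes with right multiplication by operators which commute with its data. -/
theorem map_mul_right (h : IsLindbladGenerator L G φ) {B : E →L[ℂ] E}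
    (hL : ∀ a, Commute (L a) B) (hG : Commute G B) (A : E →L[ℂ] E) :
    φ (A * B) = φ A * B := by
  have h1 : φ (A * B) - driftMap G (A * B) = (φ A - driftMap G A) * B := by
    ext1 w
    refine ext_inner_left ℂ fun v => ?_
    have e1 := h.hasSum (A * B) v w
    have e2 := h.hasSum A v (B w)
    have hL' : ∀ a x, L a (B x) = B (L a x) := fun a x =>
      congrArg (fun T : E →L[ℂ] E => T x) (hL a).eq
    simp only [hL'] at e2
    exact e1.unique e2
  have h2 : driftMap G (A * B) = driftMap G A * B := by
    rw [driftMap_apply, driftMap_apply, add_mul, mul_assoc, mul_assoc, mul_assoc, hG.eq]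
  rw [h2, sub_mul] at h1
  exact sub_left_inj.1 h1

end IsLindbladGenerator

end LindbladSeries

/-! ### Normalization of Lindblad operators -/

section Normalization

variable {E : Type*} [NormedAddCommGroup E] [InnerProductSpace ℂ E] [CompleteSpace E]

/-- The contribution to the drift operator of a Lindblad operator `l` which is shifted to
`l - c`. -/
def driftTerm (l : E →L[ℂ] E) (c : ℂ) : E →L[ℂ] E :=
  (1 / 2 : ℂ) • ((starRingEnd ℂ c) • (l - c • 1) - c • star (l - c • 1)
    - star (l - c • 1) * (l - c • 1))

/-- The drift operator of the first `N` Lindblad operators, shifted by `c`, and of the Hamiltonian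
`h`, shifted by `α`. -/
def drift (h : E →L[ℂ] E) (l : ℕ → E →L[ℂ] E) (α : ℝ) (c : ℕ → ℂ) (N : ℕ) : E →L[ℂ] E :=
  -Complex.I • (h - (α : ℂ) • 1) + ∑ a ∈ Finset.range N, driftTerm (l a) (c a)

/-- Lindblad operators may be shifted by multiples of the identity, if the drift is adjusted. -/
theorem lindbladTerm_eq (l : E →L[ℂ] E) (c : ℂ) (A : E →L[ℂ] E) :
    lindbladTerm l A = sandwich (l - c • 1) A + driftMap (driftTerm l c) A := by
  simp only [lindbladTerm, sandwich_apply, driftMap_apply, driftTerm, star_smul, star_sub, star_mul,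
    star_one, star_star, starRingEnd_apply, mul_sub, sub_mul, smul_sub, smul_mul_assoc,
    mul_smul_comm, mul_one, one_mul, mul_assoc, smul_add]
  simp only [Complex.star_def, map_div₀, map_one, map_ofNat]
  module

theorem partialGenerator_eq {h : E →L[ℂ] E} (hh : star h = h) (l : ℕ → E →L[ℂ] E) (α : ℝ)
    (c : ℕ → ℂ) (N : ℕ) (A : E →L[ℂ] E) :
    Complex.I • (h * A - A * h) + ∑ a ∈ Finset.range N, lindbladTerm (l a) A =
      lindbladPartial (fun a => l a - c a • 1) (drift h l α c) N A := by
  have h1 : driftMap (drift h l α c N) = driftMap (-Complex.I • (h - (α : ℂ) • 1)) +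
      ∑ a ∈ Finset.range N, driftMap (driftTerm (l a) (c a)) := by
    rw [drift, driftMap_add]
    congr 1
    induction N with
    | zero => simp [driftMap_zero]
    | succ N ih => rw [Finset.sum_range_succ, Finset.sum_range_succ, driftMap_add, ih]
  have h2 : driftMap (-Complex.I • (h - (α : ℂ) • 1)) A = Complex.I • (h * A - A * h) := by
    simp only [driftMap_apply, star_smul, star_sub, hh, star_neg, star_one, Complex.star_def,
      Complex.conj_I, Complex.conj_ofReal, sub_mul, mul_sub, smul_mul_assoc, mul_smul_comm, mul_one,
      one_mul, smul_sub, neg_neg]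
    module
  rw [Finset.sum_congr rfl fun a _ => lindbladTerm_eq (l a) (c a) A, Finset.sum_add_distrib,
    lindbladPartial, h1]
  simp only [add_apply, sum_apply, h2]
  abel

/-- If the series of Lindblad terms converges strongly, then it becomes a series of Lindblad
type with convergent drift once the expectations of all Lindblad operators in a fixed unit vector
are subtracted.  The drift is controlled by the norm of the sum, because it can be read off from the
values of the sum at the rank one operators `|w⟩⟨e|`. -/
theorem exists_isLindbladSeries {h : E →L[ℂ] E} (hh : star h = h) {l : ℕ → E →L[ℂ] E}
    {φ : (E →L[ℂ] E) → (E →L[ℂ] E)}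
    (hφ : ∀ b w, Tendsto (fun N => (Complex.I • (h * b - b * h) +
      ∑ a ∈ Finset.range N, lindbladTerm (l a) b) w) atTop (𝓝 (φ b w)))
    {e : E} (he : ‖e‖ = 1) {C : ℝ} (hC : ∀ b, ‖φ b‖ ≤ C * ‖b‖) :
    ∃ (α : ℝ) (c : ℕ → ℂ) (G : E →L[ℂ] E),
      IsLindbladSeries (fun a => l a - c a • 1) (drift h l α c) G ∧ ‖G‖ ≤ 2 * C := by
  set α : ℝ := (⟪e, h e⟫_ℂ).re with hα
  set c : ℕ → ℂ := fun a => ⟪e, l a e⟫_ℂ with hc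
  set L : ℕ → E →L[ℂ] E := fun a => l a - c a • 1 with hL
  have hee : ⟪e, e⟫_ℂ = 1 := by rw [inner_self_eq_norm_sq_to_K, he]; simp
  have hLe : ∀ a, ⟪e, L a e⟫_ℂ = 0 := fun a => by
    simp [hL, hc, he]
  have hstar : ∀ (T : E →L[ℂ] E) x y, ⟪x, star T y⟫_ℂ = ⟪T x, y⟫_ℂ := fun T x y => by
    rw [ContinuousLinearMap.star_eq_adjoint, ContinuousLinearMap.adjoint_inner_right]
  set Gs := drift h l α c with hGs
  set ρ : ℕ → ℂ := fun N => ⟪e, Gs N e⟫_ℂ with hρdef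
  -- the normalizations make the expectation of the drift in the state `e` real
  have hρ : ∀ N, (starRingEnd ℂ) (ρ N) = ρ N := fun N => by
    have h0 : (starRingEnd ℂ) ⟪e, h e⟫_ℂ = ⟪e, h e⟫_ℂ := by
      rw [inner_conj_symm, ← hstar, hh]
    have h1 : ⟪e, h e⟫_ℂ = (α : ℂ) := by rw [hα]; exact (Complex.conj_eq_iff_re.1 h0).symm
    have h2 : ∀ a, ⟪e, driftTerm (l a) (c a) e⟫_ℂ = ((-(1 / 2) * ‖L a e‖ ^ 2 : ℝ) : ℂ) :=
      fun a => by
        have h3 : ⟪L a e, e⟫_ℂ = 0 := by rw [← inner_conj_symm, hLe, map_zero]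
        have h4 : driftTerm (l a) (c a) =
            (1 / 2 : ℂ) • ((starRingEnd ℂ (c a)) • L a - c a • star (L a) - star (L a) * L a) := rfl
        rw [h4]
        simp only [smul_apply, sub_apply, mul_apply_eq_comp, inner_smul_right, inner_sub_right,
          hstar, hLe, h3, inner_self_eq_norm_sq_to_K]
        rw [show (RCLike.ofReal ‖L a e‖ : ℂ) = Complex.ofReal ‖L a e‖ from rfl]
        push_cast
        ring
    have h5 : ρ N = ((∑ a ∈ Finset.range N, -(1 / 2) * ‖L a e‖ ^ 2 : ℝ) : ℂ) := by
      simp only [hρdef, hGs, drift, add_apply, sum_apply, smul_apply, sub_apply, inner_add_right,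
        inner_sum, h2, inner_smul_right, inner_sub_right, one_apply_eq_self, h1, hee]
      push_cast
      ring
    rw [h5, Complex.conj_ofReal]
  have hpart : ∀ N b, Complex.I • (h * b - b * h) +
      ∑ a ∈ Finset.range N, lindbladTerm (l a) b = lindbladPartial L Gs N b :=
    fun N b => partialGenerator_eq hh l α c N b
  simp only [hpart] at hφ
  -- for `A = |w⟩⟨e|` the terms `L_a* A L_a` vanish on `e`, since `⟪e, L_a e⟫ = 0`: only the drift
  -- is left
  set R : E → E →L[ℂ] E := fun w => InnerProductSpace.rankOne ℂ w e with hR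
  have hRx : ∀ w x, R w x = ⟪e, x⟫_ℂ • w := fun w x => by
    simp [hR, InnerProductSpace.rankOne_apply]
  have hRn : ∀ w, ‖R w‖ ≤ ‖w‖ := fun w =>
    ContinuousLinearMap.opNorm_le_bound _ (norm_nonneg _) fun x => by
      rw [hRx, norm_smul, mul_comm]
      gcongr
      simpa [he] using norm_inner_le_norm (𝕜 := ℂ) e x
  have heval : ∀ N w, lindbladPartial L Gs N (R w) e = star (Gs N) w + ρ N • w := fun N w => by
    simp [lindbladPartial, add_apply, sum_apply, sandwich_apply, driftMap_apply,
      mul_apply_eq_comp, hRx, hLe, he, hρdef]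
  have hρlim : Tendsto ρ atTop (𝓝 ((1 / 2 : ℂ) * ⟪e, φ (R e) e⟫_ℂ)) := by
    have h1 : Tendsto (fun N => ⟪e, lindbladPartial L Gs N (R e) e⟫_ℂ) atTop
        (𝓝 ⟪e, φ (R e) e⟫_ℂ) :=
      (continuous_const.inner continuous_id).continuousAt.tendsto.comp (hφ (R e) e)
    have h2 : ∀ N, ⟪e, lindbladPartial L Gs N (R e) e⟫_ℂ = 2 * ρ N := fun N => by
      rw [heval, inner_add_right, inner_smul_right, hee, hstar, ← inner_conj_symm]
      have := hρ N
      simp only [hρdef] at this ⊢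
      rw [this]
      ring
    simp only [h2] at h1
    simpa using h1.const_mul (1 / 2 : ℂ)
  set ρ' : ℂ := (1 / 2 : ℂ) * ⟪e, φ (R e) e⟫_ℂ with hρ'
  have hGlim : ∀ w, Tendsto (fun N => star (Gs N) w) atTop (𝓝 (φ (R w) e - ρ' • w)) := fun w => by
    have := (hφ (R w) e).sub (hρlim.smul_const w)
    simpa [heval] using this
  obtain ⟨D, hD⟩ : ∃ D, ∀ N, ‖star (Gs N)‖ ≤ D := by
    refine banach_steinhaus fun w => ?_
    obtain ⟨D, hD⟩ := (hGlim w).norm.bddAbove_range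
    exact ⟨D, fun N => hD ⟨N, rfl⟩⟩
  obtain ⟨G', hG'⟩ := exists_weakTendsto hD fun v w =>
    ⟨_, (continuous_const.inner continuous_id).continuousAt.tendsto.comp (hGlim w)⟩
  have hG'w : ∀ w, G' w = φ (R w) e - ρ' • w := fun w => ext_inner_left ℂ fun v =>
    tendsto_nhds_unique (hG' v w)
      ((continuous_const.inner continuous_id).continuousAt.tendsto.comp (hGlim w))
  have hφe : ∀ w, ‖φ (R w) e‖ ≤ C * ‖w‖ := fun w => by
    have h1 := (φ (R w)).le_opNorm e
    have h2 := hC (R w)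
    rw [he, mul_one] at h1
    have hC0 : 0 ≤ C := by
      have h3 := (norm_nonneg _).trans (hC 1)
      have h4 : (0 : ℝ) < ‖(1 : E →L[ℂ] E)‖ := by
        rw [norm_pos_iff]
        intro h5
        have : e = 0 := congrArg (fun T : E →L[ℂ] E => T e) h5
        rw [this, norm_zero] at he
        exact zero_ne_one he
      exact nonneg_of_mul_nonneg_left h3 h4
    exact h1.trans (h2.trans (mul_le_mul_of_nonneg_left (hRn w) hC0))
  have hC0 : 0 ≤ C := by simpa [he] using (norm_nonneg _).trans (hφe e)
  have hρn : ‖ρ'‖ ≤ C := by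
    have h1 : ‖⟪e, φ (R e) e⟫_ℂ‖ ≤ C := by
      refine (norm_inner_le_norm _ _).trans ?_
      simpa [he] using hφe e
    rw [hρ', norm_mul]
    norm_num
    linarith
  refine ⟨α, c, star G', ⟨⟨D, fun N => by simpa using hD N⟩, by simpa using hG'.star,
    fun N => ?_⟩, ?_⟩
  · rw [← hpart N 1]
    simp [lindbladTerm, ← two_smul ℂ, smul_smul]
  · rw [norm_star]
    refine ContinuousLinearMap.opNorm_le_bound _ (by positivity) fun w => ?_
    rw [hG'w]
    calc ‖φ (R w) e - ρ' • w‖ ≤ ‖φ (R w) e‖ + ‖ρ' • w‖ := norm_sub_le _ _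
      _ ≤ C * ‖w‖ + C * ‖w‖ := by
        gcongr
        · exact hφe w
        · rw [norm_smul]; gcongr
      _ = 2 * C * ‖w‖ := by ring

end Normalization

/-! ### Matrix elements -/

section Coefficients

variable {ι : Type*}

open Classical in
/-- The vector of the standard orthonormal basis of `ℓ²(ι)` with label `i`. -/
def basisVec (i : ι) : lp (fun _ : ι => ℂ) 2 := lp.single 2 i 1

theorem inner_basisVec (i : ι) (f : lp (fun _ : ι => ℂ) 2) : ⟪basisVec i, f⟫_ℂ = f i := by
  classical
  rw [basisVec, lp.inner_single_left]
  simp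

open Classical in
theorem basisVec_apply (i j : ι) : basisVec i j = if j = i then (1 : ℂ) else 0 := by
  rw [basisVec, lp.single_apply]
  split_ifs with h
  · subst h; simp
  · simp [Pi.single_eq_of_ne h]

theorem norm_basisVec (i : ι) : ‖basisVec i‖ = 1 := by
  classical
  simp [basisVec]

/-- The matrix elements of an operator on `ℓ²(ι)`. -/
def coeff (A : lp (fun _ : ι => ℂ) 2 →L[ℂ] lp (fun _ : ι => ℂ) 2) (i j : ι) : ℂ := A (basisVec j) i

theorem coeff_eq_inner (A : lp (fun _ : ι => ℂ) 2 →L[ℂ] lp (fun _ : ι => ℂ) 2) (i j : ι) :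
    coeff A i j = ⟪basisVec i, A (basisVec j)⟫_ℂ := (inner_basisVec _ _).symm

theorem star_basisVec_apply (A : lp (fun _ : ι => ℂ) 2 →L[ℂ] lp (fun _ : ι => ℂ) 2) (i j : ι) :
    star A (basisVec i) j = (starRingEnd ℂ) (coeff A i j) := by
  rw [coeff_eq_inner, inner_conj_symm, ← inner_basisVec, ContinuousLinearMap.star_eq_adjoint,
    ContinuousLinearMap.adjoint_inner_right]

theorem ext_coeff {A B : lp (fun _ : ι => ℂ) 2 →L[ℂ] lp (fun _ : ι => ℂ) 2}
    (h : ∀ i j, coeff A i j = coeff B i j) : A = B := by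
  have h1 : ∀ i, star A (basisVec i) = star B (basisVec i) := fun i => by
    ext j
    rw [star_basisVec_apply, star_basisVec_apply, h]
  ext f i
  rw [← inner_basisVec, ← inner_basisVec, ← ContinuousLinearMap.adjoint_inner_left,
    ← ContinuousLinearMap.adjoint_inner_left, ← ContinuousLinearMap.star_eq_adjoint,
    ← ContinuousLinearMap.star_eq_adjoint, h1]

/-- Matrix multiplication. -/
theorem hasSum_coeff_mul (A B : lp (fun _ : ι => ℂ) 2 →L[ℂ] lp (fun _ : ι => ℂ) 2) (i j : ι) :
    HasSum (fun k => coeff A i k * coeff B k j) (coeff (A * B) i j) := by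
  have h := lp.hasSum_inner (𝕜 := ℂ) (star A (basisVec i)) (B (basisVec j))
  have h1 : ⟪star A (basisVec i), B (basisVec j)⟫_ℂ = coeff (A * B) i j := by
    rw [ContinuousLinearMap.star_eq_adjoint, ContinuousLinearMap.adjoint_inner_left,
      inner_basisVec]
    rfl
  have h2 : ∀ k, ⟪star A (basisVec i) k, B (basisVec j) k⟫_ℂ = coeff A i k * coeff B k j :=
    fun k => by
      rw [star_basisVec_apply]
      simp [coeff, mul_comm]
  rw [h1] at h
  simpa only [h2] using h

end Coefficients

/-! ### Supports of operators -/

section Supports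

variable {Γ : Type*} {H : Γ → Type*} [∀ x, NormedAddCommGroup (H x)]
  [∀ x, InnerProductSpace ℂ (H x)] [∀ x, CompleteSpace (H x)]

/-- The operator `A` acts on the sites in `s` only: its matrix elements are those of an operator
of the form `a ⊗ 1`. -/
structure ActsOn (s : Set Γ) (A : Op H) : Prop where
  eq_zero : ∀ σ τ : Config H, (∃ x, x ∉ s ∧ σ x ≠ τ x) → coeff A σ τ = 0
  congr : ∀ σ τ σ' τ' : Config H, (∀ x, x ∉ s → σ x = τ x) → (∀ x, x ∉ s → σ' x = τ' x) →
    (∀ x, x ∈ s → σ x = σ' x) → (∀ x, x ∈ s → τ x = τ' x) → coeff A σ τ = coeff A σ' τ'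

theorem ActsOn.mono {s t : Set Γ} (hst : s ⊆ t) {A : Op H} (hA : ActsOn s A) : ActsOn t A where
  eq_zero σ τ := fun ⟨x, hx, h⟩ => hA.eq_zero σ τ ⟨x, fun h' => hx (hst h'), h⟩
  congr σ τ σ' τ' h1 h2 h3 h4 := by
    by_cases h : ∀ x, x ∉ s → σ x = τ x
    · refine hA.congr σ τ σ' τ' h (fun x hx => ?_) (fun x hx => h3 x (hst hx))
        (fun x hx => h4 x (hst hx))
      by_cases hxt : x ∈ t
      · rw [← h3 x hxt, ← h4 x hxt, h x hx]
      · exact h2 x hxt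
    · push Not at h
      obtain ⟨x, hx, hne⟩ := h
      have hxt : x ∈ t := by
        by_contra hxt
        exact hne (h1 x hxt)
      rw [hA.eq_zero σ τ ⟨x, hx, hne⟩,
        hA.eq_zero σ' τ' ⟨x, hx, by rwa [← h3 x hxt, ← h4 x hxt]⟩]

open Classical in
/-- The configuration which agrees with `σ` on `s` and with `τ` elsewhere. -/
def glue (s : Set Γ) (σ τ : Config H) : Config H := fun x => if x ∈ s then σ x else τ x

theorem glue_of_mem {s : Set Γ} {x : Γ} (hx : x ∈ s) (σ τ : Config H) : glue s σ τ x = σ x :=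
  if_pos hx

theorem glue_of_notMem {s : Set Γ} {x : Γ} (hx : x ∉ s) (σ τ : Config H) : glue s σ τ x = τ x :=
  if_neg hx

/-- The only intermediate configuration which contributes to a matrix element of a product of
operators with disjoint supports. -/
theorem ActsOn.coeff_mul {s t : Set Γ} (hst : Disjoint s t) {A B : Op H} (hA : ActsOn s A)
    (hB : ActsOn t B) (σ τ : Config H) :
    coeff (A * B) σ τ = coeff A σ (glue s τ σ) * coeff B (glue s τ σ) τ := by
  refine (hasSum_coeff_mul A B σ τ).unique (hasSum_single _ fun ρ hρ => ?_)
  by_contra h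
  obtain ⟨h1, h2⟩ := mul_ne_zero_iff.1 h
  apply hρ
  ext1 x
  by_cases hx : x ∈ s
  · rw [glue_of_mem hx]
    by_contra hne
    exact h2 (hB.eq_zero _ _ ⟨x, Set.disjoint_left.1 hst hx, hne⟩)
  · rw [glue_of_notMem hx]
    by_contra hne
    exact h1 (hA.eq_zero _ _ ⟨x, hx, fun h => hne h.symm⟩)

/-- Operators with disjoint supports commute.  The supports may be infinite, which covers local
observables together with the matrix units outside of a finite volume. -/
theorem ActsOn.commute {s t : Set Γ} (hst : Disjoint s t) {A B : Op H} (hA : ActsOn s A)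
    (hB : ActsOn t B) : Commute A B := by
  refine ext_coeff fun σ τ => ?_
  rw [hA.coeff_mul hst hB, hB.coeff_mul hst.symm hA]
  by_cases h : ∃ x, (x ∉ s ∧ x ∉ t) ∧ σ x ≠ τ x
  · obtain ⟨x, ⟨hxs, hxt⟩, hne⟩ := h
    rw [hB.eq_zero (glue s τ σ) τ ⟨x, hxt, by rwa [glue_of_notMem hxs]⟩,
      hA.eq_zero (glue t τ σ) τ ⟨x, hxs, by rwa [glue_of_notMem hxt]⟩, mul_zero, mul_zero]
  · push Not at h
    have d1 : ∀ x, x ∈ s → x ∉ t := fun x hx => Set.disjoint_left.1 hst hx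
    have d2 : ∀ x, x ∈ t → x ∉ s := fun x hx => Set.disjoint_right.1 hst hx
    have e1 : coeff A σ (glue s τ σ) = coeff A (glue t τ σ) τ := by
      refine hA.congr _ _ _ _ (fun x hx => by rw [glue_of_notMem hx]) (fun x hx => ?_)
        (fun x hx => by rw [glue_of_notMem (d1 x hx)]) (fun x hx => by rw [glue_of_mem hx])
      by_cases hxt : x ∈ t
      · rw [glue_of_mem hxt]
      · rw [glue_of_notMem hxt, h x ⟨hx, hxt⟩]
    have e2 : coeff B (glue s τ σ) τ = coeff B σ (glue t τ σ) := by
      refine hB.congr _ _ _ _ (fun x hx => ?_) (fun x hx => by rw [glue_of_notMem hx])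
        (fun x hx => by rw [glue_of_notMem (d2 x hx)]) (fun x hx => by rw [glue_of_mem hx])
      by_cases hxs : x ∈ s
      · rw [glue_of_mem hxs]
      · rw [glue_of_notMem hxs, h x ⟨hxs, hx⟩]
    rw [e1, e2, mul_comm]

end Supports

/-! ### Matrix units and blocks -/

section Fibers

variable {Γ : Type*} {H : Γ → Type*} [∀ x, NormedAddCommGroup (H x)]
  [∀ x, InnerProductSpace ℂ (H x)] [∀ x, CompleteSpace (H x)]

instance nonempty_basisIndex {E : Type*} [NormedAddCommGroup E] [InnerProductSpace ℂ E]
    [CompleteSpace E] [Nontrivial E] : Nonempty (BasisIndex E) := by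
  by_contra h
  rw [not_nonempty_iff] at h
  obtain ⟨b, -⟩ := (exists_hilbertBasis ℂ E).choose_spec
  have h' : IsEmpty ((exists_hilbertBasis ℂ E).choose : Set E) := h
  have : ∀ v : E, v = 0 := fun v => by
    apply b.repr.injective
    ext i
    exact h'.elim i
  obtain ⟨v, hv⟩ := exists_ne (0 : E)
  exact hv (this v)

theorem splitConfig_fst (X : Finset Γ) (σ : Config H) (x : {x // x ∉ X}) :
    (splitConfig X σ).1 x = σ x := rfl

theorem splitConfig_snd (X : Finset Γ) (σ : Config H) (x : {x // x ∈ X}) :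
    (splitConfig X σ).2 x = σ x := rfl

/-- The bounded operator `f ↦ fiber X η f`. -/
def fiberL (X : Finset Γ) (η : OuterConfig H X) : TotalSpace H →L[ℂ] LocalSpace H X :=
  LinearMap.mkContinuous
    { toFun := fiber X η
      map_add' := fiber_add X η
      map_smul' := fun c f => fiber_smul X η c f } 1 fun f => by
    rw [one_mul]
    refine le_of_sq_le_sq ?_ (norm_nonneg f)
    exact le_hasSum (hasSum_fiber X f) η fun _ _ => sq_nonneg _

@[simp]
theorem fiberL_apply (X : Finset Γ) (η : OuterConfig H X) (f : TotalSpace H) :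
    fiberL X η f = fiber X η f := rfl

/-- The isometry `v ↦ v ⊗ η` of `ℋ_X` into the total space. -/
def embed (X : Finset Γ) (η : OuterConfig H X) : LocalSpace H X →L[ℂ] TotalSpace H :=
  ContinuousLinearMap.adjoint (fiberL X η)

open Classical in
theorem fiber_basisVec (X : Finset Γ) (η : OuterConfig H X) (τ : Config H) :
    fiber X η (basisVec τ) =
      if η = (splitConfig X τ).1 then basisVec (splitConfig X τ).2 else 0 := by
  ext ξ
  rw [fiber_apply, basisVec_apply]
  have : (splitConfig X).symm (η, ξ) = τ ↔ η = (splitConfig X τ).1 ∧ ξ = (splitConfig X τ).2 := by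
    rw [Equiv.symm_apply_eq, Prod.ext_iff]
  by_cases h : η = (splitConfig X τ).1
  · by_cases h' : ξ = (splitConfig X τ).2
    · rw [if_pos (this.2 ⟨h, h'⟩), if_pos h, basisVec_apply, if_pos h']
    · rw [if_neg (fun h2 => h' (this.1 h2).2), if_pos h, basisVec_apply, if_neg h']
  · rw [if_neg (fun h2 => h (this.1 h2).1), if_neg h]
    rfl

open Classical in
theorem fiber_embed (X : Finset Γ) (η ζ : OuterConfig H X) (v : LocalSpace H X) :
    fiber X ζ (embed X η v) = if ζ = η then v else 0 := by
  ext ξ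
  rw [fiber_apply, ← inner_basisVec, embed, ContinuousLinearMap.adjoint_inner_right, fiberL_apply,
    fiber_basisVec]
  simp only [Equiv.apply_symm_apply]
  by_cases h : ζ = η
  · rw [if_pos h.symm, if_pos h, inner_basisVec]
  · rw [if_neg (fun h' => h h'.symm), if_neg h, inner_zero_left]
    rfl

theorem fiber_embed_self (X : Finset Γ) (η : OuterConfig H X) (v : LocalSpace H X) :
    fiber X η (embed X η v) = v := by
  classical
  rw [fiber_embed, if_pos rfl]

/-- The matrix unit `1 ⊗ |η⟩⟨ζ|` of the commutant of the local algebra of `X`. -/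
def outerUnit (X : Finset Γ) (η ζ : OuterConfig H X) : Op H := (embed X η).comp (fiberL X ζ)

theorem outerUnit_apply (X : Finset Γ) (η ζ : OuterConfig H X) (f : TotalSpace H) :
    outerUnit X η ζ f = embed X η (fiber X ζ f) := rfl

open Classical in
theorem coeff_outerUnit (X : Finset Γ) (η ζ : OuterConfig H X) (σ τ : Config H) :
    coeff (outerUnit X η ζ) σ τ = if η = (splitConfig X σ).1 ∧ ζ = (splitConfig X τ).1 ∧
      (splitConfig X σ).2 = (splitConfig X τ).2 then 1 else 0 := by
  rw [coeff_eq_inner, outerUnit_apply, embed, ContinuousLinearMap.adjoint_inner_right, fiberL_apply,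
    fiber_basisVec, fiber_basisVec]
  by_cases h1 : η = (splitConfig X σ).1
  · by_cases h2 : ζ = (splitConfig X τ).1
    · rw [if_pos h1, if_pos h2, inner_basisVec, basisVec_apply]
      simp [h1, h2]
    · simp [h2]
  · simp [h1]

theorem actsOn_outerUnit (X : Finset Γ) (η ζ : OuterConfig H X) :
    ActsOn (X : Set Γ)ᶜ (outerUnit X η ζ) where
  eq_zero σ τ := by
    classical
    rintro ⟨x, hx, hne⟩
    rw [coeff_outerUnit, if_neg]
    rintro ⟨-, -, h⟩
    have hx' : x ∈ X := by simpa using hx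
    exact hne (congrFun h ⟨x, hx'⟩)
  congr σ τ σ' τ' h1 h2 h3 h4 := by
    classical
    have e1 : (splitConfig X σ).1 = (splitConfig X σ').1 := funext fun x => h3 x x.2
    have e2 : (splitConfig X τ).1 = (splitConfig X τ').1 := funext fun x => h4 x x.2
    have e3 : (splitConfig X σ).2 = (splitConfig X τ).2 :=
      funext fun x => h1 x (by simp)
    have e4 : (splitConfig X σ').2 = (splitConfig X τ').2 :=
      funext fun x => h2 x (by simp)
    rw [coeff_outerUnit, coeff_outerUnit, e1, e2, e3, e4]
    simp

theorem fiber_ampliation (X : Finset Γ) (a : LocalSpace H X →L[ℂ] LocalSpace H X)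
    (η : OuterConfig H X) (f : TotalSpace H) :
    fiber X η (ampliation H X a f) = a (fiber X η f) := fiber_amplOp X a f η

open Classical in
theorem coeff_ampliation (X : Finset Γ) (a : LocalSpace H X →L[ℂ] LocalSpace H X)
    (σ τ : Config H) : coeff (ampliation H X a) σ τ =
      if (splitConfig X σ).1 = (splitConfig X τ).1 then
        coeff a (splitConfig X σ).2 (splitConfig X τ).2 else 0 := by
  have h : coeff (ampliation H X a) σ τ =
      fiber X (splitConfig X σ).1 (ampliation H X a (basisVec τ)) (splitConfig X σ).2 := by
    rw [fiber_apply]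
    simp [coeff]
  rw [h, fiber_ampliation, fiber_basisVec]
  split_ifs
  · rfl
  · simp

theorem actsOn_ampliation (X : Finset Γ) (a : LocalSpace H X →L[ℂ] LocalSpace H X) :
    ActsOn (X : Set Γ) (ampliation H X a) where
  eq_zero σ τ := by
    classical
    rintro ⟨x, hx, hne⟩
    rw [coeff_ampliation, if_neg]
    intro h
    exact hne (congrFun h ⟨x, by simpa using hx⟩)
  congr σ τ σ' τ' h1 h2 h3 h4 := by
    classical
    have e1 : (splitConfig X σ).1 = (splitConfig X τ).1 := funext fun x => h1 x (by simpa using x.2)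
    have e2 : (splitConfig X σ').1 = (splitConfig X τ').1 :=
      funext fun x => h2 x (by simpa using x.2)
    have e3 : (splitConfig X σ).2 = (splitConfig X σ').2 :=
      funext fun x => h3 x (by simp)
    have e4 : (splitConfig X τ).2 = (splitConfig X τ').2 :=
      funext fun x => h4 x (by simp)
    rw [coeff_ampliation, coeff_ampliation, if_pos e1, if_pos e2, e3, e4]

/-- The block of an operator between two outer configurations: the operator is regarded as a matrix
over `B(ℋ_X)`, indexed by the configurations outside of `X`. -/
def block (X : Finset Γ) (η ζ : OuterConfig H X) (A : Op H) : LocalSpace H X →L[ℂ] LocalSpace H X :=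
  (fiberL X η).comp (A.comp (embed X ζ))

theorem block_apply (X : Finset Γ) (η ζ : OuterConfig H X) (A : Op H) (v : LocalSpace H X) :
    block X η ζ A v = fiber X η (A (embed X ζ v)) := rfl

theorem block_ampliation (X : Finset Γ) (η : OuterConfig H X)
    (a : LocalSpace H X →L[ℂ] LocalSpace H X) : block X η η (ampliation H X a) = a := by
  ext1 v
  rw [block_apply, fiber_ampliation, fiber_embed_self]

theorem ampliation_embed (X : Finset Γ) (a : LocalSpace H X →L[ℂ] LocalSpace H X)
    (η : OuterConfig H X) (v : LocalSpace H X) :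
    ampliation H X a (embed X η v) = embed X η (a v) := by
  classical
  refine ext_fiber X fun ζ => ?_
  rw [fiber_ampliation, fiber_embed, fiber_embed]
  split_ifs
  · rfl
  · simp

/-- The blocks of `A` are recovered by compression with outer matrix units. -/
theorem outerUnit_mul_mul (X : Finset Γ) (η₀ η ζ : OuterConfig H X) (A : Op H) :
    outerUnit X η₀ η * A * outerUnit X ζ η₀ =
      ampliation H X (block X η ζ A) * outerUnit X η₀ η₀ := by
  ext1 f
  simp only [mul_apply_eq_comp, outerUnit_apply, ampliation_embed, block_apply]

/-- An operator which commutes with all outer matrix units belongs to the local algebra. -/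
theorem mem_localAlgebra_of_commute [∀ x, Nontrivial (H x)] {X : Finset Γ} {A : Op H}
    (h : ∀ η ζ, Commute A (outerUnit X η ζ)) : A ∈ localAlgebra H X := by
  let η₀ : OuterConfig H X := fun _ => Classical.arbitrary _
  refine ⟨block X η₀ η₀ A, ?_⟩
  change ampliation H X (block X η₀ η₀ A) = A
  ext1 f
  refine ext_fiber X fun η => ?_
  have h1 : outerUnit X η₀ η (A f) = A (outerUnit X η₀ η f) :=
    (congrArg (fun T : Op H => T f) (h η₀ η).eq).symm
  rw [fiber_ampliation, block_apply, ← outerUnit_apply, ← h1, outerUnit_apply, fiber_embed_self]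

/-- The local algebras are characterized by the matrix elements of their elements. -/
theorem mem_localAlgebra_iff [∀ x, Nontrivial (H x)] {X : Finset Γ} {A : Op H} :
    A ∈ localAlgebra H X ↔ ActsOn (X : Set Γ) A := by
  refine ⟨?_, fun h => mem_localAlgebra_of_commute fun η ζ =>
    h.commute disjoint_compl_right (actsOn_outerUnit X η ζ)⟩
  rintro ⟨a, rfl⟩
  exact actsOn_ampliation X a

theorem actsOn_of_mem {X : Finset Γ} {A : Op H} (hA : A ∈ localAlgebra H X) :
    ActsOn (X : Set Γ) A := by
  obtain ⟨a, rfl⟩ := hA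
  exact actsOn_ampliation X a

theorem localAlgebra_mono [∀ x, Nontrivial (H x)] : Monotone (localAlgebra H) := fun X Y h A hA =>
  mem_localAlgebra_iff.2 ((actsOn_of_mem hA).mono (by exact_mod_cast h))

theorem commute_of_mem {X Y : Finset Γ} (h : Disjoint X Y) {A B : Op H}
    (hA : A ∈ localAlgebra H X) (hB : B ∈ localAlgebra H Y) : Commute A B :=
  (actsOn_of_mem hA).commute (by exact_mod_cast h) (actsOn_of_mem hB)

theorem commute_outerUnit {X Y : Finset Γ} (h : X ⊆ Y) {A : Op H}
    (hA : A ∈ localAlgebra H X) (η ζ : OuterConfig H Y) : Commute A (outerUnit Y η ζ) :=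
  ((actsOn_of_mem hA).mono (by exact_mod_cast h)).commute disjoint_compl_right
    (actsOn_outerUnit Y η ζ)

theorem localAlgebra_le_quasiLocalAlgebra (X : Finset Γ) :
    localAlgebra H X ≤ quasiLocalAlgebra H :=
  (le_iSup (localAlgebra H) X).trans (StarSubalgebra.le_topologicalClosure _)

theorem mem_closure_local [∀ x, Nontrivial (H x)] (A : quasiLocalAlgebra H) :
    (A : Op H) ∈ closure {B : Op H | ∃ X, B ∈ localAlgebra H X} := by
  have h1 : (A : Op H) ∈ closure ((⨆ X : Finset Γ, localAlgebra H X : StarSubalgebra ℂ (Op H)) :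
    Set (Op H)) := A.2
  have h2 : Directed (· ≤ ·) (localAlgebra H) := localAlgebra_mono.directed_le
  rw [StarSubalgebra.coe_iSup_of_directed h2] at h1
  convert h1 using 2
  ext B
  simp

end Fibers

/-! ### Extension of the local generators to all bounded operators -/

section LocalGenerators

variable {Γ : Type*} {H : Γ → Type*} [∀ x, NormedAddCommGroup (H x)]
  [∀ x, InnerProductSpace ℂ (H x)] [∀ x, CompleteSpace (H x)]

theorem norm_ampliation_le (X : Finset Γ) (a : LocalSpace H X →L[ℂ] LocalSpace H X) :
    ‖ampliation H X a‖ ≤ ‖a‖ :=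
  LinearMap.mkContinuous_norm_le _ (norm_nonneg a) (norm_amplVec_le X a)

/-- Ampliation is weakly continuous on bounded sequences. -/
theorem WeakTendsto.ampliation (X : Finset Γ) {T : ℕ → LocalSpace H X →L[ℂ] LocalSpace H X}
    {B : LocalSpace H X →L[ℂ] LocalSpace H X} {c : ℝ} (hT : ∀ n, ‖T n‖ ≤ c)
    (h : WeakTendsto T B) :
    WeakTendsto (fun n => OpenLattice.ampliation H X (T n)) (OpenLattice.ampliation H X B) :=
  fun f g => by
    have h1 : ∀ a : LocalSpace H X →L[ℂ] LocalSpace H X,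
        ⟪f, OpenLattice.ampliation H X a g⟫_ℂ = ∑' η, ⟪fiber X η f, a (fiber X η g)⟫_ℂ :=
      fun a => by
        simp only [← fiber_ampliation]
        exact (hasSum_inner_fiber X f _).tsum_eq.symm
    simp only [h1]
    exact tendsto_tsum_of_dominated_convergence
      (((hasSum_fiber X f).summable.add (hasSum_fiber X g).summable).mul_left c)
      (fun η => h _ _) (Eventually.of_forall fun n η => norm_inner_le_add_sq (hT n))

theorem ampliation_lindbladPartial (X : Finset Γ) (l g : ℕ → LocalSpace H X →L[ℂ] LocalSpace H X)
    (N : ℕ) (b : LocalSpace H X →L[ℂ] LocalSpace H X) :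
    lindbladPartial (fun a => ampliation H X (l a)) (fun n => ampliation H X (g n)) N
      (ampliation H X b) = ampliation H X (lindbladPartial l g N b) := by
  simp [lindbladPartial, map_star]

theorem ampliation_drift (X : Finset Γ) (h : LocalSpace H X →L[ℂ] LocalSpace H X)
    (l : ℕ → LocalSpace H X →L[ℂ] LocalSpace H X) (α : ℝ) (c : ℕ → ℂ) (N : ℕ) :
    drift (ampliation H X h) (fun a => ampliation H X (l a)) α c N =
      ampliation H X (drift h l α c N) := by
  simp only [drift, driftTerm, map_add, map_sub, map_sum, map_smul, map_mul, map_star, map_one]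

theorem ampliation_lindbladTerm (X : Finset Γ) (l b : LocalSpace H X →L[ℂ] LocalSpace H X) :
    lindbladTerm (ampliation H X l) (ampliation H X b) = ampliation H X (lindbladTerm l b) := by
  simp [lindbladTerm, map_star, map_smul]

theorem block_mul_ampliation (X : Finset Γ) (η ζ : OuterConfig H X) (A : Op H)
    (b : LocalSpace H X →L[ℂ] LocalSpace H X) :
    block X η ζ (A * ampliation H X b) = block X η ζ A * b := by
  ext1 v
  simp only [block_apply, mul_apply_eq_comp, ampliation_embed]

theorem block_ampliation_mul (X : Finset Γ) (η ζ : OuterConfig H X) (A : Op H)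
    (b : LocalSpace H X →L[ℂ] LocalSpace H X) :
    block X η ζ (ampliation H X b * A) = b * block X η ζ A := by
  ext1 v
  simp only [block_apply, mul_apply_eq_comp, fiber_ampliation]

theorem block_add (X : Finset Γ) (η ζ : OuterConfig H X) (A B : Op H) :
    block X η ζ (A + B) = block X η ζ A + block X η ζ B := by
  ext1 v
  simp only [block_apply, add_apply, fiber_add]

theorem block_sum (X : Finset Γ) (η ζ : OuterConfig H X) {ι : Type*} (s : Finset ι)
    (A : ι → Op H) : block X η ζ (∑ i ∈ s, A i) = ∑ i ∈ s, block X η ζ (A i) := by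
  ext1 v
  simp only [block, ContinuousLinearMap.comp_apply, sum_apply, map_sum]

theorem block_lindbladPartial (X : Finset Γ) (η ζ : OuterConfig H X)
    (l g : ℕ → LocalSpace H X →L[ℂ] LocalSpace H X) (N : ℕ) (A : Op H) :
    block X η ζ (lindbladPartial (fun a => ampliation H X (l a)) (fun n => ampliation H X (g n)) N
      A) = lindbladPartial l g N (block X η ζ A) := by
  simp only [lindbladPartial, add_apply, sum_apply, sandwich_apply, driftMap_apply, block_add,
    block_sum, ← map_star, block_mul_ampliation, block_ampliation_mul]

theorem inner_block (X : Finset Γ) (η ζ : OuterConfig H X) (A : Op H) (v w : LocalSpace H X) :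
    ⟪v, block X η ζ A w⟫_ℂ = ⟪embed X η v, A (embed X ζ w)⟫_ℂ := by
  rw [embed, ContinuousLinearMap.adjoint_inner_left]
  rfl

theorem WeakTendsto.block (X : Finset Γ) (η ζ : OuterConfig H X) {T : ℕ → Op H} {B : Op H}
    (h : WeakTendsto T B) :
    WeakTendsto (fun n => OpenLattice.block X η ζ (T n)) (OpenLattice.block X η ζ B) :=
  fun v w => by
    simp only [inner_block]
    exact h _ _

/-- The decomposition of the total space into the copies of `ℋ_X` attached to the configurations
outside of `X`. -/
theorem hasSum_embed_fiber (X : Finset Γ) (f : TotalSpace H) :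
    HasSum (fun η => embed X η (fiber X η f)) f := by
  classical
  have h1 : ∀ s : Finset (OuterConfig H X), ‖(∑ η ∈ s, embed X η (fiber X η f)) - f‖ ^ 2 =
      ‖f‖ ^ 2 - ∑ η ∈ s, ‖fiber X η f‖ ^ 2 := fun s => by
    have h2 := hasSum_fiber X ((∑ η ∈ s, embed X η (fiber X η f)) - f)
    have h3 : ∀ ζ, ‖fiber X ζ ((∑ η ∈ s, embed X η (fiber X η f)) - f)‖ ^ 2 =
        ‖fiber X ζ f‖ ^ 2 - (if ζ ∈ s then ‖fiber X ζ f‖ ^ 2 else 0) := fun ζ => by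
      rw [← fiberL_apply, map_sub, map_sum]
      simp only [fiberL_apply, fiber_embed]
      rw [Finset.sum_ite_eq]
      split_ifs <;> simp
    simp only [h3] at h2
    have h4 : HasSum (fun ζ => if ζ ∈ s then ‖fiber X ζ f‖ ^ 2 else 0)
        (∑ η ∈ s, ‖fiber X η f‖ ^ 2) := by
      have := hasSum_sum_of_ne_finset_zero (s := s) (L := .unconditional _)
        (f := fun ζ => if ζ ∈ s then ‖fiber X ζ f‖ ^ 2 else 0) (fun ζ hζ => if_neg hζ)
      rwa [Finset.sum_congr rfl fun ζ hζ => if_pos hζ] at this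
    exact h2.unique ((hasSum_fiber X f).sub h4)
  have h5 : Tendsto (fun s : Finset (OuterConfig H X) =>
      ‖(∑ η ∈ s, embed X η (fiber X η f)) - f‖ ^ 2) atTop (𝓝 0) := by
    simp only [h1]
    have := Tendsto.const_sub (‖f‖ ^ 2) (hasSum_fiber X f)
    rwa [sub_self] at this
  have h6 := (Real.continuous_sqrt.tendsto 0).comp h5
  simp only [Function.comp_def, Real.sqrt_sq (norm_nonneg _), Real.sqrt_zero] at h6
  exact tendsto_iff_norm_sub_tendsto_zero.2 h6

theorem sum_eq_sum_equivFin {α M : Type*} [AddCommMonoid M] (s : Finset α) (F : α → M) :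
    ∑ a ∈ s, F a = ∑ i, F (s.equivFin.symm i) := by
  rw [← Finset.sum_coe_sort s F]
  exact (Equiv.sum_comp s.equivFin.symm fun i : s => F i).symm

theorem norm_sq_sum_embed (X : Finset Γ) {n : ℕ} {η : Fin n → OuterConfig H X}
    (hη : Function.Injective η) (v : Fin n → LocalSpace H X) :
    ‖∑ i, embed X (η i) (v i)‖ ^ 2 = ∑ i, ‖v i‖ ^ 2 := by
  classical
  have h1 : ∀ i, fiber X (η i) (∑ j, embed X (η j) (v j)) = v i := fun i => by
    rw [← fiberL_apply, map_sum]
    simp only [fiberL_apply, fiber_embed, hη.eq_iff]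
    simp
  have h2 : (⟪∑ i, embed X (η i) (v i), ∑ i, embed X (η i) (v i)⟫_ℂ) =
      ((∑ i, ‖v i‖ ^ 2 : ℝ) : ℂ) := by
    rw [sum_inner]
    simp only [embed, ContinuousLinearMap.adjoint_inner_left]
    change ∑ i, ⟪v i, fiber X (η i) (∑ j, embed X (η j) (v j))⟫_ℂ = _
    simp [h1, inner_self_eq_norm_sq_to_K]
  rw [inner_self_eq_norm_sq_to_K] at h2
  exact Complex.ofReal_injective (by rw [← h2]; simp)

theorem sum_norm_sq_fiber_le (X : Finset Γ) {n : ℕ} {η : Fin n → OuterConfig H X}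
    (hη : Function.Injective η) (f : TotalSpace H) :
    ∑ i, ‖fiber X (η i) f‖ ^ 2 ≤ ‖f‖ ^ 2 := by
  classical
  have := sum_le_hasSum (Finset.univ.image η) (fun _ _ => sq_nonneg _) (hasSum_fiber X f)
  rwa [Finset.sum_image fun i _ j _ h => hη h] at this

/-- Finite compressions of an operator are matrices over the local algebra of at most the same
norm. -/
theorem norm_blockMatrix_le (X : Finset Γ) {n : ℕ} {η : Fin n → OuterConfig H X}
    (hη : Function.Injective η) (A : Op H) :
    ‖(CStarMatrix.ofMatrix fun i j => ampliation H X (block X (η i) (η j) A) :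
      CStarMatrix (Fin n) (Fin n) (Op H))‖ ≤ ‖A‖ := by
  refine norm_le_of_matAct (StarAlgHom.id ℂ (Op H)) Function.injective_id (norm_nonneg A)
    fun v => ?_
  have h1 : ∀ ζ i, fiber X ζ (matAct (fun i j => ampliation H X (block X (η i) (η j) A)) v i) =
      fiber X (η i) (A (∑ j, embed X (η j) (fiber X ζ (v j)))) := fun ζ i => by
    rw [matAct, ← fiberL_apply, map_sum, map_sum, ← fiberL_apply, map_sum]
    simp only [fiberL_apply, fiber_ampliation, block_apply]
  refine hasSum_le (f := fun ζ => ∑ i, ‖fiber X ζ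
      (matAct (fun i j => ampliation H X (block X (η i) (η j) A)) v i)‖ ^ 2)
    (g := fun ζ => ‖A‖ ^ 2 * ∑ i, ‖fiber X ζ (v i)‖ ^ 2) (fun ζ => ?_)
    (hasSum_sum fun i _ => hasSum_fiber X _)
    ((hasSum_sum fun i _ => hasSum_fiber X (v i)).mul_left _)
  simp only [h1]
  refine (sum_norm_sq_fiber_le X hη _).trans ?_
  rw [← norm_sq_sum_embed X hη, ← mul_pow]
  exact pow_le_pow_left₀ (norm_nonneg _) (A.le_opNorm _) 2

theorem norm_map_le_cbNorm {Z : Finset Γ} {ψ : Op H → Op H} (hψ : cbNorm Z ψ < ∞) {n : ℕ}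
    {M : CStarMatrix (Fin n) (Fin n) (Op H)} (hM : ∀ i j, M i j ∈ localAlgebra H Z)
    (hM1 : ‖M‖ ≤ 1) : ‖M.map ψ‖ ≤ (cbNorm Z ψ).toReal := by
  have h : ENNReal.ofReal ‖M.map ψ‖ ≤ cbNorm Z ψ := by
    unfold cbNorm
    exact le_iSup_of_le n (le_iSup_of_le M (le_iSup_of_le hM (le_iSup_of_le hM1 le_rfl)))
  exact (ENNReal.ofReal_le_iff_le_toReal hψ.ne).1 h

/-- A completely bounded map of the local algebra, acting on the blocks of an operator of norm at
most one, defines an operator whose norm is at most the cb-norm. -/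
theorem sum_norm_sq_block_le {Z : Finset Γ} {ψ : Op H → Op H} (hψ : cbNorm Z ψ < ∞)
    {A : Op H} (hA : ‖A‖ ≤ 1) (η₀ : OuterConfig H Z) {n : ℕ} {η : Fin n → OuterConfig H Z}
    (hη : Function.Injective η) (v : Fin n → LocalSpace H Z) :
    ∑ i, ‖∑ j, block Z η₀ η₀ (ψ (ampliation H Z (block Z (η i) (η j) A))) (v j)‖ ^ 2 ≤
      (cbNorm Z ψ).toReal ^ 2 * ∑ i, ‖v i‖ ^ 2 := by
  set M : CStarMatrix (Fin n) (Fin n) (Op H) :=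
    CStarMatrix.ofMatrix fun i j => ampliation H Z (block Z (η i) (η j) A) with hM
  have h1 : ‖M.map ψ‖ ≤ (cbNorm Z ψ).toReal :=
    norm_map_le_cbNorm hψ (fun i j => ⟨_, rfl⟩) ((norm_blockMatrix_le Z hη A).trans hA)
  have h2 := sum_norm_matAct_le (StarAlgHom.id ℂ (Op H)) (M.map ψ) (fun i => embed Z η₀ (v i))
  have h3 : ∀ w, ‖embed Z η₀ w‖ ^ 2 = ‖w‖ ^ 2 := fun w => by
    have := norm_sq_sum_embed Z (n := 1) (η := fun _ => η₀) (Function.injective_of_subsingleton _)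
      (fun _ => w)
    simpa using this
  simp only [h3] at h2
  refine (Finset.sum_le_sum fun i _ => ?_).trans (h2.trans ?_)
  · have h4 : ∑ j, block Z η₀ η₀ (ψ (ampliation H Z (block Z (η i) (η j) A))) (v j) =
        fiberL Z η₀ (matAct (fun i j => StarAlgHom.id ℂ (Op H) (M.map ψ i j))
          (fun i => embed Z η₀ (v i)) i) := by
      rw [matAct, map_sum]
      rfl
    rw [h4]
    have := sum_norm_sq_fiber_le Z (n := 1) (η := fun _ => η₀)
      (Function.injective_of_subsingleton _)
        (matAct (fun i j => StarAlgHom.id ℂ (Op H) (M.map ψ i j)) (fun i => embed Z η₀ (v i)) i)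
    simpa using this
  · gcongr

/-- `φ` is a generator on the whole of `B(ℋ)` of Lindblad type, all of whose data belong to the
local algebra of `Z`, and of norm at most `c`.  The bound on the drift `G` makes the error of second
order in `exists_isCPMap_near` uniform. -/
structure IsLocalGenerator (Z : Finset Γ) (c : ℝ) (φ : Op H →L[ℂ] Op H) : Prop where
  norm_le : ‖φ‖ ≤ c
  exists_series : ∃ (L Gs : ℕ → Op H) (G : Op H), IsLindbladSeries L Gs G ∧
    IsLindbladGenerator L G φ ∧ (∀ A, WeakTendsto (fun N => lindbladPartial L Gs N A) (φ A)) ∧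
    (∀ a, L a ∈ localAlgebra H Z) ∧ (∀ N, Gs N ∈ localAlgebra H Z) ∧ G ∈ localAlgebra H Z ∧
    ‖G‖ ≤ 2 * c

namespace LatticeSystem

variable (S : LatticeSystem H)

theorem tendsto_Ψ (hS : S.SeriesConverge) (t : ℝ) {Z X : Finset Γ} (hZX : Z ⊆ X) {A : Op H}
    (hA : A ∈ localAlgebra H X) (f : TotalSpace H) :
    Tendsto (fun N => (Complex.I • (S.Φ t Z * A - A * S.Φ t Z) +
      ∑ a ∈ Finset.range N, lindbladTerm (S.L t Z a) A) f) atTop (𝓝 (S.Ψ t Z A f)) := by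
  have h : ∃ B, HasStrongSum (fun a => lindbladTerm (S.L t Z a) A) B := hS t Z X hZX A hA
  have h1 : HasStrongSum (fun a => lindbladTerm (S.L t Z a) A)
      (strongSum fun a => lindbladTerm (S.L t Z a) A) := by
    rw [strongSum, dif_pos h]
    exact h.choose_spec
  have h2 := (h1 f).const_add ((Complex.I • (S.Φ t Z * A - A * S.Φ t Z)) f)
  simpa only [Ψ, add_apply, sum_apply] using h2

/-- The generator `Ψ_Z(t)` extends to a generator of Lindblad type on `B(ℋ)`, which is bounded by
the cb-norm of `Ψ_Z(t)`: it acts on each block of an operator as `Ψ_Z(t)` acts on `B(ℋ_Z)`, and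
finite matrices of blocks are controlled by the cb-norm. -/
theorem exists_localGenerator [∀ x, Nontrivial (H x)] (hS : S.SeriesConverge) (t : ℝ)
    (Z : Finset Γ) (hfin : cbNorm Z (S.Ψ t Z) < ∞) :
    ∃ φ : Op H →L[ℂ] Op H, IsLocalGenerator Z (cbNorm Z (S.Ψ t Z)).toReal φ ∧
      ∀ X, Z ⊆ X → ∀ A ∈ localAlgebra H X, S.Ψ t Z A = φ A := by
  set c₀ := (cbNorm Z (S.Ψ t Z)).toReal with hc₀
  have hc₀0 : 0 ≤ c₀ := ENNReal.toReal_nonneg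
  let η₀ : OuterConfig H Z := fun _ => Classical.arbitrary _
  let ξ₀ : LocalConfig H Z := fun _ => Classical.arbitrary _
  choose l hl using S.L_mem t Z
  obtain ⟨h, hh⟩ := S.Φ_mem t Z
  replace hl : ∀ a, ampliation H Z (l a) = S.L t Z a := hl
  replace hh : ampliation H Z h = S.Φ t Z := hh
  have hstar : star h = h := by
    rw [← block_ampliation Z η₀ (star h), map_star, hh, S.Φ_star, ← hh, block_ampliation]
  -- `φ₀` is `Ψ_Z(t)`, regarded as a map of `B(ℋ_Z)`
  set φ₀ : (LocalSpace H Z →L[ℂ] LocalSpace H Z) → (LocalSpace H Z →L[ℂ] LocalSpace H Z) :=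
    fun b => block Z η₀ η₀ (S.Ψ t Z (ampliation H Z b)) with hφ₀
  have hlim : ∀ b w, Tendsto (fun N => (Complex.I • (h * b - b * h) +
      ∑ a ∈ Finset.range N, lindbladTerm (l a) b) w) atTop (𝓝 (φ₀ b w)) := fun b w => by
    have h1 := S.tendsto_Ψ hS t (Finset.Subset.refl Z) (A := ampliation H Z b) ⟨b, rfl⟩
      (embed Z η₀ w)
    have h2 := ((fiberL Z η₀).continuous.tendsto _).comp h1
    refine h2.congr fun N => ?_
    have h3 : Complex.I • (S.Φ t Z * ampliation H Z b - ampliation H Z b * S.Φ t Z) +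
        ∑ a ∈ Finset.range N, lindbladTerm (S.L t Z a) (ampliation H Z b) =
        ampliation H Z (Complex.I • (h * b - b * h) +
          ∑ a ∈ Finset.range N, lindbladTerm (l a) b) := by
      simp only [← hl, ← hh, ampliation_lindbladTerm, map_add, map_smul, map_sub, map_mul, map_sum]
    rw [Function.comp_apply, h3, ampliation_embed, fiberL_apply, fiber_embed_self]
  have hφ₀smul : ∀ (z : ℂ) b, φ₀ (z • b) = z • φ₀ b := fun z b => by
    ext1 w
    refine tendsto_nhds_unique (hlim (z • b) w) ?_
    have h1 : ∀ N, (Complex.I • (h * (z • b) - (z • b) * h) +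
        ∑ a ∈ Finset.range N, lindbladTerm (l a) (z • b)) w = z • ((Complex.I • (h * b - b * h) +
        ∑ a ∈ Finset.range N, lindbladTerm (l a) b) w) := fun N => by
      rw [← smul_apply]
      congr 1
      rw [smul_add, Finset.smul_sum]
      congr 1
      · simp only [mul_smul_comm, smul_mul_assoc]
        module
      · refine Finset.sum_congr rfl fun a _ => ?_
        simp only [lindbladTerm, mul_smul_comm, smul_mul_assoc]
        module
    simp only [h1]
    exact (hlim b w).const_smul z
  have hφ₀1 : ∀ b, ‖b‖ ≤ 1 → ‖φ₀ b‖ ≤ c₀ := fun b hb => by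
    refine ContinuousLinearMap.opNorm_le_bound _ hc₀0 fun w => ?_
    have h1 := sum_norm_sq_block_le hfin ((norm_ampliation_le Z b).trans hb) η₀ (n := 1)
      (η := fun _ => η₀) (Function.injective_of_subsingleton _) (fun _ => w)
    simp only [Finset.univ_unique, Finset.sum_singleton, block_ampliation, ← mul_pow] at h1
    exact le_of_sq_le_sq h1 (by positivity)
  have hφ₀n : ∀ b, ‖φ₀ b‖ ≤ c₀ * ‖b‖ := fun b => by
    rcases eq_or_ne b 0 with rfl | hb
    · have := hφ₀smul 0 0
      rw [zero_smul, zero_smul] at this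
      rw [this]
      simp
    have hbn : ‖b‖ ≠ 0 := norm_ne_zero_iff.2 hb
    have h1 := hφ₀1 (((‖b‖⁻¹ : ℝ) : ℂ) • b) (by
      rw [norm_smul, Complex.norm_real, norm_inv, norm_norm, inv_mul_cancel₀ hbn])
    rw [hφ₀smul, norm_smul, Complex.norm_real, norm_inv, norm_norm, inv_mul_le_iff₀
      (norm_pos_iff.2 hb), mul_comm] at h1
    exact h1
  obtain ⟨α, c, g, hser, hg⟩ := exists_isLindbladSeries hstar hlim (norm_basisVec ξ₀) hφ₀n
  set lL := fun a => l a - c a • (1 : LocalSpace H Z →L[ℂ] LocalSpace H Z) with hlL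
  set gs := drift h l α c with hgs
  set L : ℕ → Op H := fun a => ampliation H Z (lL a) with hL
  set Gs : ℕ → Op H := fun N => ampliation H Z (gs N) with hGs
  set G : Op H := ampliation H Z g with hG
  obtain ⟨C, hC⟩ := hser.bounded
  have hser' : IsLindbladSeries L Gs G := by
    refine ⟨⟨C, fun N => (norm_ampliation_le Z _).trans (hC N)⟩, hser.tendsto.ampliation Z hC,
      fun N => ?_⟩
    rw [← map_one (ampliation H Z), ampliation_lindbladPartial, hser.map_one, map_zero]
  -- the normalized data, acting on the total space, define the extension
  obtain ⟨φ, hφ, hφlim⟩ := hser'.exists_generator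
  have hblock : ∀ A η ζ, block Z η ζ (φ A) = φ₀ (block Z η ζ A) := fun A η ζ => by
    have h1 := (hφlim A).block Z η ζ
    simp only [hL, hGs, block_lindbladPartial] at h1
    refine h1.unique (WeakTendsto.of_tendsto fun w => ?_)
    simp only [hlL, hgs, ← partialGenerator_eq hstar]
    exact hlim _ w
  have hnorm1 : ∀ A, ‖A‖ ≤ 1 → ‖φ A‖ ≤ c₀ := fun A hA => by
    refine ContinuousLinearMap.opNorm_le_bound _ hc₀0 fun f => ?_
    classical
    -- bound the compressions to finitely many outer configurations
    have key : ∀ s : Finset (OuterConfig H Z),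
        ∑ η ∈ s, ‖fiber Z η (φ A (∑ ζ ∈ s, embed Z ζ (fiber Z ζ f)))‖ ^ 2 ≤
          (c₀ * ‖f‖) ^ 2 := fun s => by
      have hinj : Function.Injective fun i => (s.equivFin.symm i : OuterConfig H Z) :=
        Subtype.val_injective.comp s.equivFin.symm.injective
      have h1 := sum_norm_sq_block_le hfin hA η₀ hinj (fun i => fiber Z (s.equivFin.symm i) f)
      have h2 := sum_norm_sq_fiber_le Z hinj f
      rw [sum_eq_sum_equivFin s (fun η => ‖fiber Z η (φ A (∑ ζ ∈ s, embed Z ζ (fiber Z ζ f)))‖ ^ 2),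
        sum_eq_sum_equivFin s (fun ζ => embed Z ζ (fiber Z ζ f))]
      have h3 : ∀ i, fiber Z (s.equivFin.symm i)
            (φ A (∑ j, embed Z (s.equivFin.symm j) (fiber Z (s.equivFin.symm j) f))) =
          ∑ j, block Z η₀ η₀
            (S.Ψ t Z (ampliation H Z (block Z (s.equivFin.symm i) (s.equivFin.symm j) A)))
              (fiber Z (s.equivFin.symm j) f) := fun i => by
        rw [map_sum, ← fiberL_apply, map_sum]
        refine Finset.sum_congr rfl fun j _ => ?_
        rw [fiberL_apply, ← block_apply, hblock]
      simp only [h3]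
      refine h1.trans ?_
      rw [mul_pow]
      gcongr
    have h1 : ∀ r : Finset (OuterConfig H Z), ∑ η ∈ r, ‖fiber Z η (φ A f)‖ ^ 2 ≤
        (c₀ * ‖f‖) ^ 2 := fun r => by
      have h2 : Tendsto (fun s : Finset (OuterConfig H Z) =>
          ∑ η ∈ r, ‖fiberL Z η (φ A (∑ ζ ∈ s, embed Z ζ (fiber Z ζ f)))‖ ^ 2) atTop
          (𝓝 (∑ η ∈ r, ‖fiberL Z η (φ A f)‖ ^ 2)) := by
        refine tendsto_finsetSum _ fun η _ => ?_
        exact ((((fiberL Z η).continuous.comp (φ A).continuous).norm.pow 2).tendsto _).comp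
          (hasSum_embed_fiber Z f)
      refine le_of_tendsto h2 ((eventually_ge_atTop r).mono fun s hs => ?_)
      exact (Finset.sum_le_sum_of_subset_of_nonneg hs fun _ _ _ => sq_nonneg _).trans (key s)
    have h3 : ‖φ A f‖ ^ 2 ≤ (c₀ * ‖f‖) ^ 2 :=
      le_of_tendsto (hasSum_fiber Z (φ A f)) (Eventually.of_forall h1)
    exact le_of_sq_le_sq h3 (by positivity)
  refine ⟨φ, ⟨ContinuousLinearMap.opNorm_le_of_unit_norm hc₀0 fun A hA => hnorm1 A hA.le, L, Gs, G,
    hser', hφ, hφlim, fun a => ⟨_, rfl⟩, fun N => ⟨_, rfl⟩, ⟨_, rfl⟩,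
    (norm_ampliation_le Z g).trans hg⟩, fun X hX A hA => ?_⟩
  have h1 : WeakTendsto (fun N => Complex.I • (S.Φ t Z * A - A * S.Φ t Z) +
      ∑ a ∈ Finset.range N, lindbladTerm (S.L t Z a) A) (S.Ψ t Z A) :=
    WeakTendsto.of_tendsto (S.tendsto_Ψ hS t hX hA)
  refine h1.unique ?_
  have h2 := hφlim A
  have h3 : L = fun a => S.L t Z a - c a • 1 := by
    funext a
    simp only [hL, hlL, map_sub, map_smul, map_one, hl]
  have h4 : Gs = drift (S.Φ t Z) (S.L t Z) α c := by
    funext N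
    simp only [hGs, hgs, ← ampliation_drift, hl, hh]
  rw [h3, h4] at h2
  simpa only [partialGenerator_eq (S.Φ_star t Z) _ α c] using h2

end LatticeSystem

namespace IsLocalGenerator

variable {Z W : Finset Γ} {c d : ℝ} {φ ψ : Op H →L[ℂ] Op H}

theorem map_one (h : IsLocalGenerator Z c φ) : φ 1 = 0 := by
  obtain ⟨L, Gs, G, -, hφ, -⟩ := h.exists_series
  exact hφ.map_one

theorem map_mul_left (h : IsLocalGenerator Z c φ) {B : Op H}
    (hB : ∀ C ∈ localAlgebra H Z, Commute C B) (A : Op H) : φ (B * A) = B * φ A := by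
  obtain ⟨L, Gs, G, -, hφ, -, hL, -, hG, -⟩ := h.exists_series
  exact hφ.map_mul_left (fun a => hB _ (star_mem (hL a))) (hB _ (star_mem hG)) A

theorem map_mul_right (h : IsLocalGenerator Z c φ) {B : Op H}
    (hB : ∀ C ∈ localAlgebra H Z, Commute C B) (A : Op H) : φ (A * B) = φ A * B := by
  obtain ⟨L, Gs, G, -, hφ, -, hL, -, hG, -⟩ := h.exists_series
  exact hφ.map_mul_right (fun a => hB _ (hL a)) (hB _ hG) A

/-- Generators annihilate the observables whose support is disjoint from theirs. -/
theorem map_eq_zero (h : IsLocalGenerator Z c φ) (hZW : Disjoint Z W) {A : Op H}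
    (hA : A ∈ localAlgebra H W) : φ A = 0 := by
  have := h.map_mul_left (fun C hC => commute_of_mem hZW hC hA) 1
  rwa [mul_one, h.map_one, mul_zero] at this

theorem exists_isCPMap (h : IsLocalGenerator Z c φ) :
    ∃ G : Op H, ‖G‖ ≤ 2 * c ∧ IsCPMap (φ - driftMap G) := by
  obtain ⟨L, Gs, G, -, hφ, -, -, -, -, hG⟩ := h.exists_series
  exact ⟨G, hG, hφ.isCPMap⟩

/-- Generators with disjoint supports commute.  One of them is approximated by finite sums of left
and right multiplications; the other one is weakly continuous on bounded sequences. -/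
theorem commute (h : IsLocalGenerator Z c φ) (h' : IsLocalGenerator W d ψ) (hZW : Disjoint Z W)
    (A : Op H) : φ (ψ A) = ψ (φ A) := by
  obtain ⟨L, Gs, G, -, hφ, -⟩ := h.exists_series
  obtain ⟨M, Ks, K, hser, hψ, hlim, hM, hKs, -⟩ := h'.exists_series
  obtain ⟨C, hC⟩ := hser.bounded
  have h1 := hφ.weakTendsto (fun N => hser.norm_lindbladPartial_apply_le hC N A) (hlim A)
  refine h1.unique ?_
  have hcomm : ∀ B ∈ localAlgebra H W, ∀ C ∈ localAlgebra H Z, Commute C B :=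
    fun B hB C hC => commute_of_mem hZW hC hB
  have h2 : ∀ N, φ (lindbladPartial M Ks N A) = lindbladPartial M Ks N (φ A) := fun N => by
    simp only [lindbladPartial, add_apply, sum_apply, sandwich_apply, driftMap_apply, map_add,
      map_sum]
    rw [h.map_mul_left (hcomm _ (star_mem (hKs N))), h.map_mul_right (hcomm _ (hKs N))]
    congr 1
    refine Finset.sum_congr rfl fun a _ => ?_
    rw [h.map_mul_right (hcomm _ (hM a)), h.map_mul_left (hcomm _ (star_mem (hM a)))]
  simp only [h2]
  exact hlim (φ A)

end IsLocalGenerator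

end LocalGenerators

/-! ### The Euler scheme -/

section Euler

variable {V W : Type*} [NormedAddCommGroup V] [NormedSpace ℂ V] [NormedAddCommGroup W]
  [NormedSpace ℂ W]

/-- The propagator of `k` explicit Euler steps of length `δ` for the linear equation with
generators `ℓ 0, ℓ 1, …`. -/
def euler (δ : ℝ) (ℓ : ℕ → V →L[ℂ] V) : ℕ → V →L[ℂ] V
  | 0 => 1
  | k + 1 => (1 + (δ : ℂ) • ℓ k) * euler δ ℓ k

variable (δ : ℝ) (ℓ : ℕ → V →L[ℂ] V)

@[simp]
theorem euler_zero (v : V) : euler δ ℓ 0 v = v := rfl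

theorem euler_succ (k : ℕ) (v : V) :
    euler δ ℓ (k + 1) v = euler δ ℓ k v + (δ : ℂ) • ℓ k (euler δ ℓ k v) := rfl

variable {δ ℓ}

theorem euler_intertwine {ℓ' : ℕ → W →L[ℂ] W} {ι : V → W} (hadd : ∀ v w, ι (v + w) = ι v + ι w)
    (hsmul : ∀ (a : ℂ) v, ι (a • v) = a • ι v) (h : ∀ k v, ℓ' k (ι v) = ι (ℓ k v)) (k : ℕ) (v : V) :
    euler δ ℓ' k (ι v) = ι (euler δ ℓ k v) := by
  induction k with
  | zero => simp
  | succ k ih => rw [euler_succ, euler_succ, ih, h, hadd, hsmul]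

theorem norm_euler_le {b : ℝ} (hb : 0 ≤ b) (h : ∀ k, ‖1 + (δ : ℂ) • ℓ k‖ ≤ b) (k : ℕ) :
    ‖euler δ ℓ k‖ ≤ b ^ k := by
  induction k with
  | zero =>
    rw [pow_zero]
    exact ContinuousLinearMap.norm_id_le
  | succ k ih =>
    rw [euler, pow_succ']
    exact (norm_mul_le _ _).trans (mul_le_mul (h k) ih (norm_nonneg _) hb)

theorem norm_euler_sub_one_le {b m : ℝ} (hδ : 0 ≤ δ) (hb : 1 ≤ b)
    (h : ∀ k, ‖1 + (δ : ℂ) • ℓ k‖ ≤ b) (hm : ∀ k, ‖ℓ k‖ ≤ m) (k : ℕ) :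
    ‖euler δ ℓ k - 1‖ ≤ k * δ * m * b ^ k := by
  have hm0 : 0 ≤ m := (norm_nonneg _).trans (hm 0)
  induction k with
  | zero => simp [euler]
  | succ k ih =>
    have h1 : euler δ ℓ (k + 1) - 1 = (euler δ ℓ k - 1) + (δ : ℂ) • (ℓ k * euler δ ℓ k) := by
      rw [euler, add_mul, one_mul, smul_mul_assoc]; abel
    rw [h1]
    have h2 : ‖(δ : ℂ) • (ℓ k * euler δ ℓ k)‖ ≤ δ * (m * b ^ k) := by
      rw [norm_smul, Complex.norm_real, Real.norm_of_nonneg hδ]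
      gcongr
      exact (norm_mul_le _ _).trans (mul_le_mul (hm k) (norm_euler_le (by linarith) h k)
        (norm_nonneg _) hm0)
    calc _ ≤ k * δ * m * b ^ k + δ * (m * b ^ k) := (norm_add_le _ _).trans (add_le_add ih h2)
      _ = (k + 1) * δ * m * b ^ k := by ring
      _ ≤ (k + 1) * δ * m * b ^ (k + 1) := by
          gcongr ?_ * ?_
          exact pow_le_pow_right₀ hb (Nat.le_succ k)
      _ = _ := by push_cast; ring

-- The next three estimates are stated for operators on an abstract space `V`; they are applied to
-- maps of operator algebras.
theorem opNorm_le_add_opNorm_sub (T U : V →L[ℂ] V) : ‖T‖ ≤ ‖U‖ + ‖T - U‖ :=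
  norm_le_norm_add_norm_sub' T U

theorem opNorm_sum_le {ι : Type*} (s : Finset ι) (f : ι → V →L[ℂ] V) :
    ‖∑ i ∈ s, f i‖ ≤ ∑ i ∈ s, ‖f i‖ := norm_sum_le s f

theorem opNorm_comp_sub_comp_le (T U T' U' : V →L[ℂ] V) :
    ‖T * U - T'.comp U'‖ ≤ ‖T - T'‖ * ‖U‖ + ‖T'‖ * ‖U - U'‖ := by
  have h : T * U - T'.comp U' = (T - T') * U + T' * (U - U') := by
    change T * U - T' * U' = _
    rw [sub_mul, mul_sub]; abel
  rw [h]
  exact (norm_add_le _ _).trans (add_le_add (norm_mul_le _ _) (norm_mul_le _ _))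

end Euler

/-! ### Lieb–Robinson bounds -/

section LiebRobinson

variable {Γ : Type*} {H : Γ → Type*} [∀ x, NormedAddCommGroup (H x)]
  [∀ x, InnerProductSpace ℂ (H x)] [∀ x, CompleteSpace (H x)]

theorem norm_sandwich_le {E : Type*} [NormedAddCommGroup E] [InnerProductSpace ℂ E]
    [CompleteSpace E] (K : E →L[ℂ] E) : ‖sandwich K‖ ≤ ‖K‖ ^ 2 := by
  refine ContinuousLinearMap.opNorm_le_bound _ (by positivity) fun A => ?_
  rw [sandwich_apply]
  calc ‖star K * A * K‖ ≤ ‖star K‖ * ‖A‖ * ‖K‖ :=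
        (norm_mul_le _ _).trans (by gcongr; exact norm_mul_le _ _)
    _ = ‖K‖ ^ 2 * ‖A‖ := by rw [norm_star]; ring

/-- A short Euler step of a sum of generators is completely positive up to an error of second
order in the length of the step: the term `δ (K* A + A K)` of the drift is completed to
`(1 + δ K)* A (1 + δ K)` by adding `δ² K* A K`. -/
theorem exists_isCPMap_near {s : Finset (Finset Γ)} {φ : Finset Γ → Op H →L[ℂ] Op H}
    {c : Finset Γ → ℝ} (hφ : ∀ Z, IsLocalGenerator Z (c Z) (φ Z)) {m : ℝ} (hm : ∑ Z ∈ s, c Z ≤ m)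
    {δ : ℝ} (hδ : 0 ≤ δ) :
    ∃ V : Op H →L[ℂ] Op H, IsCPMap V ∧ ‖V‖ ≤ 1 + 4 * δ ^ 2 * m ^ 2 ∧
      ‖1 + (δ : ℂ) • ∑ Z ∈ s, φ Z - V‖ ≤ 4 * δ ^ 2 * m ^ 2 := by
  choose G hG hcp using fun Z => (hφ Z).exists_isCPMap
  set K : Op H := ∑ Z ∈ s, G Z with hK
  have hKm : ‖K‖ ≤ 2 * m := by
    refine (norm_sum_le _ _).trans ((Finset.sum_le_sum fun Z _ => hG Z).trans ?_)
    rw [← Finset.mul_sum]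
    linarith
  have hdrift : driftMap K = ∑ Z ∈ s, driftMap (G Z) := by
    ext1 A
    simp [hK, driftMap_apply, Finset.sum_add_distrib, Finset.sum_mul, Finset.mul_sum, star_sum]
  have hKm2 : ‖K‖ ^ 2 ≤ 4 * m ^ 2 := by
    have := pow_le_pow_left₀ (norm_nonneg _) hKm 2
    linarith
  refine ⟨sandwich (1 + (δ : ℂ) • K) + (δ : ℂ) • ∑ Z ∈ s, (φ Z - driftMap (G Z)),
    (isCPMap_sandwich _).add ((IsCPMap.sum s fun Z _ => hcp Z).smul hδ), ?_⟩
  have hV : sandwich (1 + (δ : ℂ) • K) + (δ : ℂ) • ∑ Z ∈ s, (φ Z - driftMap (G Z)) =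
      1 + (δ : ℂ) • ∑ Z ∈ s, φ Z + ((δ : ℂ) ^ 2) • sandwich K := by
    rw [Finset.sum_sub_distrib, ← hdrift]
    ext1 A
    simp only [add_apply, smul_apply, sub_apply, sandwich_apply, driftMap_apply, star_add, star_one,
      star_smul, Complex.star_def, Complex.conj_ofReal, one_apply_eq_self]
    simp only [add_mul, mul_add, one_mul, mul_one, smul_mul_assoc, mul_smul_comm, smul_smul,
      smul_add, smul_sub, ← pow_two]
    abel
  have hnorm : ‖((δ : ℂ) ^ 2) • sandwich K‖ ≤ 4 * δ ^ 2 * m ^ 2 := by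
    rw [norm_smul, norm_pow, Complex.norm_real, Real.norm_of_nonneg hδ]
    calc δ ^ 2 * ‖sandwich K‖ ≤ δ ^ 2 * (4 * m ^ 2) := by
          gcongr; exact (norm_sandwich_le K).trans hKm2
      _ = _ := by ring
  constructor
  · refine ((isCPMap_sandwich _).add
      ((IsCPMap.sum s fun Z _ => hcp Z).smul hδ)).norm_le.trans ?_
    rw [hV]
    have h1 : (1 + (δ : ℂ) • ∑ Z ∈ s, φ Z + ((δ : ℂ) ^ 2) • sandwich K) 1 =
        1 + (((δ : ℂ) ^ 2) • sandwich K) 1 := by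
      simp [(hφ _).map_one]
    rw [h1]
    have h2 : ‖(1 : Op H)‖ ≤ 1 := ContinuousLinearMap.norm_id_le
    refine (norm_add_le _ _).trans (add_le_add h2 ?_)
    refine (ContinuousLinearMap.le_opNorm _ _).trans ?_
    have := mul_le_mul hnorm h2 (norm_nonneg _) (by positivity)
    linarith
  · rw [hV, sub_add_cancel_left]
    exact (norm_neg (((δ : ℂ) ^ 2) • sandwich K)).trans_le hnorm

/-- Euler steps are contractions up to an error of second order, since the nearby completely
positive map is nearly unital. -/
theorem norm_one_add_smul_sum_le {s : Finset (Finset Γ)} {φ : Finset Γ → Op H →L[ℂ] Op H}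
    {c : Finset Γ → ℝ} (hφ : ∀ Z, IsLocalGenerator Z (c Z) (φ Z)) {m : ℝ} (hm : ∑ Z ∈ s, c Z ≤ m)
    {δ : ℝ} (hδ : 0 ≤ δ) : ‖1 + (δ : ℂ) • ∑ Z ∈ s, φ Z‖ ≤ 1 + 8 * δ ^ 2 * m ^ 2 := by
  obtain ⟨V, -, h1, h2⟩ := exists_isCPMap_near hφ hm hδ
  have := opNorm_le_add_opNorm_sub (1 + (δ : ℂ) • ∑ Z ∈ s, φ Z) V
  linarith

/-- The Euler propagators are completely positive up to a small error. -/
theorem exists_isCPMap_euler {φ : ℕ → Finset Γ → Op H →L[ℂ] Op H}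
    {c : ℕ → Finset Γ → ℝ} (hφ : ∀ k Z, IsLocalGenerator Z (c k Z) (φ k Z)) {δ : ℝ} (hδ : 0 ≤ δ)
    {Λ : Finset Γ} {m : ℝ} (hm : ∀ k, ∑ Z ∈ Λ.powerset, c k Z ≤ m) (k : ℕ) :
    ∃ V : Op H →L[ℂ] Op H, IsCPMap V ∧
      ‖euler δ (fun k => ∑ W ∈ Λ.powerset, φ k W) k - V‖ ≤
        k * (4 * δ ^ 2 * m ^ 2) * (1 + 8 * δ ^ 2 * m ^ 2) ^ k := by
  induction k with
  | zero => exact ⟨1, IsCPMap.id, by simp [euler]⟩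
  | succ k ih =>
    obtain ⟨V, hV, h1⟩ := ih
    obtain ⟨U, hU, h2, h3⟩ := exists_isCPMap_near (hφ k) (hm k) hδ
    refine ⟨U.comp V, hU.comp hV, ?_⟩
    set P : Op H →L[ℂ] Op H := 1 + (δ : ℂ) • ∑ Z ∈ Λ.powerset, φ k Z with hP
    set E := euler δ (fun k => ∑ W ∈ Λ.powerset, φ k W) k with hE
    have hE1 : ‖E‖ ≤ (1 + 8 * δ ^ 2 * m ^ 2) ^ k :=
      norm_euler_le (by positivity) (fun k => norm_one_add_smul_sum_le (hφ k) (hm k) hδ) k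
    have hb : 1 ≤ 1 + 8 * δ ^ 2 * m ^ 2 := by linarith [show 0 ≤ 8 * δ ^ 2 * m ^ 2 by positivity]
    have h5 : ‖U‖ ≤ 1 + 8 * δ ^ 2 * m ^ 2 := by
      have : 0 ≤ 4 * δ ^ 2 * m ^ 2 := by positivity
      linarith
    calc ‖P * E - U.comp V‖ ≤ ‖P - U‖ * ‖E‖ + ‖U‖ * ‖E - V‖ := opNorm_comp_sub_comp_le P E U V
      _ ≤ 4 * δ ^ 2 * m ^ 2 * (1 + 8 * δ ^ 2 * m ^ 2) ^ k + (1 + 8 * δ ^ 2 * m ^ 2) *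
          (k * (4 * δ ^ 2 * m ^ 2) * (1 + 8 * δ ^ 2 * m ^ 2) ^ k) := by gcongr
      _ ≤ 4 * δ ^ 2 * m ^ 2 * (1 + 8 * δ ^ 2 * m ^ 2) ^ (k + 1) + (1 + 8 * δ ^ 2 * m ^ 2) *
          (k * (4 * δ ^ 2 * m ^ 2) * (1 + 8 * δ ^ 2 * m ^ 2) ^ k) := by
          exact add_le_add (mul_le_mul_of_nonneg_left (pow_le_pow_right₀ hb (Nat.le_succ k))
            (by positivity)) le_rfl
      _ = _ := by push_cast; ring

variable [MetricSpace Γ]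

/-- The bounds `c Z` decay in the sense that the sum of `c Z` over all `Z` containing `x` and `y`
is at most `M * F (dist x y)`. -/
structure HasDecay (F : ℝ → ℝ) (M : ℝ) (c : Finset Γ → ℝ) : Prop where
  nonneg : ∀ Z, 0 ≤ c Z
  empty : c ∅ = 0
  sum_le : ∀ (x y : Γ) (s : Finset (Finset Γ)), (∀ Z ∈ s, x ∈ Z ∧ y ∈ Z) →
    ∑ Z ∈ s, c Z ≤ M * F (dist x y)

/-- The function `z ↦ ∑ x ∈ X, F (dist z x)`, which measures how close `z` is to `X`. -/
def spread (F : ℝ → ℝ) (X : Finset Γ) (z : Γ) : ℝ := ∑ x ∈ X, F (dist z x)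

theorem IsDecayFunction.exists_convolution {F : ℝ → ℝ} (hF : IsDecayFunction Γ F) :
    ∃ C, 0 ≤ C ∧ ∀ (x y : Γ) (s : Finset Γ),
      ∑ w ∈ s, F (dist x w) * F (dist w y) ≤ C * F (dist x y) := by
  set C := ⨆ (x : Γ) (y : Γ),
    ∑' z : Γ, ENNReal.ofReal (F (dist x z) * F (dist y z) / F (dist x y)) with hC
  refine ⟨C.toReal, ENNReal.toReal_nonneg, fun x y s => ?_⟩
  have hpos : ∀ x y : Γ, 0 < F (dist x y) := fun x y => hF.pos _ dist_nonneg
  have h1 : ∑ z ∈ s, ENNReal.ofReal (F (dist x z) * F (dist y z) / F (dist x y)) ≤ C :=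
    (ENNReal.sum_le_tsum s).trans (le_iSup₂ (f := fun x y : Γ => ∑' z : Γ,
      ENNReal.ofReal (F (dist x z) * F (dist y z) / F (dist x y))) x y)
  rw [← ENNReal.ofReal_sum_of_nonneg fun z _ =>
    div_nonneg (mul_nonneg (hpos _ _).le (hpos _ _).le) (hpos _ _).le] at h1
  have h2 := (ENNReal.ofReal_le_iff_le_toReal hF.convolution.ne).1 h1
  rw [← Finset.sum_div, div_le_iff₀ (hpos _ _)] at h2
  simpa only [dist_comm y] using h2

theorem spread_nonneg {F : ℝ → ℝ} (hF : IsDecayFunction Γ F) (X : Finset Γ) (z : Γ) :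
    0 ≤ spread F X z := Finset.sum_nonneg fun _ _ => (hF.pos _ dist_nonneg).le

/-- Sets which meet `X` are not small in the sense of `spread F X`. -/
theorem le_sum_spread {F : ℝ → ℝ} (hF : IsDecayFunction Γ F) {X Z : Finset Γ}
    (h : ¬ Disjoint Z X) : F 0 ≤ ∑ z ∈ Z, spread F X z := by
  obtain ⟨z, hz, hx⟩ := Finset.not_disjoint_iff.1 h
  calc F 0 = F (dist z z) := by rw [dist_self]
    _ ≤ spread F X z := Finset.single_le_sum (f := fun x => F (dist z x))
        (fun x _ => (hF.pos _ dist_nonneg).le) hx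
    _ ≤ _ := Finset.single_le_sum (f := fun z => spread F X z)
        (fun z _ => spread_nonneg hF X z) hz

open Classical in
/-- Convolution estimate: sets which meet `T` spread the decay of `spread F X` at the cost of a
constant factor. -/
theorem HasDecay.sum_mul_spread_le {F : ℝ → ℝ} (hF : IsDecayFunction Γ F) {C : ℝ}
    (hC : ∀ (x y : Γ) (s : Finset Γ), ∑ w ∈ s, F (dist x w) * F (dist w y) ≤ C * F (dist x y))
    {M : ℝ} (hM : 0 ≤ M) {c : Finset Γ → ℝ} (hc : HasDecay F M c) (X T Λ : Finset Γ)
    {s : Finset (Finset Γ)} (hs : ∀ W ∈ s, W ⊆ Λ) (hT : ∀ W ∈ s, ¬ Disjoint W T) :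
    ∑ W ∈ s, c W * ∑ w ∈ W, spread F X w ≤ M * C * ∑ z ∈ T, spread F X z := by
  have hg := spread_nonneg hF X
  calc ∑ W ∈ s, c W * ∑ w ∈ W, spread F X w
      ≤ ∑ W ∈ s, ∑ z ∈ T, ∑ w ∈ Λ, if z ∈ W ∧ w ∈ W then c W * spread F X w else 0 := by
        refine Finset.sum_le_sum fun W hW => ?_
        obtain ⟨z, hzW, hzT⟩ := Finset.not_disjoint_iff.1 (hT W hW)
        have h0 : ∀ z w, 0 ≤ if z ∈ W ∧ w ∈ W then c W * spread F X w else 0 := fun z w => by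
          split_ifs
          · exact mul_nonneg (hc.nonneg W) (hg w)
          · exact le_rfl
        refine le_trans ?_ (Finset.single_le_sum (f := fun z => ∑ w ∈ Λ,
          if z ∈ W ∧ w ∈ W then c W * spread F X w else 0)
          (fun z _ => Finset.sum_nonneg fun w _ => h0 z w) hzT)
        simp only [hzW, true_and]
        rw [← Finset.sum_filter, Finset.mul_sum, Finset.filter_mem_eq_inter,
          Finset.inter_eq_right.2 (hs W hW)]
    _ = ∑ z ∈ T, ∑ w ∈ Λ, (∑ W ∈ s with z ∈ W ∧ w ∈ W, c W) * spread F X w := by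
        rw [Finset.sum_comm]
        refine Finset.sum_congr rfl fun z _ => ?_
        rw [Finset.sum_comm]
        refine Finset.sum_congr rfl fun w _ => ?_
        rw [← Finset.sum_filter, Finset.sum_mul]
    _ ≤ ∑ z ∈ T, ∑ w ∈ Λ, M * F (dist z w) * spread F X w := by
        gcongr with z _ w _
        · exact hg w
        · exact hc.sum_le z w _ fun Z hZ => (Finset.mem_filter.1 hZ).2
    _ = ∑ z ∈ T, M * ∑ x ∈ X, ∑ w ∈ Λ, F (dist z w) * F (dist w x) := by
        refine Finset.sum_congr rfl fun z _ => ?_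
        simp only [spread, Finset.mul_sum]
        rw [Finset.sum_comm]
        simp only [mul_assoc]
    _ ≤ ∑ z ∈ T, M * ∑ x ∈ X, C * F (dist z x) := by
        gcongr with z _ x _
        exact hC z x Λ
    _ = _ := by
        simp only [spread, Finset.mul_sum, mul_assoc]

/-- The generators supported in a finite volume are bounded, at a rate which may depend on the
volume. -/
theorem HasDecay.sum_le_card {F : ℝ → ℝ} {M : ℝ} {c : Finset Γ → ℝ} (hc : HasDecay F M c)
    {Λ : Finset Γ} {s : Finset (Finset Γ)} (hs : s ⊆ Λ.powerset) :
    ∑ Z ∈ s, c Z ≤ Λ.card * (M * F 0) := by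
  classical
  calc ∑ Z ∈ s, c Z ≤ ∑ Z ∈ s, ∑ x ∈ Λ, if x ∈ Z then c Z else 0 := by
        refine Finset.sum_le_sum fun Z hZ => ?_
        have h0 : ∀ x ∈ Λ, 0 ≤ if x ∈ Z then c Z else 0 := fun x _ => by
          split_ifs
          · exact hc.nonneg Z
          · exact le_rfl
        rcases Z.eq_empty_or_nonempty with rfl | ⟨x, hx⟩
        · rw [hc.empty]
          simp
        · have := Finset.single_le_sum h0 (Finset.mem_powerset.1 (hs hZ) hx)
          simpa [hx] using this
    _ = ∑ x ∈ Λ, ∑ Z ∈ s with x ∈ Z, c Z := by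
        rw [Finset.sum_comm]
        exact Finset.sum_congr rfl fun x _ => (Finset.sum_filter _ _).symm
    _ ≤ ∑ x ∈ Λ, M * F 0 := by
        refine Finset.sum_le_sum fun x _ => ?_
        simpa using hc.sum_le x x _ fun Z hZ =>
          ⟨(Finset.mem_filter.1 hZ).2, (Finset.mem_filter.1 hZ).2⟩
    _ = _ := by simp

variable {F : ℝ → ℝ} {C M : ℝ} {φ : ℕ → Finset Γ → Op H →L[ℂ] Op H} {c : ℕ → Finset Γ → ℝ}

open Classical in
/-- Lieb–Robinson bound for the Euler approximations of the evolution in the volume `Λ`: a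
generator attached to `Z`, applied to an evolved observable of `X`, is small if `Z` is far from
`X`.  The generators whose support is disjoint from `Z` commute with it and hence do not contribute
to the growth of the bound, whatever the size of `Λ`. -/
theorem norm_apply_euler_le (hF : IsDecayFunction Γ F)
    (hC : ∀ (x y : Γ) (s : Finset Γ), ∑ w ∈ s, F (dist x w) * F (dist w y) ≤ C * F (dist x y))
    (hC0 : 0 ≤ C) (hM : 0 ≤ M) (hφ : ∀ k Z, IsLocalGenerator Z (c k Z) (φ k Z))
    (hc : ∀ k, HasDecay F M (c k)) {δ : ℝ} (hδ : 0 ≤ δ) {Λ : Finset Γ} {m : ℝ}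
    (hm : Λ.card * (M * F 0) ≤ m) {X : Finset Γ} {A : Op H} (hA : A ∈ localAlgebra H X) (k : ℕ)
    {Z : Finset Γ} {d : ℝ} {ψ : Op H →L[ℂ] Op H} (hψ : IsLocalGenerator Z d ψ) :
    ‖ψ (euler δ (fun k => ∑ W ∈ Λ.powerset, φ k W) k A)‖ ≤
      d * (‖A‖ * (1 + 8 * δ ^ 2 * m ^ 2 + δ * (M * C)) ^ k * (F 0)⁻¹ *
        ∑ z ∈ Z, spread F X z) := by
  have hF0 : 0 < F 0 := hF.pos 0 le_rfl
  set ρ := 1 + 8 * δ ^ 2 * m ^ 2 + δ * (M * C) with hρ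
  induction k generalizing Z d ψ with
  | zero =>
    have hd : 0 ≤ d := (norm_nonneg ψ).trans hψ.norm_le
    rw [euler_zero, pow_zero, mul_one]
    by_cases hZX : Disjoint Z X
    · rw [hψ.map_eq_zero hZX hA, norm_zero]
      have := Finset.sum_nonneg fun z (_ : z ∈ Z) => spread_nonneg hF X z
      positivity
    · refine (ψ.le_of_opNorm_le hψ.norm_le A).trans ?_
      gcongr
      rw [mul_assoc]
      refine le_mul_of_one_le_right (norm_nonneg _) ?_
      rw [inv_mul_eq_div, one_le_div₀ hF0]
      exact le_sum_spread hF hZX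
  | succ k ih =>
    have hd : 0 ≤ d := (norm_nonneg ψ).trans hψ.norm_le
    set u := euler δ (fun k => ∑ W ∈ Λ.powerset, φ k W) k A with hu
    set s₁ := Λ.powerset.filter fun W => Disjoint Z W with hs₁
    set s₂ := Λ.powerset.filter fun W => ¬ Disjoint Z W with hs₂
    have hg : 0 ≤ ∑ z ∈ Z, spread F X z := Finset.sum_nonneg fun z _ => spread_nonneg hF X z
    have hρ0 : 0 ≤ ρ := by positivity
    have h1 : ψ (euler δ (fun k => ∑ W ∈ Λ.powerset, φ k W) (k + 1) A) =
        (1 + (δ : ℂ) • ∑ W ∈ s₁, φ k W) (ψ u) + (δ : ℂ) • ∑ W ∈ s₂, ψ (φ k W u) := by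
      have hsplit : (∑ W ∈ Λ.powerset, φ k W) u = ∑ W ∈ s₁, φ k W u + ∑ W ∈ s₂, φ k W u := by
        rw [sum_apply, hs₁, hs₂, Finset.sum_filter_add_sum_filter_not]
      rw [euler_succ, ← hu, hsplit]
      simp only [map_add, map_smul, map_sum, smul_add, add_apply, one_apply_eq_self, smul_apply,
        sum_apply, add_assoc]
      congr 3
      exact Finset.sum_congr rfl fun W hW =>
        hψ.commute (hφ k W) (Finset.mem_filter.1 hW).2 u
    have h2 : ‖(1 + (δ : ℂ) • ∑ W ∈ s₁, φ k W) (ψ u)‖ ≤ (1 + 8 * δ ^ 2 * m ^ 2) *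
        (d * (‖A‖ * ρ ^ k * (F 0)⁻¹ * ∑ z ∈ Z, spread F X z)) := by
      refine (ContinuousLinearMap.le_opNorm _ _).trans (mul_le_mul ?_ (ih hψ) (norm_nonneg _)
        (by positivity))
      exact norm_one_add_smul_sum_le (hφ k)
        (((hc k).sum_le_card (Finset.filter_subset _ _)).trans hm) hδ
    have h3 : ‖∑ W ∈ s₂, ψ (φ k W u)‖ ≤
        d * (‖A‖ * ρ ^ k * (F 0)⁻¹ * (M * C * ∑ z ∈ Z, spread F X z)) := by
      calc ‖∑ W ∈ s₂, ψ (φ k W u)‖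
          ≤ ∑ W ∈ s₂, d * (c k W * (‖A‖ * ρ ^ k * (F 0)⁻¹ * ∑ z ∈ W, spread F X z)) := by
            refine (norm_sum_le _ _).trans (Finset.sum_le_sum fun W _ => ?_)
            refine (ψ.le_of_opNorm_le hψ.norm_le _).trans ?_
            gcongr
            exact ih (hφ k W)
        _ = d * (‖A‖ * ρ ^ k * (F 0)⁻¹ * ∑ W ∈ s₂, c k W * ∑ z ∈ W, spread F X z) := by
            rw [Finset.mul_sum, Finset.mul_sum]
            exact Finset.sum_congr rfl fun W _ => by ring
        _ ≤ _ := by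
            gcongr
            refine (hc k).sum_mul_spread_le hF hC hM X Z Λ
              (fun W hW => Finset.mem_powerset.1 (Finset.mem_filter.1 hW).1)
              (fun W hW h => (Finset.mem_filter.1 hW).2 h.symm)
    rw [h1]
    refine (norm_add_le _ _).trans ?_
    rw [norm_smul, Complex.norm_real, Real.norm_of_nonneg hδ]
    calc _ ≤ _ := add_le_add h2 (mul_le_mul_of_nonneg_left h3 hδ)
      _ = _ := by rw [pow_succ, hρ]; ring

open Classical in
/-- Comparison of the Euler approximations in two volumes `Λ ⊆ Λ'`.  The dependence on the size of
`Λ'` is through `m` only, which appears together with `δ ^ 2` and disappears as `δ → 0`. -/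
theorem norm_euler_sub_euler_le (hF : IsDecayFunction Γ F)
    (hC : ∀ (x y : Γ) (s : Finset Γ), ∑ w ∈ s, F (dist x w) * F (dist w y) ≤ C * F (dist x y))
    (hC0 : 0 ≤ C) (hM : 0 ≤ M) (hφ : ∀ k Z, IsLocalGenerator Z (c k Z) (φ k Z))
    (hc : ∀ k, HasDecay F M (c k)) {δ : ℝ} (hδ : 0 ≤ δ) {Λ Λ' : Finset Γ} (hΛ : Λ ⊆ Λ') {m : ℝ}
    (hm : Λ'.card * (M * F 0) ≤ m) {X : Finset Γ} {A : Op H} (hA : A ∈ localAlgebra H X) (k : ℕ) :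
    ‖euler δ (fun k => ∑ W ∈ Λ'.powerset, φ k W) k A -
        euler δ (fun k => ∑ W ∈ Λ.powerset, φ k W) k A‖ ≤
      k * δ * ((1 + 8 * δ ^ 2 * m ^ 2) ^ k * (1 + 8 * δ ^ 2 * m ^ 2 + δ * (M * C)) ^ k) *
        (‖A‖ * (F 0)⁻¹ * (M * C * ∑ y ∈ Λ' \ Λ, spread F X y)) := by
  have hF0 : 0 < F 0 := hF.pos 0 le_rfl
  set b := 1 + 8 * δ ^ 2 * m ^ 2 with hb
  set ρ := b + δ * (M * C) with hρ
  set g := ∑ y ∈ Λ' \ Λ, spread F X y with hg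
  have hg0 : 0 ≤ g := Finset.sum_nonneg fun z _ => spread_nonneg hF X z
  have hb1 : 1 ≤ b := by rw [hb]; linarith [show 0 ≤ 8 * δ ^ 2 * m ^ 2 by positivity]
  have hρ1 : 1 ≤ ρ := by rw [hρ]; linarith [show 0 ≤ δ * (M * C) by positivity]
  have hmΛ : Λ.card * (M * F 0) ≤ m := by
    refine le_trans ?_ hm
    gcongr
  induction k with
  | zero => simp
  | succ k ih =>
    set u := euler δ (fun k => ∑ W ∈ Λ.powerset, φ k W) k A with hu
    set v := euler δ (fun k => ∑ W ∈ Λ'.powerset, φ k W) k A with hv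
    set s := Λ'.powerset \ Λ.powerset with hs
    have h1 : euler δ (fun k => ∑ W ∈ Λ'.powerset, φ k W) (k + 1) A -
        euler δ (fun k => ∑ W ∈ Λ.powerset, φ k W) (k + 1) A =
        (1 + (δ : ℂ) • ∑ W ∈ Λ'.powerset, φ k W) (v - u) + (δ : ℂ) • ∑ W ∈ s, φ k W u := by
      have hsplit : (∑ W ∈ Λ'.powerset, φ k W) u =
          ∑ W ∈ s, φ k W u + (∑ W ∈ Λ.powerset, φ k W) u := by
        rw [sum_apply, sum_apply, hs, Finset.sum_sdiff (Finset.powerset_mono.2 hΛ)]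
      simp only [euler_succ, ← hu, ← hv, add_apply, one_apply_eq_self, smul_apply, map_sub]
      rw [hsplit]
      simp only [smul_add]
      abel
    have h3 : ‖∑ W ∈ s, φ k W u‖ ≤ ρ ^ k * (‖A‖ * (F 0)⁻¹ * (M * C * g)) := by
      calc ‖∑ W ∈ s, φ k W u‖
          ≤ ∑ W ∈ s, c k W * (‖A‖ * ρ ^ k * (F 0)⁻¹ * ∑ z ∈ W, spread F X z) :=
            (norm_sum_le _ _).trans (Finset.sum_le_sum fun W _ =>
              norm_apply_euler_le hF hC hC0 hM hφ hc hδ hmΛ hA k (hφ k W))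
        _ = ‖A‖ * ρ ^ k * (F 0)⁻¹ * ∑ W ∈ s, c k W * ∑ z ∈ W, spread F X z := by
            rw [Finset.mul_sum]
            exact Finset.sum_congr rfl fun W _ => by ring
        _ ≤ ‖A‖ * ρ ^ k * (F 0)⁻¹ * (M * C * g) := by
            gcongr
            refine (hc k).sum_mul_spread_le hF hC hM X _ Λ' (fun W hW => ?_) (fun W hW h => ?_)
            · exact Finset.mem_powerset.1 (Finset.mem_sdiff.1 hW).1
            · obtain ⟨h4, h5⟩ := Finset.mem_sdiff.1 hW
              refine h5 (Finset.mem_powerset.2 fun w hw => ?_)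
              by_contra hwΛ
              exact Finset.disjoint_left.1 h hw
                (Finset.mem_sdiff.2 ⟨Finset.mem_powerset.1 h4 hw, hwΛ⟩)
        _ = _ := by ring
    rw [h1]
    refine (norm_add_le _ _).trans ?_
    rw [norm_smul, Complex.norm_real, Real.norm_of_nonneg hδ]
    have h4 := (ContinuousLinearMap.le_opNorm _ _).trans
      (mul_le_mul (norm_one_add_smul_sum_le (hφ k)
        (((hc k).sum_le_card (Finset.Subset.refl Λ'.powerset)).trans hm) hδ) ih (norm_nonneg _)
        (by positivity))
    have hR : 0 ≤ ‖A‖ * (F 0)⁻¹ * (M * C * g) := by positivity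
    calc _ ≤ _ := add_le_add h4 (mul_le_mul_of_nonneg_left h3 hδ)
      _ = (k * δ * (b ^ (k + 1) * ρ ^ k) + δ * (1 * ρ ^ k)) *
          (‖A‖ * (F 0)⁻¹ * (M * C * g)) := by rw [pow_succ]; ring
      _ ≤ (k * δ * (b ^ (k + 1) * ρ ^ (k + 1)) + δ * (b ^ (k + 1) * ρ ^ (k + 1))) *
          (‖A‖ * (F 0)⁻¹ * (M * C * g)) := by
          have := one_le_pow₀ hb1 (n := k + 1)
          have h6 := pow_le_pow_right₀ hρ1 (Nat.le_succ k)
          gcongr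
      _ = _ := by push_cast; ring

end LiebRobinson

/-! ### Linear differential equations -/

section LinearODE

variable {V : Type*} [NormedAddCommGroup V] [NormedSpace ℂ V]

/-- `f` solves the linear equation `f' = ℓ f` on `[s, t]`. -/
def SolvesLinear (ℓ : ℝ → V →L[ℂ] V) (s t : ℝ) (f : ℝ → V) : Prop :=
  ∀ u ∈ Set.Icc s t, HasDerivWithinAt f (ℓ u (f u)) (Set.Icc s t) u

namespace SolvesLinear

variable {ℓ : ℝ → V →L[ℂ] V} {r s t : ℝ} {f g : ℝ → V}

theorem continuousOn (hf : SolvesLinear ℓ s t f) : ContinuousOn f (Set.Icc s t) :=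
  fun u hu => (hf u hu).continuousWithinAt

theorem mono (hf : SolvesLinear ℓ s t f) {s' t' : ℝ} (hs : s ≤ s') (ht : t' ≤ t) :
    SolvesLinear ℓ s' t' f :=
  fun u hu => (hf u (Set.Icc_subset_Icc hs ht hu)).mono (Set.Icc_subset_Icc hs ht)

theorem congr (hf : SolvesLinear ℓ s t f) (h : ∀ u ∈ Set.Icc s t, g u = f u) :
    SolvesLinear ℓ s t g := fun u hu => by
  rw [h u hu]
  exact (hf u hu).congr h (h u hu)

theorem congr_generator {ℓ' : ℝ → V →L[ℂ] V} (hf : SolvesLinear ℓ s t f)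
    (h : ∀ u ∈ Set.Icc s t, ℓ' u = ℓ u) : SolvesLinear ℓ' s t f := fun u hu => by
  rw [h u hu]
  exact hf u hu

/-- Solutions on adjacent intervals can be joined. -/
theorem glue (hf : SolvesLinear ℓ r s f) (hg : SolvesLinear ℓ s t g) (hrs : r ≤ s) (hst : s ≤ t)
    (h : f s = g s) : SolvesLinear ℓ r t (fun u => if u ≤ s then f u else g u) := by
  set k : ℝ → V := fun u => if u ≤ s then f u else g u with hk
  have h1 : ∀ u ∈ Set.Icc r s, k u = f u := fun u hu => if_pos hu.2
  have h2 : ∀ u ∈ Set.Icc s t, k u = g u := fun u hu => by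
    rcases hu.1.eq_or_lt with rfl | hlt
    · simp [hk, h]
    · exact if_neg hlt.not_ge
  intro u hu
  rw [← Set.Icc_union_Icc_eq_Icc hrs hst]
  refine HasDerivWithinAt.union ?_ ?_
  · by_cases hus : u ≤ s
    · exact hf.congr h1 u ⟨hu.1, hus⟩
    · refine hasDerivWithinAt_iff_hasFDerivWithinAt.2 (.of_notMem_closure ?_)
      rw [isClosed_Icc.closure_eq]
      exact fun h => hus h.2
  · by_cases hus : s ≤ u
    · exact hg.congr h2 u ⟨hus, hu.2⟩
    · refine hasDerivWithinAt_iff_hasFDerivWithinAt.2 (.of_notMem_closure ?_)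
      rw [isClosed_Icc.closure_eq]
      exact fun h => hus h.1

end SolvesLinear

/-- A linear equation with a continuous bounded family of generators has a solution on a time
interval whose length depends on the bound only. -/
theorem exists_solvesLinear_short [CompleteSpace V] {ℓ : ℝ → V →L[ℂ] V} (hℓ : Continuous ℓ) {M : ℝ}
    (hM : ∀ u, ‖ℓ u‖ ≤ M) {h : ℝ} (h0 : 0 ≤ h) (hMh : 2 * M * h ≤ 1) (s : ℝ) (x : V) :
    ∃ f, f s = x ∧ SolvesLinear ℓ s (s + h) f := by
  have hM0 : 0 ≤ M := (norm_nonneg _).trans (hM 0)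
  have hs : s ∈ Set.Icc s (s + h) := ⟨le_rfl, by linarith⟩
  have hpl : IsPicardLindelof (fun u v => ℓ u v) ⟨s, hs⟩ x ‖x‖₊ 0 (2 * M.toNNReal * ‖x‖₊)
      M.toNNReal := by
    refine ⟨fun u _ => ?_, fun v _ => ?_, fun u _ v hv => ?_, ?_⟩
    · refine ((ℓ u).lipschitz.weaken ?_).lipschitzOnWith
      rw [← norm_toNNReal]
      exact Real.toNNReal_le_toNNReal (hM u)
    · exact (hℓ.clm_apply continuous_const).continuousOn
    · have hv' : ‖v‖ ≤ 2 * ‖x‖ := by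
        have h1 : ‖v - x‖ ≤ ‖x‖ := by simpa [dist_eq_norm] using hv
        have h2 := norm_le_norm_add_norm_sub' v x
        linarith
      refine ((ℓ u).le_of_opNorm_le (hM u) v).trans ?_
      push_cast
      rw [Real.coe_toNNReal _ hM0]
      have := mul_le_mul_of_nonneg_left hv' hM0
      linarith
    · push_cast
      rw [Real.coe_toNNReal _ hM0]
      simp only [add_sub_cancel_left, sub_self, sub_zero, max_eq_left h0]
      nlinarith [norm_nonneg x]
  obtain ⟨f, hf, hf'⟩ := hpl.exists_eq_forall_mem_Icc_hasDerivWithinAt₀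
  exact ⟨f, hf, hf'⟩

/-- Global existence for linear equations. -/
theorem exists_solvesLinear [CompleteSpace V] {ℓ : ℝ → V →L[ℂ] V} {s t : ℝ}
    (hℓ : ContinuousOn ℓ (Set.Icc s t)) (hst : s ≤ t) (x : V) :
    ∃ f, f s = x ∧ SolvesLinear ℓ s t f := by
  -- the generators are continued by constants, which gives a bounded family on the whole line
  set ℓ' : ℝ → V →L[ℂ] V := Set.IccExtend hst (fun u => ℓ u) with hℓ'
  have hcont : Continuous ℓ' := (continuousOn_iff_continuous_domRestrict.1 hℓ).Icc_extend'
  obtain ⟨M, hM⟩ := isCompact_Icc.exists_bound_of_continuousOn hℓ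
  have hM' : ∀ u, ‖ℓ' u‖ ≤ M := fun u => hM _ (Set.projIcc s t hst u).2
  have hM0 : 0 ≤ M := (norm_nonneg _).trans (hM' 0)
  set h : ℝ := (2 * M + 1)⁻¹ with hh
  have h0 : 0 < h := by positivity
  have hMh : 2 * M * h ≤ 1 := by
    rw [hh, ← div_eq_mul_inv, div_le_one (by positivity)]; linarith
  -- short solutions, on intervals of a fixed length `h`, are joined
  have key : ∀ n : ℕ, ∃ f, f s = x ∧ SolvesLinear ℓ' s (s + n * h) f := by
    intro n
    induction n with
    | zero => simpa using exists_solvesLinear_short hcont hM' le_rfl (by simp) s x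
    | succ n ih =>
      obtain ⟨f, hf, hf'⟩ := ih
      obtain ⟨g, hg, hg'⟩ := exists_solvesLinear_short hcont hM' h0.le hMh (s + n * h)
        (f (s + n * h))
      have hn : s ≤ s + n * h := by linarith [show 0 ≤ n * h by positivity]
      refine ⟨_, ?_, (hf'.glue hg' hn (by linarith) hg.symm).mono le_rfl ?_⟩
      · simp [hn, hf]
      · push_cast; linarith
  obtain ⟨n, hn⟩ := exists_nat_ge ((t - s) / h)
  obtain ⟨f, hf, hf'⟩ := key n
  refine ⟨f, hf, (hf'.mono le_rfl ?_).congr_generator fun u hu => ?_⟩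
  · rw [div_le_iff₀ h0] at hn; linarith
  · exact (Set.IccExtend_of_mem hst (fun u : Set.Icc s t => ℓ u) hu).symm

/-- The nodes of the subdivision of `[s, t]` into `N` intervals of equal length.  They are cut off
at `t`, so that they belong to `[s, t]` for all `k` (and also for `N = 0`, where the quotient is
zero). -/
def node (s t : ℝ) (N k : ℕ) : ℝ := min (s + k * ((t - s) / N)) t

theorem node_mem {s t : ℝ} (hst : s ≤ t) (N k : ℕ) : node s t N k ∈ Set.Icc s t := by
  refine ⟨le_min ?_ hst, min_le_right _ _⟩
  have : 0 ≤ (k : ℝ) * ((t - s) / N) := mul_nonneg k.cast_nonneg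
    (div_nonneg (by linarith) N.cast_nonneg)
  linarith

theorem node_eq {s t : ℝ} (hst : s ≤ t) {N k : ℕ} (hN : 0 < N) (hk : k ≤ N) :
    node s t N k = s + k * ((t - s) / N) := by
  refine min_eq_left ?_
  have hN' : (0 : ℝ) < N := by exact_mod_cast hN
  have h1 : (k : ℝ) * ((t - s) / N) ≤ N * ((t - s) / N) :=
    mul_le_mul_of_nonneg_right (by exact_mod_cast hk) (div_nonneg (by linarith) hN'.le)
  rw [mul_div_cancel₀ _ hN'.ne'] at h1
  linarith

/-- Convergence of the explicit Euler scheme for linear equations. -/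
theorem SolvesLinear.tendsto_euler {ℓ : ℝ → V →L[ℂ] V} {s t : ℝ}
    (hℓ : ContinuousOn ℓ (Set.Icc s t)) (hst : s ≤ t) {f : ℝ → V} (hf : SolvesLinear ℓ s t f) :
    Tendsto (fun N : ℕ => euler ((t - s) / N) (fun k => ℓ (node s t N k)) N (f s)) atTop
      (𝓝 (f t)) := by
  obtain ⟨M, hM⟩ := isCompact_Icc.exists_bound_of_continuousOn hℓ
  have hM0 : 0 ≤ M := (norm_nonneg _).trans (hM s ⟨le_rfl, hst⟩)
  have huc := isCompact_Icc.uniformContinuousOn_of_continuous (hℓ.clm_apply hf.continuousOn)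
  rw [Metric.uniformContinuousOn_iff_le] at huc
  rw [Metric.tendsto_atTop]
  intro ε hε
  set κ := Real.exp ((t - s) * M) * (t - s) + 1 with hκ
  have hκ0 : 0 < κ := by
    have := mul_nonneg (Real.exp_pos ((t - s) * M)).le (sub_nonneg.2 hst)
    linarith
  obtain ⟨η, hη, hη'⟩ := huc (ε / (2 * κ)) (by positivity)
  obtain ⟨N₀, hN₀⟩ := exists_nat_gt ((t - s) / η)
  refine ⟨N₀ + 1, fun N hN => ?_⟩
  have hNpos : 0 < N := by omega
  have hN' : (0 : ℝ) < N := by exact_mod_cast hNpos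
  set δ : ℝ := (t - s) / N with hδ
  have hδ0 : 0 ≤ δ := div_nonneg (by linarith) hN'.le
  have hδη : δ ≤ η := by
    rw [hδ, div_le_iff₀ hN']
    rw [div_lt_iff₀ hη] at hN₀
    have : (N₀ : ℝ) ≤ N := by exact_mod_cast (Nat.le_succ N₀).trans hN
    nlinarith
  set e := ε / (2 * κ) with he
  have he0 : 0 < e := by positivity
  -- the local error of each step is at most `e * δ`, by uniform continuity of `u ↦ ℓ u (f u)`
  have key : ∀ k ≤ N, ‖euler δ (fun k => ℓ (node s t N k)) k (f s) - f (s + k * δ)‖ ≤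
      (1 + δ * M) ^ k * (k * δ * e) := by
    intro k
    induction k with
    | zero => simp
    | succ k ih =>
      intro hk
      set r := s + k * δ with hr
      have hr1 : s + (k + 1 : ℕ) * δ = r + δ := by rw [hr]; push_cast; ring
      have hrn : node s t N k = r := node_eq hst hNpos (by omega)
      have hrt : r ∈ Set.Icc s t := hrn ▸ node_mem hst N k
      have hrt' : r + δ ∈ Set.Icc s t := by
        rw [← hr1, ← node_eq hst hNpos hk]
        exact node_mem hst N _
      have hsub : Set.Icc r (r + δ) ⊆ Set.Icc s t := Set.Icc_subset_Icc hrt.1 hrt'.2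
      set u := euler δ (fun k => ℓ (node s t N k)) k (f s) with hu
      have hstep : ‖f (r + δ) - f r - δ • ℓ r (f r)‖ ≤ e * δ := by
        have h1 := (convex_Icc r (r + δ)).norm_image_sub_le_of_norm_hasDerivWithin_le
          (f := fun u => f u - u • ℓ r (f r)) (f' := fun u => ℓ u (f u) - ℓ r (f r)) (C := e)
          (x := r) (y := r + δ) (fun v hv => ?_) (fun v hv => ?_) ⟨le_rfl, by linarith⟩
          ⟨by linarith, le_rfl⟩
        · rw [add_sub_cancel_left, Real.norm_of_nonneg hδ0] at h1
          refine le_trans (le_of_eq ?_) h1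
          rw [add_smul]
          congr 1
          abel
        · have h2 := ((hasDerivAt_id v).smul_const (ℓ r (f r))).hasDerivWithinAt
            (s := Set.Icc r (r + δ))
          rw [one_smul] at h2
          exact ((hf v (hsub hv)).mono hsub).sub h2
        · rw [← dist_eq_norm]
          refine hη' v (hsub hv) r hrt ?_
          rw [Real.dist_eq, abs_of_nonneg (by linarith [hv.1])]
          linarith [hv.2]
      have hid : euler δ (fun k => ℓ (node s t N k)) (k + 1) (f s) - f (s + (k + 1 : ℕ) * δ) =
          ((u - f r) + δ • ℓ r (u - f r)) - (f (r + δ) - f r - δ • ℓ r (f r)) := by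
        rw [euler_succ, ← hu, hr1, hrn, map_sub, smul_sub, Complex.coe_smul]
        abel
      rw [hid]
      have h3 := ih (by omega)
      have h4 : ‖(u - f r) + δ • ℓ r (u - f r)‖ ≤ (1 + δ * M) * ‖u - f r‖ := by
        refine (norm_add_le _ _).trans ?_
        rw [norm_smul, Real.norm_of_nonneg hδ0, add_mul, one_mul, mul_assoc]
        gcongr
        exact (ℓ r).le_of_opNorm_le (hM r hrt) _
      have h5 : (1 : ℝ) ≤ (1 + δ * M) ^ (k + 1) := one_le_pow₀ (by nlinarith)
      calc _ ≤ (1 + δ * M) * ((1 + δ * M) ^ k * (k * δ * e)) + e * δ :=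
            (norm_sub_le _ _).trans (add_le_add
              (h4.trans (mul_le_mul_of_nonneg_left h3 (by positivity))) hstep)
        _ ≤ (1 + δ * M) * ((1 + δ * M) ^ k * (k * δ * e)) + (1 + δ * M) ^ (k + 1) * (e * δ) := by
            exact add_le_add le_rfl (le_mul_of_one_le_left (mul_nonneg he0.le hδ0) h5)
        _ = _ := by push_cast; ring
  have h1 := key N le_rfl
  have hNδ : N * δ = t - s := mul_div_cancel₀ _ hN'.ne'
  rw [hNδ, add_sub_cancel] at h1
  rw [dist_eq_norm]
  have h2 : (1 + δ * M) ^ N ≤ Real.exp ((t - s) * M) := by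
    rw [← hNδ, mul_assoc, Real.exp_nat_mul]
    gcongr
    linarith [Real.add_one_le_exp (δ * M)]
  calc _ ≤ _ := h1
    _ ≤ Real.exp ((t - s) * M) * ((t - s) * e) := by
        have : 0 ≤ (t - s) * e := mul_nonneg (by linarith) he0.le
        gcongr
    _ ≤ κ * e := by rw [hκ]; nlinarith
    _ = ε / 2 := by rw [he]; field_simp
    _ < ε := by linarith

end LinearODE

/-! ### Bimodule maps over commutants -/

section Blocks

variable {Γ : Type*} {H : Γ → Type*} [∀ x, NormedAddCommGroup (H x)]
  [∀ x, InnerProductSpace ℂ (H x)] [∀ x, CompleteSpace (H x)]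

theorem norm_fiber_le (X : Finset Γ) (η : OuterConfig H X) (f : TotalSpace H) :
    ‖fiber X η f‖ ≤ ‖f‖ := by
  have := sum_norm_sq_fiber_le X (n := 1) (η := fun _ => η) (Function.injective_of_subsingleton _) f
  rw [Fin.sum_univ_one] at this
  exact le_of_sq_le_sq this (norm_nonneg f)

theorem norm_embed (X : Finset Γ) (η : OuterConfig H X) (v : LocalSpace H X) :
    ‖embed X η v‖ = ‖v‖ := by
  have := norm_sq_sum_embed X (n := 1) (η := fun _ => η) (Function.injective_of_subsingleton _)
    fun _ => v
  rw [Fin.sum_univ_one, Fin.sum_univ_one] at this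
  exact (pow_left_inj₀ (norm_nonneg _) (norm_nonneg _) two_ne_zero).1 this

theorem norm_block_le (X : Finset Γ) (η ζ : OuterConfig H X) (A : Op H) :
    ‖block X η ζ A‖ ≤ ‖A‖ :=
  ContinuousLinearMap.opNorm_le_bound _ (norm_nonneg A) fun v => by
    rw [block_apply]
    refine (norm_fiber_le X η _).trans ?_
    simpa [norm_embed] using A.le_opNorm (embed X ζ v)

theorem block_smul (X : Finset Γ) (η ζ : OuterConfig H X) (a : ℂ) (A : Op H) :
    block X η ζ (a • A) = a • block X η ζ A := by
  ext1 v
  simp only [block_apply, smul_apply, fiber_smul]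

/-- Taking a block of an operator, as a bounded linear map. -/
def blockL (X : Finset Γ) (η ζ : OuterConfig H X) :
    Op H →L[ℂ] (LocalSpace H X →L[ℂ] LocalSpace H X) :=
  LinearMap.mkContinuous ⟨⟨block X η ζ, block_add X η ζ⟩, block_smul X η ζ⟩ 1
    fun A => by simpa using norm_block_le X η ζ A

@[simp]
theorem blockL_apply (X : Finset Γ) (η ζ : OuterConfig H X) (A : Op H) :
    blockL X η ζ A = block X η ζ A := rfl

/-- The ampliation as a bounded linear map. -/
def ampliationL (X : Finset Γ) : (LocalSpace H X →L[ℂ] LocalSpace H X) →L[ℂ] Op H :=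
  LinearMap.mkContinuous ((ampliation H X).toAlgHom.toLinearMap) 1
    fun a => by simpa using norm_ampliation_le X a

/-- Operators are determined by their blocks. -/
theorem ext_block (X : Finset Γ) {A B : Op H} (h : ∀ η ζ, block X η ζ A = block X η ζ B) :
    A = B := by
  have h1 : ∀ ζ v, A (embed X ζ v) = B (embed X ζ v) := fun ζ v => ext_fiber X fun η => by
    simpa only [block_apply] using congrArg (fun b => b v) (h η ζ)
  ext1 f
  have h2 := (hasSum_embed_fiber X f).mapL A
  simp only [h1] at h2
  exact h2.unique ((hasSum_embed_fiber X f).mapL B)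

/-- Convergence of sequences `S x` which depend on `x` in an equicontinuous way needs to be verified
on a net which approximates `x` only. -/
theorem cauchySeq_of_approx {E ι : Type*} [NormedAddCommGroup E] {S : E → ℕ → ℂ} {x : E} {C : ℝ}
    (hC : 0 ≤ C) (hS : ∀ y n, dist (S x n) (S y n) ≤ C * ‖x - y‖) {l : Filter ι} [l.NeBot]
    {y : ι → E} (hy : Tendsto y l (𝓝 x)) (hc : ∀ i, CauchySeq (S (y i))) : CauchySeq (S x) := by
  rw [Metric.cauchySeq_iff']
  intro ε hε
  obtain ⟨i, hi⟩ := (hy.eventually (Metric.ball_mem_nhds x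
    (show 0 < ε / (3 * (C + 1)) by positivity))).exists
  obtain ⟨N, hN⟩ := Metric.cauchySeq_iff'.1 (hc i) (ε / 3) (by positivity)
  have h1 : ∀ n, dist (S x n) (S (y i) n) ≤ ε / 3 := fun n => by
    refine (hS _ n).trans ?_
    rw [← dist_eq_norm, dist_comm]
    calc C * dist (y i) x ≤ (C + 1) * (ε / (3 * (C + 1))) := by
          have := le_of_lt (Metric.mem_ball.1 hi)
          gcongr
          linarith
      _ = ε / 3 := by field_simp
  refine ⟨N, fun n hn => ?_⟩
  calc dist (S x n) (S x N) ≤ dist (S x n) (S (y i) n) + dist (S (y i) n) (S (y i) N) +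
        dist (S (y i) N) (S x N) := dist_triangle4 _ _ _ _
    _ < ε := by
        have h2 := h1 N
        rw [dist_comm] at h2
        linarith [h1 n, hN n hn]

/-- A bounded sequence of operators all of whose blocks converge has a limit in the weak operator
topology. -/
theorem exists_weakTendsto_of_block (X : Finset Γ) {T : ℕ → Op H} {c : ℝ} (hT : ∀ n, ‖T n‖ ≤ c)
    (h : ∀ η ζ, ∃ b, Tendsto (fun n => block X η ζ (T n)) atTop (𝓝 b)) :
    ∃ B, WeakTendsto T B := by
  have hc : 0 ≤ c := (norm_nonneg _).trans (hT 0)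
  have h1 : ∀ v w n, ‖⟪v, T n w⟫_ℂ‖ ≤ c * ‖v‖ * ‖w‖ := fun v w n => by
    refine (norm_inner_le_norm _ _).trans ?_
    rw [mul_comm c, mul_assoc]
    gcongr
    exact (T n).le_of_opNorm_le (hT n) w
  have h2 : ∀ η v₀ w, CauchySeq fun n => ⟪embed X η v₀, T n w⟫_ℂ := fun η v₀ w => by
    refine cauchySeq_of_approx (S := fun w n => ⟪embed X η v₀, T n w⟫_ℂ)
      (C := c * ‖embed X η v₀‖) (by positivity) (fun y n => ?_) (hasSum_embed_fiber X w)
      (fun s => ?_)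
    · rw [dist_eq_norm, ← inner_sub_right, ← map_sub]
      exact h1 _ _ n
    · simp only [map_sum, inner_sum, ← inner_block]
      refine (tendsto_finsetSum s fun ζ _ => ?_).cauchySeq (x := ∑ ζ ∈ s,
        ⟪v₀, (h η ζ).choose (fiber X ζ w)⟫_ℂ)
      have := ((ContinuousLinearMap.apply ℂ _ (fiber X ζ w)).continuous.tendsto _).comp
        (h η ζ).choose_spec
      exact tendsto_const_nhds.inner this
  have h3 : ∀ v w, CauchySeq fun n => ⟪v, T n w⟫_ℂ := fun v w => by
    refine cauchySeq_of_approx (S := fun v n => ⟪v, T n w⟫_ℂ) (C := c * ‖w‖) (by positivity)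
      (fun y n => ?_) (hasSum_embed_fiber X v) (fun s => ?_)
    · rw [dist_eq_norm, ← inner_sub_left]
      refine (h1 _ _ n).trans (le_of_eq (by ring))
    · simp only [sum_inner]
      refine (tendsto_finsetSum s fun η _ => ?_).cauchySeq (x := ∑ η ∈ s,
        (cauchySeq_tendsto_of_complete (h2 η (fiber X η v) w)).choose)
      exact (cauchySeq_tendsto_of_complete (h2 η (fiber X η v) w)).choose_spec
  exact exists_weakTendsto hT fun v w => cauchySeq_tendsto_of_complete (h3 v w)

/-- `φ` is a bimodule map over the commutant of the local algebra of `X`. -/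
structure IsBimoduleMap (X : Finset Γ) (φ : Op H →L[ℂ] Op H) : Prop where
  map_mul_left : ∀ B, (∀ C ∈ localAlgebra H X, Commute C B) → ∀ A, φ (B * A) = B * φ A
  map_mul_right : ∀ B, (∀ C ∈ localAlgebra H X, Commute C B) → ∀ A, φ (A * B) = φ A * B

namespace IsBimoduleMap

variable {X Y : Finset Γ} {φ ψ : Op H →L[ℂ] Op H}

theorem one : IsBimoduleMap X (1 : Op H →L[ℂ] Op H) := ⟨fun _ _ _ => rfl, fun _ _ _ => rfl⟩

theorem mul (hφ : IsBimoduleMap X φ) (hψ : IsBimoduleMap X ψ) : IsBimoduleMap X (φ * ψ) where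
  map_mul_left B hB A := by
    rw [mul_apply_eq_comp, mul_apply_eq_comp, hψ.map_mul_left B hB, hφ.map_mul_left B hB]
  map_mul_right B hB A := by
    rw [mul_apply_eq_comp, mul_apply_eq_comp, hψ.map_mul_right B hB, hφ.map_mul_right B hB]

theorem add (hφ : IsBimoduleMap X φ) (hψ : IsBimoduleMap X ψ) : IsBimoduleMap X (φ + ψ) where
  map_mul_left B hB A := by
    rw [add_apply, add_apply, hφ.map_mul_left B hB, hψ.map_mul_left B hB, mul_add]
  map_mul_right B hB A := by
    rw [add_apply, add_apply, hφ.map_mul_right B hB, hψ.map_mul_right B hB, add_mul]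

theorem smul (hφ : IsBimoduleMap X φ) (a : ℂ) : IsBimoduleMap X (a • φ) where
  map_mul_left B hB A := by
    rw [smul_apply, smul_apply, hφ.map_mul_left B hB, mul_smul_comm]
  map_mul_right B hB A := by
    rw [smul_apply, smul_apply, hφ.map_mul_right B hB, smul_mul_assoc]

theorem sum {ι : Type*} (s : Finset ι) {φ : ι → Op H →L[ℂ] Op H}
    (hφ : ∀ i ∈ s, IsBimoduleMap X (φ i)) : IsBimoduleMap X (∑ i ∈ s, φ i) where
  map_mul_left B hB A := by
    rw [sum_apply, sum_apply, Finset.mul_sum]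
    exact Finset.sum_congr rfl fun i hi => (hφ i hi).map_mul_left B hB A
  map_mul_right B hB A := by
    rw [sum_apply, sum_apply, Finset.sum_mul]
    exact Finset.sum_congr rfl fun i hi => (hφ i hi).map_mul_right B hB A

theorem euler {ℓ : ℕ → Op H →L[ℂ] Op H} (h : ∀ k, IsBimoduleMap X (ℓ k)) (δ : ℝ) (k : ℕ) :
    IsBimoduleMap X (euler δ ℓ k) := by
  induction k with
  | zero => exact one
  | succ k ih => exact (one.add ((h k).smul _)).mul ih

theorem of_weakTendsto {φ : ℕ → Op H →L[ℂ] Op H} (hφ : ∀ n, IsBimoduleMap X (φ n))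
    (h : ∀ A, WeakTendsto (fun n => φ n A) (ψ A)) : IsBimoduleMap X ψ where
  map_mul_left B hB A := by
    refine (h (B * A)).unique ?_
    simp only [(hφ _).map_mul_left B hB]
    exact (h A).mul_left B
  map_mul_right B hB A := by
    refine (h (A * B)).unique ?_
    simp only [(hφ _).map_mul_right B hB]
    exact (h A).mul_right B

end IsBimoduleMap

/-- Bounded maps which converge on each operator in the weak operator topology have a limit. -/
theorem exists_limit_map {φ : ℕ → Op H →L[ℂ] Op H} {c : ℝ} (hφ : ∀ n, ‖φ n‖ ≤ c)
    (h : ∀ A, ∃ B, WeakTendsto (fun n => φ n A) B) :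
    ∃ ψ : Op H →L[ℂ] Op H, ∀ A, WeakTendsto (fun n => φ n A) (ψ A) := by
  have hc : 0 ≤ c := (norm_nonneg (φ 0)).trans (hφ 0)
  choose f hf using h
  refine ⟨LinearMap.mkContinuous ⟨⟨f, fun A B => ?_⟩, fun a A => ?_⟩ c fun A => ?_, hf⟩
  · refine (hf (A + B)).unique ?_
    simp only [map_add]
    exact (hf A).add (hf B)
  · refine (hf (a • A)).unique ?_
    simp only [map_smul]
    exact (hf A).smul a
  · exact (hf A).norm_le (by positivity)
      (Eventually.of_forall fun n => (φ n).le_of_opNorm_le (hφ n) A)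

variable [∀ x, Nontrivial (H x)]

/-- A reference configuration outside `X`. -/
def refOuter (X : Finset Γ) : OuterConfig H X := fun _ => Classical.arbitrary _

/-- The map of `B(ℋ_X)` induced by a map `φ` of `B(ℋ)` by compression to a reference block; for
maps which preserve the local algebra of `X` it is the restriction of `φ` to it. -/
def compress (X : Finset Γ) (φ : Op H →L[ℂ] Op H) :
    (LocalSpace H X →L[ℂ] LocalSpace H X) →L[ℂ] (LocalSpace H X →L[ℂ] LocalSpace H X) :=
  (blockL X (refOuter X) (refOuter X)).comp (φ.comp (ampliationL X))

theorem compress_apply (X : Finset Γ) (φ : Op H →L[ℂ] Op H)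
    (a : LocalSpace H X →L[ℂ] LocalSpace H X) :
    compress X φ a = block X (refOuter X) (refOuter X) (φ (ampliation H X a)) := rfl

namespace IsBimoduleMap

variable {X Y : Finset Γ} {φ ψ : Op H →L[ℂ] Op H}

theorem _root_.OpenLattice.IsLocalGenerator.isBimoduleMap {Z : Finset Γ} {c : ℝ}
    (h : IsLocalGenerator Z c φ) (hZ : Z ⊆ X) : IsBimoduleMap X φ where
  map_mul_left _ hB A := h.map_mul_left (fun C hC => hB C (localAlgebra_mono hZ hC)) A
  map_mul_right _ hB A := h.map_mul_right (fun C hC => hB C (localAlgebra_mono hZ hC)) A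

/-- Bimodule maps over the commutant of `𝒜_X` preserve the local algebras of all larger volumes, as
these are the commutants of the outer matrix units. -/
theorem map_mem (hφ : IsBimoduleMap X φ) (hXY : X ⊆ Y) {A : Op H} (hA : A ∈ localAlgebra H Y) :
    φ A ∈ localAlgebra H Y := by
  refine mem_localAlgebra_of_commute fun η ζ => ?_
  have hB : ∀ C ∈ localAlgebra H X, Commute C (outerUnit Y η ζ) := fun C hC =>
    commute_outerUnit hXY hC η ζ
  rw [commute_iff_eq, ← hφ.map_mul_right _ hB, ← hφ.map_mul_left _ hB,
    (commute_outerUnit subset_rfl hA η ζ).eq]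

theorem map_ampliation (hφ : IsBimoduleMap X φ) (a : LocalSpace H X →L[ℂ] LocalSpace H X) :
    φ (ampliation H X a) = ampliation H X (compress X φ a) := by
  obtain ⟨b, hb⟩ := hφ.map_mem subset_rfl (A := ampliation H X a) ⟨a, rfl⟩
  replace hb : ampliation H X b = φ (ampliation H X a) := hb
  rw [compress_apply, ← hb, block_ampliation]

/-- Bimodule maps act block by block. -/
theorem block_map (hφ : IsBimoduleMap X φ) (η ζ : OuterConfig H X) (A : Op H) :
    block X η ζ (φ A) = compress X φ (block X η ζ A) := by
  set η₀ : OuterConfig H X := refOuter X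
  have hB : ∀ η ζ, ∀ C ∈ localAlgebra H X, Commute C (outerUnit X η ζ) := fun η ζ C hC =>
    commute_outerUnit subset_rfl hC η ζ
  have h1 : ampliation H X (block X η ζ (φ A)) * outerUnit X η₀ η₀ =
      ampliation H X (compress X φ (block X η ζ A)) * outerUnit X η₀ η₀ := by
    rw [← outerUnit_mul_mul, ← hφ.map_ampliation, ← hφ.map_mul_right _ (hB _ _),
      ← outerUnit_mul_mul, hφ.map_mul_right _ (hB _ _), hφ.map_mul_left _ (hB _ _)]
  have h2 : ∀ b : LocalSpace H X →L[ℂ] LocalSpace H X,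
      block X η₀ η₀ (ampliation H X b * outerUnit X η₀ η₀) = b := fun b => by
    rw [block_ampliation_mul]
    have : block X η₀ η₀ (outerUnit X η₀ η₀) = 1 := by
      ext1 v
      rw [block_apply, outerUnit_apply, fiber_embed_self, fiber_embed_self, one_apply_eq_self]
    rw [this, mul_one]
  rw [← h2 (block X η ζ (φ A)), h1, h2]

end IsBimoduleMap

end Blocks

/-! ### Bounds for products of many short steps -/

section StepBounds

/-- Errors of second order disappear in the product over all `N` steps, as the bound tends to
`exp (τ * b)`. -/
theorem pow_step_le {a b τ : ℝ} (ha : 0 ≤ a) (hb : 0 ≤ b) (hτ : 0 ≤ τ) (N : ℕ) :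
    (1 + a * (τ / N) ^ 2 + τ / N * b) ^ N ≤ Real.exp (a * τ ^ 2 / N + τ * b) := by
  rcases N.eq_zero_or_pos with rfl | hN
  · simp only [pow_zero, Nat.cast_zero, div_zero, zero_add]
    exact Real.one_le_exp (mul_nonneg hτ hb)
  have hN' : (0 : ℝ) < N := by exact_mod_cast hN
  have h1 : a * τ ^ 2 / N + τ * b = N * (a * (τ / N) ^ 2 + τ / N * b) := by
    field_simp
  rw [h1, Real.exp_nat_mul]
  gcongr
  linarith [Real.add_one_le_exp (a * (τ / N) ^ 2 + τ / N * b)]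

theorem pow_step_le_zero {m τ : ℝ} (hτ : 0 ≤ τ) (N : ℕ) :
    (1 + 8 * (τ / N) ^ 2 * m ^ 2) ^ N ≤ Real.exp (8 * m ^ 2 * τ ^ 2 / N + τ * 0) := by
  refine le_trans (le_of_eq ?_) (pow_step_le (by positivity) le_rfl hτ N)
  ring

theorem tendsto_exp_step (a τ b : ℝ) :
    Tendsto (fun N : ℕ => Real.exp (a * τ ^ 2 / N + τ * b)) atTop (𝓝 (Real.exp (τ * b))) := by
  refine (Real.continuous_exp.tendsto _).comp ?_
  simpa using (tendsto_const_div_atTop_nhds_zero_nat (a * τ ^ 2)).add_const (τ * b)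

end StepBounds

/-! ### Finite volume evolutions on all bounded operators -/

section Evolution

variable {Γ : Type*} [MetricSpace Γ] {H : Γ → Type*} [∀ x, NormedAddCommGroup (H x)]
  [∀ x, InnerProductSpace ℂ (H x)] [∀ x, CompleteSpace (H x)]

/-- The propagator from time `s` to time `t` of the Euler scheme with `N` steps, in the
volume `Λ`. -/
def eulerOp (φ : ℝ → Finset Γ → Op H →L[ℂ] Op H) (Λ : Finset Γ) (t s : ℝ) (N : ℕ) :
    Op H →L[ℂ] Op H :=
  euler ((t - s) / N) (fun k => ∑ Z ∈ Λ.powerset, φ (node s t N k) Z) N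

/-- The finite volume evolution on all bounded operators: the limit of the Euler scheme in the weak
operator topology.  (Outside of the local algebra of `Λ` norm limits need not exist, because the
generators need not depend continuously on time there.) -/
def evolution (φ : ℝ → Finset Γ → Op H →L[ℂ] Op H) (Λ : Finset Γ) (t s : ℝ) : Op H →L[ℂ] Op H :=
  Classical.epsilon fun ψ => ∀ A, WeakTendsto (fun N => eulerOp φ Λ t s N A) (ψ A)

variable [∀ x, Nontrivial (H x)]

/-- A family of local generators with decaying bounds, locally uniformly in time, whose sums over
finite volumes are norm continuous on the local algebras. -/
structure IsGeneratorFamily (F : ℝ → ℝ) (φ : ℝ → Finset Γ → Op H →L[ℂ] Op H)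
    (c : ℝ → Finset Γ → ℝ) : Prop where
  isLocalGenerator : ∀ r Z, IsLocalGenerator Z (c r Z) (φ r Z)
  decay : ∀ T, ∃ M, 0 ≤ M ∧ ∀ r ≤ T, HasDecay F M (c r)
  continuous : ∀ Λ : Finset Γ, Continuous fun r => compress Λ (∑ Z ∈ Λ.powerset, φ r Z)

namespace IsGeneratorFamily

variable {F : ℝ → ℝ} {φ : ℝ → Finset Γ → Op H →L[ℂ] Op H} {c : ℝ → Finset Γ → ℝ}
  {Λ : Finset Γ} {r s t : ℝ}

theorem isBimoduleMap (hφ : IsGeneratorFamily F φ c) (Λ : Finset Γ) (r : ℝ) :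
    IsBimoduleMap Λ (∑ Z ∈ Λ.powerset, φ r Z) :=
  IsBimoduleMap.sum _ fun Z hZ => (hφ.isLocalGenerator r Z).isBimoduleMap (Finset.mem_powerset.1 hZ)

theorem isBimoduleMap_eulerOp (hφ : IsGeneratorFamily F φ c) (Λ : Finset Γ) (t s : ℝ) (N : ℕ) :
    IsBimoduleMap Λ (eulerOp φ Λ t s N) :=
  IsBimoduleMap.euler (fun _ => hφ.isBimoduleMap Λ _) _ _

theorem block_eulerOp (hφ : IsGeneratorFamily F φ c) (Λ : Finset Γ) (t s : ℝ) (N : ℕ)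
    (η ζ : OuterConfig H Λ) (A : Op H) : block Λ η ζ (eulerOp φ Λ t s N A) =
      euler ((t - s) / N) (fun k => compress Λ (∑ Z ∈ Λ.powerset, φ (node s t N k) Z)) N
        (block Λ η ζ A) :=
  (euler_intertwine (block_add Λ η ζ) (block_smul Λ η ζ)
    (fun k A => ((hφ.isBimoduleMap Λ (node s t N k)).block_map η ζ A).symm) N A).symm

theorem exists_bound (hφ : IsGeneratorFamily F φ c) (hst : s ≤ t) (Λ : Finset Γ) :
    ∃ m, 0 ≤ m ∧ ∀ N k, ∑ Z ∈ Λ.powerset, c (node s t N k) Z ≤ m := by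
  obtain ⟨M, hM, hc⟩ := hφ.decay t
  exact ⟨max 0 (Λ.card * (M * F 0)), le_max_left _ _, fun N k =>
    ((hc _ (node_mem hst N k).2).sum_le_card subset_rfl).trans (le_max_right _ _)⟩

theorem norm_eulerOp_le (hφ : IsGeneratorFamily F φ c) (hst : s ≤ t) {m : ℝ}
    (hm : ∀ N k, ∑ Z ∈ Λ.powerset, c (node s t N k) Z ≤ m) (N : ℕ) :
    ‖eulerOp φ Λ t s N‖ ≤ Real.exp (8 * m ^ 2 * (t - s) ^ 2 / N + (t - s) * 0) := by
  have hδ : 0 ≤ (t - s) / N := div_nonneg (by linarith) N.cast_nonneg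
  have h1 : ‖eulerOp φ Λ t s N‖ ≤ (1 + 8 * ((t - s) / N) ^ 2 * m ^ 2) ^ N :=
    norm_euler_le (by positivity) (fun k =>
      norm_one_add_smul_sum_le (hφ.isLocalGenerator (node s t N k)) (hm N k) hδ) N
  exact h1.trans (pow_step_le_zero (sub_nonneg.2 hst) N)

/-- The Euler scheme converges because its blocks do. -/
theorem evolution_spec (hφ : IsGeneratorFamily F φ c) (hst : s ≤ t) (Λ : Finset Γ) (A : Op H) :
    WeakTendsto (fun N => eulerOp φ Λ t s N A) (evolution φ Λ t s A) := by
  obtain ⟨m, -, hm⟩ := hφ.exists_bound hst Λ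
  have hb : ∀ N, ‖eulerOp φ Λ t s N‖ ≤ Real.exp (8 * m ^ 2 * (t - s) ^ 2) := fun N => by
    refine (hφ.norm_eulerOp_le hst hm N).trans (Real.exp_le_exp.2 ?_)
    rw [mul_zero, add_zero]
    rcases N.eq_zero_or_pos with rfl | hN
    · simp only [Nat.cast_zero, div_zero]; positivity
    · exact div_le_self (by positivity) (by exact_mod_cast hN)
  have hex : ∃ ψ : Op H →L[ℂ] Op H, ∀ A, WeakTendsto (fun N => eulerOp φ Λ t s N A) (ψ A) := by
    refine exists_limit_map hb fun A => ?_
    refine exists_weakTendsto_of_block Λ (fun N => (eulerOp φ Λ t s N).le_of_opNorm_le (hb N) A)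
      fun η ζ => ?_
    obtain ⟨f, hf, hf'⟩ := exists_solvesLinear (hφ.continuous Λ).continuousOn hst (block Λ η ζ A)
    refine ⟨f t, ?_⟩
    simp only [hφ.block_eulerOp]
    rw [← hf]
    exact hf'.tendsto_euler (hφ.continuous Λ).continuousOn hst
  exact Classical.epsilon_spec hex A

/-- Each block of an evolved operator solves the evolution equation of the local algebra. -/
theorem block_evolution (hφ : IsGeneratorFamily F φ c) (hst : s ≤ t) {η ζ : OuterConfig H Λ}
    {A : Op H} {f : ℝ → LocalSpace H Λ →L[ℂ] LocalSpace H Λ}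
    (hf : SolvesLinear (fun r => compress Λ (∑ Z ∈ Λ.powerset, φ r Z)) s t f)
    (hs : f s = block Λ η ζ A) : block Λ η ζ (evolution φ Λ t s A) = f t := by
  have h1 := (hφ.evolution_spec hst Λ A).block Λ η ζ
  have h2 := hf.tendsto_euler (hφ.continuous Λ).continuousOn hst
  simp only [hs, ← hφ.block_eulerOp] at h2
  exact h1.unique (WeakTendsto.of_norm_tendsto h2)

theorem isBimoduleMap_evolution (hφ : IsGeneratorFamily F φ c) (hst : s ≤ t) :
    IsBimoduleMap Λ (evolution φ Λ t s) :=
  IsBimoduleMap.of_weakTendsto (fun N => hφ.isBimoduleMap_eulerOp Λ t s N)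
    (hφ.evolution_spec hst Λ)

theorem norm_evolution_apply_le (hφ : IsGeneratorFamily F φ c) (hst : s ≤ t) (A : Op H) :
    ‖evolution φ Λ t s A‖ ≤ ‖A‖ := by
  obtain ⟨m, -, hm⟩ := hφ.exists_bound hst Λ
  have h1 : Tendsto (fun N : ℕ => Real.exp (8 * m ^ 2 * (t - s) ^ 2 / N + (t - s) * 0) * ‖A‖) atTop
      (𝓝 (1 * ‖A‖)) := by
    have := (tendsto_exp_step (8 * m ^ 2) (t - s) 0).mul_const ‖A‖
    simpa using this
  refine le_of_forall_gt_imp_ge_of_dense fun a ha => ?_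
  refine (hφ.evolution_spec hst Λ A).norm_le ((norm_nonneg A).trans ha.le) ?_
  filter_upwards [h1.eventually_lt_const (show 1 * ‖A‖ < a by rwa [one_mul])] with N hN
  exact ((eulerOp φ Λ t s N).le_of_opNorm_le (hφ.norm_eulerOp_le hst hm N) A).trans hN.le

theorem evolution_one (hφ : IsGeneratorFamily F φ c) (hst : s ≤ t) :
    evolution φ Λ t s 1 = 1 := by
  refine (hφ.evolution_spec hst Λ 1).unique ?_
  have h : ∀ N, eulerOp φ Λ t s N 1 = 1 := fun N => by
    have : ∀ k, euler ((t - s) / N) (fun k => ∑ Z ∈ Λ.powerset, φ (node s t N k) Z) k 1 = 1 := by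
      intro k
      induction k with
      | zero => rfl
      | succ k ih => simp [euler_succ, ih, (hφ.isLocalGenerator _ _).map_one]
    exact this N
  simp only [h]
  exact WeakTendsto.const 1

theorem isCPMap_evolution (hφ : IsGeneratorFamily F φ c) (hst : s ≤ t) :
    IsCPMap (evolution φ Λ t s) := by
  obtain ⟨m, hm0, hm⟩ := hφ.exists_bound hst Λ
  have hδ : ∀ N : ℕ, 0 ≤ (t - s) / N := fun N => div_nonneg (by linarith) N.cast_nonneg
  choose V hV hV' using fun N : ℕ => exists_isCPMap_euler
    (φ := fun k => φ (node s t N k)) (fun k => hφ.isLocalGenerator (node s t N k))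
    (hδ N) (hm N) N
  have h1 : Tendsto (fun N : ℕ => 4 * m ^ 2 * (t - s) ^ 2 / N *
      Real.exp (8 * m ^ 2 * (t - s) ^ 2 / N + (t - s) * 0)) atTop (𝓝 0) := by
    have := (tendsto_const_div_atTop_nhds_zero_nat (4 * m ^ 2 * (t - s) ^ 2)).mul
      (tendsto_exp_step (8 * m ^ 2) (t - s) 0)
    rwa [zero_mul] at this
  have h2 : Tendsto (fun N : ℕ => ‖eulerOp φ Λ t s N - V N‖) atTop (𝓝 0) := by
    refine squeeze_zero_norm' ?_ h1
    filter_upwards [eventually_gt_atTop 0] with N hN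
    have hN' : (N : ℝ) ≠ 0 := by exact_mod_cast hN.ne'
    refine (abs_norm (eulerOp φ Λ t s N - V N)).trans_le ((hV' N).trans ?_)
    have h4 : N * (4 * ((t - s) / N) ^ 2 * m ^ 2) = 4 * m ^ 2 * (t - s) ^ 2 / N := by
      field_simp
    rw [h4]
    gcongr
    exact pow_step_le_zero (sub_nonneg.2 hst) N
  have h3 : ∀ A, WeakTendsto (fun N => V N A) (evolution φ Λ t s A) := fun A => by
    have h4 : WeakTendsto (fun N => (eulerOp φ Λ t s N - V N) A) 0 := by
      refine WeakTendsto.of_tendsto fun w => ?_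
      rw [zero_apply]
      refine squeeze_zero_norm (a := fun N => ‖eulerOp φ Λ t s N - V N‖ * ‖A‖ * ‖w‖)
        (fun N => ?_) ?_
      · exact ((eulerOp φ Λ t s N - V N) A).le_of_opNorm_le
          ((eulerOp φ Λ t s N - V N).le_opNorm A) w
      · have := (h2.mul_const ‖A‖).mul_const ‖w‖
        simpa only [zero_mul] using this
    have h5 := (hφ.evolution_spec hst Λ A).sub h4
    simpa only [sub_apply, sub_sub_cancel, sub_zero] using h5
  intro n K hK
  exact IsPosKernel.of_weakTendsto (fun N => hV N n K hK) fun i j => h3 (K i j)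

theorem norm_evolution_sub_le (hφ : IsGeneratorFamily F φ c) (hst : s ≤ t) {m : ℝ}
    (hm : ∀ r ≤ t, ∑ Z ∈ Λ.powerset, c r Z ≤ m) (A : Op H) :
    ‖evolution φ Λ t s A - A‖ ≤ (t - s) * m * ‖A‖ := by
  have hm' : ∀ N k, ∑ Z ∈ Λ.powerset, c (node s t N k) Z ≤ m := fun N k =>
    hm _ (node_mem hst N k).2
  have hφm : ∀ r ≤ t, ‖∑ Z ∈ Λ.powerset, φ r Z‖ ≤ m := fun r hr =>
    (opNorm_sum_le _ _).trans ((Finset.sum_le_sum fun Z _ =>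
      (hφ.isLocalGenerator r Z).norm_le).trans (hm r hr))
  have hm0 : 0 ≤ m := (norm_nonneg (∑ Z ∈ Λ.powerset, φ t Z)).trans (hφm t le_rfl)
  have h1 : Tendsto (fun N : ℕ => (t - s) * m *
      Real.exp (8 * m ^ 2 * (t - s) ^ 2 / N + (t - s) * 0) * ‖A‖) atTop
      (𝓝 ((t - s) * m * ‖A‖)) := by
    have := ((tendsto_exp_step (8 * m ^ 2) (t - s) 0).const_mul ((t - s) * m)).mul_const ‖A‖
    simpa using this
  have h0 : 0 ≤ t - s := by linarith
  refine le_of_forall_gt_imp_ge_of_dense fun a ha => ?_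
  refine ((hφ.evolution_spec hst Λ A).sub (WeakTendsto.const A)).norm_le
    ((show 0 ≤ (t - s) * m * ‖A‖ by positivity).trans ha.le) ?_
  filter_upwards [h1.eventually_lt_const ha, eventually_gt_atTop 0] with N hN hNpos
  refine le_trans ?_ hN.le
  have hN' : (N : ℝ) ≠ 0 := by exact_mod_cast hNpos.ne'
  have hδ : 0 ≤ (t - s) / N := div_nonneg h0 N.cast_nonneg
  have h2 : ‖eulerOp φ Λ t s N - 1‖ ≤
      N * ((t - s) / N) * m * (1 + 8 * ((t - s) / N) ^ 2 * m ^ 2) ^ N :=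
    norm_euler_sub_one_le hδ (by linarith [show 0 ≤ 8 * ((t - s) / N) ^ 2 * m ^ 2 by positivity])
      (fun k => norm_one_add_smul_sum_le (hφ.isLocalGenerator (node s t N k)) (hm' N k) hδ)
      (fun k => hφm _ (node_mem hst N k).2) N
  rw [mul_div_cancel₀ _ hN'] at h2
  have h4 : ‖eulerOp φ Λ t s N - 1‖ ≤
      (t - s) * m * Real.exp (8 * m ^ 2 * (t - s) ^ 2 / N + (t - s) * 0) := by
    refine h2.trans ?_
    gcongr
    exact pow_step_le_zero h0 N
  exact (eulerOp φ Λ t s N - 1).le_of_opNorm_le h4 A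

theorem evolution_self (hφ : IsGeneratorFamily F φ c) (Λ : Finset Γ) (s : ℝ) :
    evolution φ Λ s s = 1 := by
  obtain ⟨M, hM, hc⟩ := hφ.decay s
  ext1 A
  have h := hφ.norm_evolution_sub_le (Λ := Λ) le_rfl
    (fun r hr => (hc r hr).sum_le_card subset_rfl) A
  rw [sub_self, zero_mul, zero_mul] at h
  exact sub_eq_zero.1 (norm_le_zero_iff.1 h)

/-- The cocycle property follows from that of the solutions of the evolution equation of each
block. -/
theorem evolution_comp (hφ : IsGeneratorFamily F φ c) (hrs : r ≤ s) (hst : s ≤ t) (A : Op H) :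
    evolution φ Λ t s (evolution φ Λ s r A) = evolution φ Λ t r A := by
  refine ext_block Λ fun η ζ => ?_
  obtain ⟨f, hf, hf'⟩ := exists_solvesLinear (hφ.continuous Λ).continuousOn (hrs.trans hst)
    (block Λ η ζ A)
  rw [hφ.block_evolution (hrs.trans hst) hf' hf]
  refine hφ.block_evolution hst (hf'.mono hrs le_rfl) ?_
  exact (hφ.block_evolution hrs (hf'.mono le_rfl hst) hf).symm

/-- The finite volume evolutions are Lipschitz continuous in both times. -/
theorem norm_evolution_sub_evolution_le (hφ : IsGeneratorFamily F φ c) {T m : ℝ}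
    (hm : ∀ r ≤ T, ∑ Z ∈ Λ.powerset, c r Z ≤ m) {s' t' : ℝ} (hst : s ≤ t) (hst' : s' ≤ t')
    (htT : t ≤ T) (htT' : t' ≤ T) (A : Op H) :
    ‖evolution φ Λ t s A - evolution φ Λ t' s' A‖ ≤ (|t - t'| + |s - s'|) * (m * ‖A‖) := by
  have hm0 : 0 ≤ m :=
    (Finset.sum_nonneg fun Z _ => (norm_nonneg (φ T Z)).trans
      (hφ.isLocalGenerator T Z).norm_le).trans (hm T le_rfl)
  -- changing the later time
  have h1 : ∀ {s t u : ℝ}, s ≤ t → t ≤ u → u ≤ T →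
      ‖evolution φ Λ u s A - evolution φ Λ t s A‖ ≤ (u - t) * (m * ‖A‖) := by
    intro s t u hst htu huT
    rw [← hφ.evolution_comp hst htu, ← mul_assoc]
    refine (hφ.norm_evolution_sub_le htu (fun r hr => hm r (hr.trans huT)) _).trans ?_
    have h0 : 0 ≤ u - t := by linarith
    gcongr
    exact hφ.norm_evolution_apply_le hst A
  -- changing the earlier time
  have h2 : ∀ {s s' t : ℝ}, s ≤ s' → s' ≤ t → t ≤ T →
      ‖evolution φ Λ t s A - evolution φ Λ t s' A‖ ≤ (s' - s) * (m * ‖A‖) := by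
    intro s s' t hss hst htT
    rw [← hφ.evolution_comp hss hst, ← mul_assoc, ← map_sub]
    exact (hφ.norm_evolution_apply_le hst _).trans
      (hφ.norm_evolution_sub_le hss (fun r hr => hm r (hr.trans (hst.trans htT))) _)
  have h3 : ∀ {s s' u : ℝ}, s ≤ u → s' ≤ u → u ≤ T →
      ‖evolution φ Λ u s A - evolution φ Λ u s' A‖ ≤ |s - s'| * (m * ‖A‖) := by
    intro s s' u hs hs' hu
    rcases le_total s s' with h | h
    · rw [abs_sub_comm, abs_of_nonneg (by linarith)]
      exact h2 h hs' hu
    · rw [norm_sub_rev, abs_of_nonneg (by linarith)]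
      exact h2 h hs hu
  rcases le_total t t' with h | h
  · calc _ ≤ ‖evolution φ Λ t s A - evolution φ Λ t' s A‖ +
        ‖evolution φ Λ t' s A - evolution φ Λ t' s' A‖ := norm_sub_le_norm_sub_add_norm_sub _ _ _
      _ ≤ |t - t'| * (m * ‖A‖) + |s - s'| * (m * ‖A‖) := by
          refine add_le_add ?_ (h3 (hst.trans h) hst' htT')
          rw [norm_sub_rev, abs_sub_comm, abs_of_nonneg (by linarith)]
          exact h1 hst h htT'
      _ = _ := by ring
  · calc _ ≤ ‖evolution φ Λ t s A - evolution φ Λ t s' A‖ +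
        ‖evolution φ Λ t s' A - evolution φ Λ t' s' A‖ := norm_sub_le_norm_sub_add_norm_sub _ _ _
      _ ≤ |s - s'| * (m * ‖A‖) + |t - t'| * (m * ‖A‖) := by
          refine add_le_add (h3 hst (hst'.trans h) htT) ?_
          rw [abs_of_nonneg (by linarith)]
          exact h1 hst' h htT
      _ = _ := by ring

open Classical in
/-- Comparison of the evolutions in two volumes `Λ ⊆ Λ'`: the Lieb–Robinson bound shows that the
difference is controlled by the part of `Λ'` outside of `Λ`, uniformly in `Λ'`. -/
theorem norm_evolution_sub_evolution_le_spread (hφ : IsGeneratorFamily F φ c)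
    (hF : IsDecayFunction Γ F) {C : ℝ} (hC0 : 0 ≤ C)
    (hC : ∀ (x y : Γ) (s : Finset Γ), ∑ w ∈ s, F (dist x w) * F (dist w y) ≤ C * F (dist x y))
    {M : ℝ} (hM : 0 ≤ M) (hst : s ≤ t) (hc : ∀ r ≤ t, HasDecay F M (c r)) {Λ' : Finset Γ}
    (hΛ : Λ ⊆ Λ') {X : Finset Γ} {A : Op H} (hA : A ∈ localAlgebra H X) :
    ‖evolution φ Λ' t s A - evolution φ Λ t s A‖ ≤
      (t - s) * Real.exp ((t - s) * (M * C)) *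
        (‖A‖ * (F 0)⁻¹ * (M * C * ∑ y ∈ Λ' \ Λ, spread F X y)) := by
  set R := ‖A‖ * (F 0)⁻¹ * (M * C * ∑ y ∈ Λ' \ Λ, spread F X y) with hR
  have hF0 : 0 < F 0 := hF.pos 0 le_rfl
  have hR0 : 0 ≤ R := by
    have : 0 ≤ ∑ y ∈ Λ' \ Λ, spread F X y := Finset.sum_nonneg fun y _ => spread_nonneg hF X y
    positivity
  have h0 : 0 ≤ t - s := by linarith
  set m : ℝ := Λ'.card * (M * F 0) with hm
  have h1 : Tendsto (fun N : ℕ => (t - s) *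
      (Real.exp (8 * m ^ 2 * (t - s) ^ 2 / N + (t - s) * 0) *
        Real.exp (8 * m ^ 2 * (t - s) ^ 2 / N + (t - s) * (M * C))) * R) atTop
      (𝓝 ((t - s) * Real.exp ((t - s) * (M * C)) * R)) := by
    have := (((tendsto_exp_step (8 * m ^ 2) (t - s) 0).mul
      (tendsto_exp_step (8 * m ^ 2) (t - s) (M * C))).const_mul (t - s)).mul_const R
    simpa using this
  refine le_of_forall_gt_imp_ge_of_dense fun a ha => ?_
  refine ((hφ.evolution_spec hst Λ' A).sub (hφ.evolution_spec hst Λ A)).norm_le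
    ((show 0 ≤ (t - s) * Real.exp ((t - s) * (M * C)) * R by positivity).trans ha.le) ?_
  filter_upwards [h1.eventually_lt_const ha, eventually_gt_atTop 0] with N hN hNpos
  refine le_trans ?_ hN.le
  have hN' : (N : ℝ) ≠ 0 := by exact_mod_cast hNpos.ne'
  have hδ : 0 ≤ (t - s) / N := div_nonneg h0 N.cast_nonneg
  have h2 := norm_euler_sub_euler_le hF hC hC0 hM (φ := fun k => φ (node s t N k))
    (c := fun k => c (node s t N k)) (fun k => hφ.isLocalGenerator (node s t N k))
    (fun k => hc _ (node_mem hst N k).2) hδ hΛ (m := m) le_rfl hA N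
  rw [mul_div_cancel₀ _ hN'] at h2
  refine h2.trans ?_
  have h4 := pow_step_le (a := 8 * m ^ 2) (b := M * C) (by positivity) (by positivity) h0 N
  gcongr
  · exact pow_step_le_zero h0 N
  · refine le_trans (le_of_eq ?_) h4
    ring

end IsGeneratorFamily

end Evolution

/-! ### Compressions of local observables -/

section Compressions

variable {Γ : Type*} {H : Γ → Type*} [∀ x, NormedAddCommGroup (H x)]
  [∀ x, InnerProductSpace ℂ (H x)] [∀ x, CompleteSpace (H x)]

theorem ampliation_mem (X : Finset Γ) (a : LocalSpace H X →L[ℂ] LocalSpace H X) :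
    ampliation H X a ∈ localAlgebra H X := ⟨a, rfl⟩

/-- The matrix unit `|ξ⟩⟨ξ'| ⊗ 1` of the local algebra of `Y`. -/
def innerUnit (Y : Finset Γ) (ξ ξ' : LocalConfig H Y) : Op H :=
  ampliation H Y (InnerProductSpace.rankOne ℂ (basisVec ξ) (basisVec ξ'))

theorem innerUnit_mem (Y : Finset Γ) (ξ ξ' : LocalConfig H Y) :
    innerUnit Y ξ ξ' ∈ localAlgebra H Y := ⟨_, rfl⟩

open Classical in
theorem coeff_innerUnit (Y : Finset Γ) (ξ ξ' : LocalConfig H Y) (σ τ : Config H) :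
    coeff (innerUnit Y ξ ξ') σ τ = if (splitConfig Y σ).1 = (splitConfig Y τ).1 ∧
      (splitConfig Y σ).2 = ξ ∧ (splitConfig Y τ).2 = ξ' then 1 else 0 := by
  rw [innerUnit, coeff_ampliation]
  have h : ∀ i j : LocalConfig H Y,
      coeff (InnerProductSpace.rankOne ℂ (basisVec ξ) (basisVec ξ')) i j =
        if i = ξ ∧ j = ξ' then 1 else 0 := fun i j => by
    rw [coeff, InnerProductSpace.rankOne_apply, inner_basisVec, lp.coeFn_smul, Pi.smul_apply,
      basisVec_apply, basisVec_apply]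
    rw [eq_comm (a := ξ')]
    by_cases h1 : i = ξ <;> by_cases h2 : j = ξ' <;> simp [h1, h2]
  rw [h]
  split_ifs <;> simp_all

open Classical in
/-- Compression by minimal projections of the local algebra of `Y` selects matrix elements. -/
theorem coeff_compression (Y : Finset Γ) (ξ ξ' : LocalConfig H Y) (A : Op H) (σ τ : Config H) :
    coeff (innerUnit Y ξ ξ * A * innerUnit Y ξ' ξ') σ τ =
      if (splitConfig Y σ).2 = ξ ∧ (splitConfig Y τ).2 = ξ' then coeff A σ τ else 0 := by
  have h : ∀ (ξ : LocalConfig H Y) (σ τ : Config H), coeff (innerUnit Y ξ ξ) σ τ =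
      if σ = τ ∧ (splitConfig Y σ).2 = ξ then 1 else 0 := fun ξ σ τ => by
    rw [coeff_innerUnit]
    refine if_congr ⟨fun h => ⟨(splitConfig Y).injective (Prod.ext h.1 (h.2.1.trans h.2.2.symm)),
      h.2.1⟩, ?_⟩ rfl rfl
    rintro ⟨rfl, h⟩
    exact ⟨rfl, h, h⟩
  have h1 : ∀ σ τ, coeff (innerUnit Y ξ ξ * A) σ τ =
      if (splitConfig Y σ).2 = ξ then coeff A σ τ else 0 := fun σ τ => by
    refine (hasSum_coeff_mul _ _ σ τ).unique ?_
    convert hasSum_single σ fun ρ hρ => ?_ using 1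
    · rw [h]; split_ifs <;> simp_all
    · rw [h, if_neg (fun h => hρ h.1.symm), zero_mul]
  refine (hasSum_coeff_mul _ _ σ τ).unique ?_
  convert hasSum_single τ fun ρ hρ => ?_ using 1
  · rw [h, h1]; split_ifs <;> simp_all
  · rw [h, if_neg (fun h => hρ h.1), mul_zero]

theorem embed_basisVec (X : Finset Γ) (η : OuterConfig H X) (ξ : LocalConfig H X) :
    embed X η (basisVec ξ) = basisVec ((splitConfig X).symm (η, ξ)) := by
  classical
  refine ext_fiber X fun ζ => ?_
  rw [fiber_embed, fiber_basisVec, Equiv.apply_symm_apply]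

theorem coeff_block (X : Finset Γ) (η ζ : OuterConfig H X) (A : Op H) (ξ ξ' : LocalConfig H X) :
    coeff (block X η ζ A) ξ ξ' =
      coeff A ((splitConfig X).symm (η, ξ)) ((splitConfig X).symm (ζ, ξ')) := by
  rw [coeff_eq_inner, inner_block, embed_basisVec, embed_basisVec, coeff_eq_inner]

theorem splitConfig_symm_eq_glue (X : Finset Γ) (σ ρ : Config H) :
    (splitConfig X).symm ((splitConfig X σ).1, (splitConfig X ρ).2) = glue (X : Set Γ) ρ σ := by
  rw [Equiv.symm_apply_eq]
  refine Prod.ext (funext fun x => ?_) (funext fun x => ?_)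
  · rw [splitConfig_fst, splitConfig_fst, glue_of_notMem (by exact_mod_cast x.2)]
  · rw [splitConfig_snd, splitConfig_snd, glue_of_mem (by exact_mod_cast x.2)]

open Classical in
/-- The compressions of an observable of `X ⊇ Λ` by minimal projections of the local algebra of
`X \ Λ` are products of observables of `Λ` and matrix units of `X \ Λ`. -/
theorem exists_compression_eq {Λ X : Finset Γ} (hΛ : Λ ⊆ X) {A : Op H}
    (hA : ActsOn (X : Set Γ) A) (σ τ : Config H) : ∃ a ∈ localAlgebra H Λ,
      innerUnit (X \ Λ) (splitConfig (X \ Λ) σ).2 (splitConfig (X \ Λ) σ).2 * A *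
        innerUnit (X \ Λ) (splitConfig (X \ Λ) τ).2 (splitConfig (X \ Λ) τ).2 =
      a * innerUnit (X \ Λ) (splitConfig (X \ Λ) σ).2 (splitConfig (X \ Λ) τ).2 := by
  set Y := X \ Λ with hY
  set σ' : Config H := glue (Y : Set Γ) τ σ with hσ'
  refine ⟨ampliation H Λ (block Λ (splitConfig Λ σ).1 (splitConfig Λ σ').1 A), ⟨_, rfl⟩, ?_⟩
  refine ext_coeff fun ρ κ => ?_
  have hdisj : Disjoint (Λ : Set Γ) (Y : Set Γ) := by
    rw [Finset.disjoint_coe, hY]; exact Finset.disjoint_sdiff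
  have hYΛ : ∀ x ∈ Y, x ∉ Λ := fun x hx => (Finset.mem_sdiff.1 hx).2
  have hX : ∀ x, x ∈ X → x ∉ Λ → x ∈ Y := fun x h1 h2 => Finset.mem_sdiff.2 ⟨h1, h2⟩
  have hg : ∀ x, x ∉ Λ → glue (Λ : Set Γ) κ ρ x = ρ x := fun x hx =>
    glue_of_notMem (by exact_mod_cast hx) κ ρ
  have hg' : ∀ x, x ∈ Λ → glue (Λ : Set Γ) κ ρ x = κ x := fun x hx =>
    glue_of_mem (by exact_mod_cast hx) κ ρ
  have e1 : (splitConfig Λ ρ).1 = (splitConfig Λ (glue (Λ : Set Γ) κ ρ)).1 :=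
    funext fun x => (hg x x.2).symm
  have e2 : (splitConfig Λ (glue (Λ : Set Γ) κ ρ)).2 = (splitConfig Λ κ).2 :=
    funext fun x => hg' x x.2
  have e3 : (splitConfig Y (glue (Λ : Set Γ) κ ρ)).2 = (splitConfig Y ρ).2 :=
    funext fun x => hg x (hYΛ x x.2)
  rw [coeff_compression,
    (actsOn_ampliation Λ _).coeff_mul hdisj (actsOn_of_mem (innerUnit_mem Y _ _)),
    coeff_ampliation, if_pos e1, coeff_block, coeff_innerUnit, e2, e3,
    splitConfig_symm_eq_glue, splitConfig_symm_eq_glue]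
  by_cases h : (splitConfig Y ρ).2 = (splitConfig Y σ).2 ∧ (splitConfig Y κ).2 = (splitConfig Y τ).2
  · rw [if_pos h]
    have hρ : ∀ x ∈ Y, ρ x = σ x := fun x hx => congrFun h.1 ⟨x, hx⟩
    have hκ : ∀ x ∈ Y, κ x = τ x := fun x hx => congrFun h.2 ⟨x, hx⟩
    by_cases hout : ∀ x, x ∉ X → ρ x = κ x
    · rw [if_pos, mul_one]
      · refine hA.congr _ _ _ _ (fun x hx => hout x (by simpa using hx)) (fun x hx => ?_)
          (fun x hx => ?_) (fun x hx => ?_)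
        · have hxX : x ∉ X := by simpa using hx
          by_cases hxΛ : x ∈ Λ
          · rw [glue_of_mem (by exact_mod_cast hxΛ), glue_of_mem (by exact_mod_cast hxΛ)]
            exact hout x hxX
          · have hxY : x ∉ Y := fun h => hxX (Finset.mem_sdiff.1 h).1
            rw [glue_of_notMem (by exact_mod_cast hxΛ), glue_of_notMem (by exact_mod_cast hxΛ), hσ',
              glue_of_notMem (by exact_mod_cast hxY)]
        · by_cases hxΛ : x ∈ Λ
          · rw [glue_of_mem (by exact_mod_cast hxΛ)]
          · rw [glue_of_notMem (by exact_mod_cast hxΛ), hρ x (hX x (by simpa using hx) hxΛ)]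
        · by_cases hxΛ : x ∈ Λ
          · rw [glue_of_mem (by exact_mod_cast hxΛ)]
          · have hxY := hX x (by simpa using hx) hxΛ
            rw [glue_of_notMem (by exact_mod_cast hxΛ), hσ', glue_of_mem (by exact_mod_cast hxY),
              hκ x hxY]
      · refine ⟨funext fun x => ?_, h⟩
        rw [splitConfig_fst, splitConfig_fst]
        by_cases hxΛ : (x : Γ) ∈ Λ
        · exact hg' x hxΛ
        · rw [hg x hxΛ]
          exact hout x fun hxX => x.2 (hX x hxX hxΛ)
    · push Not at hout
      obtain ⟨x, hx, hne⟩ := hout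
      rw [hA.eq_zero ρ κ ⟨x, by simpa using hx, hne⟩, if_neg, mul_zero]
      rintro ⟨h1, -⟩
      by_cases hxΛ : x ∈ Λ
      · exact hx (hΛ hxΛ)
      · have hxY : x ∉ Y := fun h => hx (Finset.mem_sdiff.1 h).1
        have := congrFun h1 ⟨x, hxY⟩
        rw [splitConfig_fst, splitConfig_fst] at this
        exact hne ((hg x hxΛ).symm.trans this)
  · rw [if_neg h, if_neg (fun h' => h h'.2), mul_zero]

end Compressions

/-! ### The generators of a lattice system -/

section GeneratorFamily

theorem continuous_of_opNorm {V : Type*} [NormedAddCommGroup V] [NormedSpace ℂ V]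
    {f : ℝ → V →L[ℂ] V}
    (h : ∀ t₀, ∀ ε > 0, ∀ᶠ t in 𝓝 t₀, ∀ v, ‖f t v - f t₀ v‖ ≤ ε * ‖v‖) : Continuous f := by
  refine Metric.continuous_iff'.2 fun t₀ ε hε => ?_
  filter_upwards [h t₀ (ε / 2) (by positivity)] with t ht
  rw [dist_eq_norm]
  exact (ContinuousLinearMap.opNorm_le_bound _ (by positivity) ht).trans_lt (half_lt_self hε)

variable {Γ : Type*} {H : Γ → Type*} [∀ x, NormedAddCommGroup (H x)]
  [∀ x, InnerProductSpace ℂ (H x)] [∀ x, CompleteSpace (H x)]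

theorem isLocalGenerator_zero (Z : Finset Γ) :
    IsLocalGenerator Z 0 (0 : Op H →L[ℂ] Op H) := by
  refine ⟨ContinuousLinearMap.opNorm_zero.le, fun _ => 0, fun _ => 0, 0,
    ⟨⟨0, by simp⟩, WeakTendsto.const 0, fun N => ?_⟩,
    ⟨by simp, fun v => by simp [summable_zero], fun A v w => ?_, ?_⟩, fun A => ?_,
    fun _ => zero_mem _, fun _ => zero_mem _, zero_mem _, by simp⟩
  · simp [lindbladPartial, sandwich_apply]
  · simp [driftMap_zero]
  · rw [driftMap_zero, sub_zero]
    exact IsCPMap.zero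
  · have : ∀ N, lindbladPartial (fun _ => (0 : Op H)) (fun _ => 0) N A = 0 := fun N => by
      simp [lindbladPartial, sandwich_apply]
    simp only [this]
    exact WeakTendsto.const 0

namespace LatticeSystem

variable (S : LatticeSystem H)

/-- The generator attached to the empty set vanishes, since the observables of the empty set are
multiples of the identity. -/
theorem Ψ_empty (t : ℝ) {X : Finset Γ} {A : Op H} (hA : A ∈ localAlgebra H X) :
    S.Ψ t ∅ A = 0 := by
  have hcomm : ∀ B ∈ localAlgebra H (∅ : Finset Γ), B * A = A * B := fun B hB =>
    commute_of_mem (Finset.disjoint_empty_left X) hB hA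
  have h1 : ∀ a, lindbladTerm (S.L t ∅ a) A = 0 := fun a => by
    have hL := S.L_mem t ∅ a
    have h2 : star (S.L t ∅ a) * A * S.L t ∅ a = A * (star (S.L t ∅ a) * S.L t ∅ a) := by
      rw [hcomm _ (star_mem hL), mul_assoc]
    rw [lindbladTerm, hcomm _ (mul_mem (star_mem hL) hL), h2, ← two_smul ℂ, smul_smul]
    norm_num
  have h3 : HasStrongSum (fun a => lindbladTerm (S.L t ∅ a) A) 0 := fun v => by
    simp [h1]
  have hex : ∃ B, HasStrongSum (fun a => lindbladTerm (S.L t ∅ a) A) B := ⟨0, h3⟩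
  have h4 : strongSum (fun a => lindbladTerm (S.L t ∅ a) A) = 0 := by
    rw [strongSum, dif_pos hex]
    ext1 v
    exact tendsto_nhds_unique (hex.choose_spec v) (h3 v)
  rw [Ψ, h4, hcomm _ (S.Φ_mem t ∅), sub_self, smul_zero, add_zero]

open Classical in
/-- The bounds of the generators.  Negative times are replaced by `0`, since the decay of the
interaction is assumed for nonnegative times only; the empty set is left out, since no condition
on the decay involves it. -/
def genBound (t : ℝ) (Z : Finset Γ) : ℝ :=
  if Z = ∅ then 0 else (cbNorm Z (S.Ψ (max t 0) Z)).toReal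

variable {S} [MetricSpace Γ] {F : ℝ → ℝ} {μ : ℝ}

/-- The exponential weight is not needed and is dropped here, by `F_μ ≤ F`. -/
theorem sum_cbNorm_le (hF : IsDecayFunction Γ F) (hμ : 0 < μ) {t r : ℝ} (hr : r ∈ Set.Icc 0 t)
    (x y : Γ) (s : Finset (Finset Γ)) (hs : ∀ Z ∈ s, x ∈ Z ∧ y ∈ Z) :
    ∑ Z ∈ s, cbNorm Z (S.Ψ r Z) ≤ S.decayNorm F t μ * ENNReal.ofReal (F (dist x y)) := by
  classical
  have hpos : 0 < weighted F μ (dist x y) := mul_pos (Real.exp_pos _) (hF.pos _ dist_nonneg)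
  have hle : weighted F μ (dist x y) ≤ F (dist x y) := by
    refine mul_le_of_le_one_left (hF.pos _ dist_nonneg).le (Real.exp_le_one_iff.2 ?_)
    nlinarith [dist_nonneg (x := x) (y := y)]
  set w := ENNReal.ofReal (weighted F μ (dist x y)) with hw
  have hw0 : w ≠ 0 := by rwa [hw, Ne, ENNReal.ofReal_eq_zero, not_le]
  have h1 : ∑ Z ∈ s, cbNorm Z (S.Ψ r Z) / w ≤ S.decayNorm F t μ := by
    have h2 : ∑' Z : {Z : Finset Γ // x ∈ Z ∧ y ∈ Z}, cbNorm (Z : Finset Γ) (S.Ψ r Z) / w ≤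
        S.decayNorm F t μ := by
      unfold decayNorm
      exact le_iSup₂_of_le (f := fun s _ => ⨆ (x : Γ) (y : Γ),
        ∑' Z : {Z : Finset Γ // x ∈ Z ∧ y ∈ Z}, cbNorm (Z : Finset Γ) (S.Ψ s Z) /
          ENNReal.ofReal (weighted F μ (dist x y))) r hr (le_iSup₂_of_le x y le_rfl)
    refine le_trans ?_ h2
    have h3 := ENNReal.sum_le_tsum (f := fun Z : {Z : Finset Γ // x ∈ Z ∧ y ∈ Z} =>
      cbNorm (Z : Finset Γ) (S.Ψ r Z) / w) (s.subtype fun Z => x ∈ Z ∧ y ∈ Z)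
    refine le_trans (le_of_eq ?_) h3
    exact (Finset.sum_subtype_of_mem (fun Z => cbNorm Z (S.Ψ r Z) / w) hs).symm
  calc ∑ Z ∈ s, cbNorm Z (S.Ψ r Z) = (∑ Z ∈ s, cbNorm Z (S.Ψ r Z) / w) * w := by
        rw [Finset.sum_mul]
        exact Finset.sum_congr rfl fun Z _ =>
          (ENNReal.div_mul_cancel hw0 ENNReal.ofReal_ne_top).symm
    _ ≤ S.decayNorm F t μ * ENNReal.ofReal (F (dist x y)) := by
        gcongr
        exact ENNReal.ofReal_le_ofReal hle

theorem cbNorm_lt_top (hF : IsDecayFunction Γ F) (hμ : 0 < μ) (hS : ∀ t, S.decayNorm F t μ < ∞)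
    {r : ℝ} (hr : 0 ≤ r) {Z : Finset Γ} (hZ : Z ≠ ∅) : cbNorm Z (S.Ψ r Z) < ∞ := by
  obtain ⟨x, hx⟩ := Finset.nonempty_iff_ne_empty.2 hZ
  have h := S.sum_cbNorm_le hF hμ ⟨hr, le_rfl⟩ x x {Z} (by simpa using hx)
  rw [Finset.sum_singleton] at h
  exact h.trans_lt (ENNReal.mul_lt_top (hS r) ENNReal.ofReal_lt_top)

theorem hasDecay_genBound (hF : IsDecayFunction Γ F) (hμ : 0 < μ)
    (hS : ∀ t, S.decayNorm F t μ < ∞) {t r : ℝ} (hrt : r ≤ t) :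
    HasDecay F (S.decayNorm F (max t 0) μ).toReal (S.genBound r) where
  nonneg Z := by
    unfold genBound
    split_ifs
    · exact le_rfl
    · exact ENNReal.toReal_nonneg
  empty := if_pos rfl
  sum_le x y s hs := by
    have hr : max r 0 ∈ Set.Icc 0 (max t 0) := ⟨le_max_right _ _, max_le_max_right _ hrt⟩
    have hne : ∀ Z ∈ s, Z ≠ ∅ := fun Z hZ => Finset.ne_empty_of_mem (hs Z hZ).1
    have h1 := S.sum_cbNorm_le hF hμ hr x y s hs
    have h2 : ∑ Z ∈ s, S.genBound r Z = (∑ Z ∈ s, cbNorm Z (S.Ψ (max r 0) Z)).toReal := by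
      rw [ENNReal.toReal_sum fun Z hZ => (S.cbNorm_lt_top hF hμ hS hr.1 (hne Z hZ)).ne]
      exact Finset.sum_congr rfl fun Z hZ => if_neg (hne Z hZ)
    rw [h2]
    have h3 := ENNReal.toReal_mono (ENNReal.mul_ne_top (hS _).ne ENNReal.ofReal_ne_top) h1
    rwa [ENNReal.toReal_mul, ENNReal.toReal_ofReal (hF.pos _ dist_nonneg).le] at h3

variable [∀ x, Nontrivial (H x)]

/-- The generators of a lattice system extend to all bounded operators, as a family indexed by all
times: the generators at time `0` are used at negative times. -/
theorem exists_isGeneratorFamily (hF : IsDecayFunction Γ F) (hμ : 0 < μ)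
    (hS : ∀ t, S.decayNorm F t μ < ∞) (hconv : S.SeriesConverge) (hcont : S.NormContinuous) :
    ∃ φ : ℝ → Finset Γ → Op H →L[ℂ] Op H, IsGeneratorFamily F φ S.genBound ∧
      ∀ t, 0 ≤ t → ∀ Λ, ∀ A ∈ localAlgebra H Λ,
        S.generator Λ t A = (∑ Z ∈ Λ.powerset, φ t Z) A := by
  classical
  have hex : ∀ t Z, ∃ φ : Op H →L[ℂ] Op H, IsLocalGenerator Z (S.genBound t Z) φ ∧
      ∀ X, Z ⊆ X → ∀ A ∈ localAlgebra H X, S.Ψ (max t 0) Z A = φ A := fun t Z => by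
    by_cases hZ : Z = ∅
    · refine ⟨0, ?_, fun X _ A hA => ?_⟩
      · rw [genBound, if_pos hZ]
        exact isLocalGenerator_zero Z
      · rw [hZ, S.Ψ_empty _ hA, zero_apply]
    · rw [genBound, if_neg hZ]
      exact S.exists_localGenerator hconv _ Z (S.cbNorm_lt_top hF hμ hS (le_max_right _ _) hZ)
  choose φ hφ hφ' using hex
  have hgen : ∀ t Λ, ∀ A ∈ localAlgebra H Λ,
      S.generator Λ (max t 0) A = (∑ Z ∈ Λ.powerset, φ t Z) A := fun t Λ A hA => by
    rw [generator, sum_apply]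
    exact Finset.sum_congr rfl fun Z hZ => hφ' t Z Λ (Finset.mem_powerset.1 hZ) A hA
  refine ⟨φ, ⟨hφ, fun T => ⟨_, ENNReal.toReal_nonneg, fun r hr =>
    S.hasDecay_genBound hF hμ hS hr⟩, fun Λ => ?_⟩, fun t ht Λ A hA => ?_⟩
  · refine continuous_of_opNorm fun t₀ ε hε => ?_
    have h2 : Tendsto (fun t : ℝ => max t 0) (𝓝 t₀) (𝓝 (max t₀ 0)) :=
      (continuous_id.max continuous_const).tendsto t₀
    filter_upwards [h2.eventually (hcont Λ (max t₀ 0) ε hε)] with t ht a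
    have ha := ampliation_mem Λ a
    have h3 := ht (ampliation H Λ a) ha
    rw [hgen t Λ _ ha, hgen t₀ Λ _ ha] at h3
    rw [compress_apply, compress_apply, ← blockL_apply, ← blockL_apply, ← map_sub, blockL_apply]
    refine (norm_block_le Λ _ _ _).trans (h3.trans ?_)
    gcongr
    exact norm_ampliation_le Λ a
  · rw [← hgen t Λ A hA, max_eq_left ht]

end LatticeSystem

end GeneratorFamily

/-! ### The quasi-local algebra -/

section QuasiLocal

variable {Γ : Type*} {H : Γ → Type*} [∀ x, NormedAddCommGroup (H x)]
  [∀ x, InnerProductSpace ℂ (H x)] [∀ x, CompleteSpace (H x)]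

/-- The restriction to the quasi-local algebra of a map which preserves it. -/
def restrictQuasi (φ : Op H →L[ℂ] Op H) (h : ∀ A ∈ quasiLocalAlgebra H, φ A ∈ quasiLocalAlgebra H) :
    quasiLocalAlgebra H →L[ℂ] quasiLocalAlgebra H :=
  LinearMap.mkContinuous ⟨⟨fun A => ⟨φ A, h A A.2⟩, fun _ _ => Subtype.ext (map_add φ _ _)⟩,
    fun _ _ => Subtype.ext (map_smul φ _ _)⟩ ‖φ‖ fun A => φ.le_opNorm A

theorem restrictQuasi_apply (φ : Op H →L[ℂ] Op H)
    (h : ∀ A ∈ quasiLocalAlgebra H, φ A ∈ quasiLocalAlgebra H) (A : quasiLocalAlgebra H) :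
    (restrictQuasi φ h A : Op H) = φ A := rfl

/-- A map of the quasi-local algebra which is a pointwise limit of completely positive maps of
`B(ℋ)` is completely positive. -/
theorem isCompletelyPositive_of_tendsto {φ : ℕ → Op H →L[ℂ] Op H} (hφ : ∀ n, IsCPMap (φ n))
    {T : quasiLocalAlgebra H →L[ℂ] quasiLocalAlgebra H}
    (hT : ∀ A : quasiLocalAlgebra H, Tendsto (fun n => φ n A) atTop (𝓝 (T A : Op H))) :
    IsCompletelyPositive T := by
  let _ := CStarAlgebra.spectralOrder (quasiLocalAlgebra H)
  let _ := CStarAlgebra.spectralOrderedRing (quasiLocalAlgebra H)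
  let ι : quasiLocalAlgebra H →⋆ₐ[ℂ] (TotalSpace H →L[ℂ] TotalSpace H) :=
    (quasiLocalAlgebra H).subtype
  refine ⟨⟨T.toLinearMap, fun k M hM => ?_⟩, fun _ => rfl⟩
  refine nonneg_of_isPosKernel ι Subtype.val_injective ?_
  refine IsPosKernel.of_weakTendsto (M := fun n i j => φ n (M i j : Op H))
    (fun n => hφ n k _ (isPosKernel_of_nonneg ι hM)) fun i j => ?_
  exact WeakTendsto.of_norm_tendsto (hT (M i j))

variable [∀ x, Nontrivial (H x)]

/-- Properties of elements of the quasi-local algebra which are stable under limits need to be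
verified on local algebras only. -/
theorem quasiLocal_induction {p : quasiLocalAlgebra H → Prop} (hp : IsClosed {A | p A})
    (h : ∀ X (A : quasiLocalAlgebra H), (A : Op H) ∈ localAlgebra H X → p A)
    (A : quasiLocalAlgebra H) : p A := by
  have h1 : A ∈ closure {B : quasiLocalAlgebra H | ∃ X, (B : Op H) ∈ localAlgebra H X} := by
    rw [closure_subtype]
    refine closure_mono ?_ (mem_closure_local A)
    rintro B ⟨X, hB⟩
    exact ⟨⟨B, localAlgebra_le_quasiLocalAlgebra X hB⟩, ⟨X, hB⟩, rfl⟩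
  refine closure_minimal ?_ hp h1
  rintro B ⟨X, hB⟩
  exact h X B hB

theorem IsBimoduleMap.map_mem_quasiLocal {Λ : Finset Γ} {φ : Op H →L[ℂ] Op H}
    (hφ : IsBimoduleMap Λ φ) {A : Op H} (hA : A ∈ quasiLocalAlgebra H) :
    φ A ∈ quasiLocalAlgebra H := by
  classical
  refine quasiLocal_induction
    (p := fun A : quasiLocalAlgebra H => φ (A : Op H) ∈ quasiLocalAlgebra H)
    ((isClosed_quasiLocalAlgebra H).preimage (φ.continuous.comp continuous_subtype_val))
    (fun X A hA => ?_) ⟨A, hA⟩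
  exact localAlgebra_le_quasiLocalAlgebra (Λ ∪ X)
    (hφ.map_mem Finset.subset_union_left (localAlgebra_mono Finset.subset_union_right hA))

variable [MetricSpace Γ] {S : LatticeSystem H} {F : ℝ → ℝ} {φ : ℝ → Finset Γ → Op H →L[ℂ] Op H}
  {c : ℝ → Finset Γ → ℝ} {Λ : Finset Γ} {s t : ℝ}

theorem hasDerivWithinAt_clm_apply {V W : Type*} [NormedAddCommGroup V] [NormedSpace ℂ V]
    [NormedAddCommGroup W] [NormedSpace ℂ W] (L : V →L[ℂ] W) {f : ℝ → V} {f' : V} {u : ℝ}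
    {a : Set ℝ} (hf : HasDerivWithinAt f f' a u) : HasDerivWithinAt (fun r => L (f r)) (L f') a u :=
  (L.restrictScalars ℝ).hasFDerivAt.comp_hasDerivWithinAt u hf

/-- The evolution on all bounded operators restricts to a finite volume evolution. -/
theorem IsGeneratorFamily.isFiniteVolumeEvolution (hφ : IsGeneratorFamily F φ c)
    (hS : ∀ t, 0 ≤ t → ∀ Λ, ∀ A ∈ localAlgebra H Λ,
      S.generator Λ t A = (∑ Z ∈ Λ.powerset, φ t Z) A) (hs : 0 ≤ s) (hst : s ≤ t) :
    S.IsFiniteVolumeEvolution Λ t s (restrictQuasi (evolution φ Λ t s)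
      fun _ => (hφ.isBimoduleMap_evolution hst).map_mem_quasiLocal) where
  on_local A hA := by
    obtain ⟨a, ha⟩ := hA
    replace ha : ampliation H Λ a = A := ha
    obtain ⟨f, hf, hf'⟩ := exists_solvesLinear (hφ.continuous Λ).continuousOn hst a
    refine ⟨fun u => ampliation H Λ (f u), ⟨fun u _ => ampliation_mem Λ _, ?_, fun u hu => ?_⟩, ?_⟩
    · simp only [hf, ha]
    · rw [hS u (hs.trans hu.1) Λ _ (ampliation_mem Λ _), (hφ.isBimoduleMap Λ u).map_ampliation]
      exact hasDerivWithinAt_clm_apply (ampliationL Λ) (hf' u hu)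
    · rw [restrictQuasi_apply, ← ha, (hφ.isBimoduleMap_evolution hst).map_ampliation,
        compress_apply, hφ.block_evolution hst hf' (by rw [hf, block_ampliation])]
  left_module Y hY A B hB :=
    Subtype.ext ((hφ.isBimoduleMap_evolution hst).map_mul_left B
      (fun _ hC => commute_of_mem hY.symm hC hB) A)
  right_module Y hY A B hB :=
    Subtype.ext ((hφ.isBimoduleMap_evolution hst).map_mul_right B
      (fun _ hC => commute_of_mem hY.symm hC hB) A)

/-- Any finite volume evolution is the restriction of the evolution on all bounded operators. -/
theorem IsGeneratorFamily.eq_evolution (hφ : IsGeneratorFamily F φ c)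
    (hS : ∀ t, 0 ≤ t → ∀ Λ, ∀ A ∈ localAlgebra H Λ,
      S.generator Λ t A = (∑ Z ∈ Λ.powerset, φ t Z) A) (hs : 0 ≤ s) (hst : s ≤ t)
    {T : quasiLocalAlgebra H →L[ℂ] quasiLocalAlgebra H} (hT : S.IsFiniteVolumeEvolution Λ t s T)
    (A : quasiLocalAlgebra H) : (T A : Op H) = evolution φ Λ t s A := by
  classical
  have hU := hφ.isFiniteVolumeEvolution (Λ := Λ) hS hs hst
  set U := restrictQuasi (evolution φ Λ t s)
      fun _ => (hφ.isBimoduleMap_evolution (Λ := Λ) hst).map_mem_quasiLocal with hU'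
  -- solutions are unique, so both maps agree on the local algebra
  have huniq : ∀ {A : Op H} {f : ℝ → Op H}, S.IsSolution Λ s t A f → evolution φ Λ t s A = f t := by
    intro A f hf
    set g : ℝ → LocalSpace H Λ →L[ℂ] LocalSpace H Λ := fun u =>
      block Λ (refOuter Λ) (refOuter Λ) (f u) with hg
    have hfg : ∀ u ∈ Set.Icc s t, f u = ampliation H Λ (g u) := fun u hu => by
      obtain ⟨a, ha⟩ := hf.mem u hu
      replace ha : ampliation H Λ a = f u := ha
      rw [hg, ← ha]
      simp only [← ha, block_ampliation]
    have hg' : SolvesLinear (fun r => compress Λ (∑ Z ∈ Λ.powerset, φ r Z)) s t g := fun u hu => by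
      have h1 := hasDerivWithinAt_clm_apply (blockL Λ (refOuter Λ) (refOuter Λ)) (hf.deriv u hu)
      rw [hS u (hs.trans hu.1) Λ _ (hf.mem u hu)] at h1
      refine h1.congr_deriv ?_
      rw [blockL_apply, compress_apply, ← hfg u hu]
    have h2 : g s = block Λ (refOuter Λ) (refOuter Λ) A := by simp only [hg, hf.init]
    have hA : A = ampliation H Λ (g s) := by rw [← hfg s ⟨le_rfl, hst⟩, hf.init]
    rw [hfg t ⟨hst, le_rfl⟩, ← hφ.block_evolution hst hg' h2, hA,
      (hφ.isBimoduleMap_evolution hst).map_ampliation, block_ampliation]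
  have hloc : ∀ B : quasiLocalAlgebra H, (B : Op H) ∈ localAlgebra H Λ → T B = U B := fun B hB => by
    obtain ⟨f, hf, hTf⟩ := hT.on_local B hB
    exact Subtype.ext (hTf.trans (huniq hf).symm)
  suffices h : T A = U A from congrArg Subtype.val h
  refine quasiLocal_induction (p := fun A => T A = U A) (isClosed_eq T.continuous U.continuous)
    (fun X A hA => ?_) A
  have hA' : ActsOn ((Λ ∪ X : Finset Γ) : Set Γ) (A : Op H) :=
    actsOn_of_mem (localAlgebra_mono Finset.subset_union_right hA)
  set Y := (Λ ∪ X) \ Λ with hY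
  have hYΛ : Disjoint Y Λ := Finset.sdiff_disjoint
  -- it suffices to compare the compressions by the projections of the local algebra of `Y`
  refine Subtype.ext (ext_coeff fun σ τ => ?_)
  obtain ⟨a, ha, h1⟩ := exists_compression_eq (Λ := Λ) Finset.subset_union_left hA' σ τ
  let e : LocalConfig H Y → LocalConfig H Y → quasiLocalAlgebra H := fun ξ ξ' =>
    ⟨innerUnit Y ξ ξ', localAlgebra_le_quasiLocalAlgebra Y (innerUnit_mem Y ξ ξ')⟩
  have he : ∀ ξ ξ', (e ξ ξ' : Op H) ∈ localAlgebra H Y := fun ξ ξ' => innerUnit_mem Y ξ ξ'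
  let a' : quasiLocalAlgebra H := ⟨a, localAlgebra_le_quasiLocalAlgebra Λ ha⟩
  set ξ := (splitConfig Y σ).2
  set ξ' := (splitConfig Y τ).2
  have h2 : e ξ ξ * A * e ξ' ξ' = a' * e ξ ξ' := Subtype.ext h1
  have h3 : e ξ ξ * T A * e ξ' ξ' = e ξ ξ * U A * e ξ' ξ' := by
    rw [← hT.left_module Y hYΛ _ _ (he _ _), ← hT.right_module Y hYΛ _ _ (he _ _),
      ← hU.left_module Y hYΛ _ _ (he _ _), ← hU.right_module Y hYΛ _ _ (he _ _), h2,
      hT.right_module Y hYΛ _ _ (he _ _), hU.right_module Y hYΛ _ _ (he _ _), hloc a' ha]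
  have h4 : ∀ B : quasiLocalAlgebra H,
      coeff (((e ξ ξ * B * e ξ' ξ' : quasiLocalAlgebra H)) : Op H) σ τ = coeff (B : Op H) σ τ :=
    fun B => (coeff_compression Y ξ ξ' (B : Op H) σ τ).trans (if_pos ⟨rfl, rfl⟩)
  rw [← h4, h3, h4]

/-- The finite volume evolution is the restriction of the evolution on all bounded operators. -/
theorem IsGeneratorFamily.finiteVolumeEvolution_apply (hφ : IsGeneratorFamily F φ c)
    (hS : ∀ t, 0 ≤ t → ∀ Λ, ∀ A ∈ localAlgebra H Λ,
      S.generator Λ t A = (∑ Z ∈ Λ.powerset, φ t Z) A) (hs : 0 ≤ s) (hst : s ≤ t)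
    (A : quasiLocalAlgebra H) :
    (S.finiteVolumeEvolution Λ t s A : Op H) = evolution φ Λ t s A := by
  have hex : ∃ T, S.IsFiniteVolumeEvolution Λ t s T :=
    ⟨_, hφ.isFiniteVolumeEvolution hS hs hst⟩
  rw [LatticeSystem.finiteVolumeEvolution, dif_pos hex]
  exact hφ.eq_evolution hS hs hst hex.choose_spec A

end QuasiLocal

/-! ### The infinite volume limit -/

section InfiniteVolume

variable {Γ : Type*} [MetricSpace Γ] {H : Γ → Type*} [∀ x, NormedAddCommGroup (H x)]
  [∀ x, InnerProductSpace ℂ (H x)] [∀ x, CompleteSpace (H x)] [∀ x, Nontrivial (H x)]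
  {F : ℝ → ℝ} {φ : ℝ → Finset Γ → Op H →L[ℂ] Op H} {c : ℝ → Finset Γ → ℝ} {r s t : ℝ}

/-- Finite sets `X` are far from most sites; this makes the Lieb–Robinson bound vanish in the limit
of large volumes. -/
theorem IsDecayFunction.summable_spread (hF : IsDecayFunction Γ F) (X : Finset Γ) :
    Summable (spread F X) := by
  refine summable_sum fun x _ => ?_
  have h1 : ∑' y : Γ, ENNReal.ofReal (F (dist x y)) ≠ ∞ :=
    ((le_iSup (fun x : Γ => ∑' y : Γ, ENNReal.ofReal (F (dist x y))) x).trans_lt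
      hF.integrable).ne
  refine (ENNReal.summable_toReal h1).congr fun y => ?_
  rw [ENNReal.toReal_ofReal (hF.pos _ dist_nonneg).le, dist_comm]

namespace IsGeneratorFamily

/-- The finite volume evolutions of a quasi-local observable are a Cauchy net in the volume,
uniformly for bounded times. -/
theorem exists_volume (hφ : IsGeneratorFamily F φ c) (hF : IsDecayFunction Γ F) (T : ℝ)
    (A : quasiLocalAlgebra H) : ∀ ε > 0, ∃ Λ₀ : Finset Γ, ∀ Λ, Λ₀ ⊆ Λ → ∀ s t, 0 ≤ s → s ≤ t →
      t ≤ T → ‖evolution φ Λ t s A - evolution φ Λ₀ t s A‖ ≤ ε := by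
  classical
  refine quasiLocal_induction (p := fun A : quasiLocalAlgebra H => ∀ ε > 0, ∃ Λ₀ : Finset Γ,
    ∀ Λ, Λ₀ ⊆ Λ → ∀ s t, 0 ≤ s → s ≤ t → t ≤ T →
      ‖evolution φ Λ t s A - evolution φ Λ₀ t s A‖ ≤ ε) ?_ (fun X A hA => ?_) A
  · refine isClosed_of_closure_subset fun A hA ε hε => ?_
    obtain ⟨B, hB, hAB⟩ := Metric.mem_closure_iff.1 hA (ε / 3) (by positivity)
    obtain ⟨Λ₀, hΛ₀⟩ := hB (ε / 3) (by positivity)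
    refine ⟨Λ₀, fun Λ hΛ s t hs hst ht => ?_⟩
    have h1 : ∀ Λ, ‖evolution φ Λ t s A - evolution φ Λ t s B‖ ≤ ε / 3 := fun Λ => by
      rw [← map_sub]
      refine (hφ.norm_evolution_apply_le hst _).trans ?_
      rw [dist_eq_norm] at hAB
      exact hAB.le
    have h2 := h1 Λ₀
    rw [norm_sub_rev] at h2
    calc ‖evolution φ Λ t s A - evolution φ Λ₀ t s A‖
        ≤ ‖evolution φ Λ t s A - evolution φ Λ t s B‖ +
          ‖evolution φ Λ t s B - evolution φ Λ₀ t s B‖ +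
          ‖evolution φ Λ₀ t s B - evolution φ Λ₀ t s A‖ := by
          refine (norm_sub_le_norm_sub_add_norm_sub _ (evolution φ Λ₀ t s B) _).trans ?_
          gcongr
          exact norm_sub_le_norm_sub_add_norm_sub _ _ _
      _ ≤ ε / 3 + ε / 3 + ε / 3 := add_le_add (add_le_add (h1 Λ) (hΛ₀ Λ hΛ s t hs hst ht)) h2
      _ = ε := by ring
  · intro ε hε
    obtain ⟨C, hC0, hC⟩ := hF.exists_convolution
    obtain ⟨M, hM, hc⟩ := hφ.decay T
    have hF0 : 0 < F 0 := hF.pos 0 le_rfl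
    set K := |T| * Real.exp (|T| * (M * C)) * (‖(A : Op H)‖ * (F 0)⁻¹ * (M * C)) with hK
    have hK0 : 0 ≤ K := by positivity
    obtain ⟨Λ₀, hΛ₀⟩ := summable_iff_vanishing_norm.1 (hF.summable_spread X) (ε / (K + 1))
      (by positivity)
    refine ⟨Λ₀, fun Λ hΛ s t hs hst ht => ?_⟩
    have h1 := hφ.norm_evolution_sub_evolution_le_spread hF hC0 hC hM hst
      (fun r hr => hc r (hr.trans ht)) hΛ hA
    have h2 : ∑ y ∈ Λ \ Λ₀, spread F X y ≤ ε / (K + 1) :=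
      (le_abs_self _).trans (hΛ₀ (Λ \ Λ₀) Finset.sdiff_disjoint).le
    have h3 : t - s ≤ |T| := by linarith [le_abs_self T]
    have h4 : 0 ≤ ∑ y ∈ Λ \ Λ₀, spread F X y := Finset.sum_nonneg fun y _ => spread_nonneg hF X y
    refine h1.trans ?_
    calc _ ≤ |T| * Real.exp (|T| * (M * C)) *
          (‖(A : Op H)‖ * (F 0)⁻¹ * (M * C * (ε / (K + 1)))) := by gcongr
      _ = K * (ε / (K + 1)) := by rw [hK]; ring
      _ ≤ (K + 1) * (ε / (K + 1)) := by gcongr; linarith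
      _ = ε := by field_simp

theorem exists_limit (hφ : IsGeneratorFamily F φ c) (hF : IsDecayFunction Γ F) (hs : 0 ≤ s)
    (hst : s ≤ t) : ∃ T : quasiLocalAlgebra H →L[ℂ] quasiLocalAlgebra H, ∀ A : quasiLocalAlgebra H,
      Tendsto (fun Λ : Finset Γ => evolution φ Λ t s A) atTop (𝓝 (T A : Op H)) := by
  classical
  have h1 : ∀ A : quasiLocalAlgebra H, ∃ B : quasiLocalAlgebra H,
      Tendsto (fun Λ : Finset Γ => evolution φ Λ t s A) atTop (𝓝 (B : Op H)) := fun A => by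
    have hcau : CauchySeq fun Λ : Finset Γ => evolution φ Λ t s (A : Op H) := by
      refine Metric.cauchySeq_iff'.2 fun ε hε => ?_
      obtain ⟨Λ₀, hΛ₀⟩ := hφ.exists_volume hF t A (ε / 2) (by positivity)
      refine ⟨Λ₀, fun Λ hΛ => ?_⟩
      rw [dist_eq_norm]
      exact (hΛ₀ Λ hΛ s t hs hst le_rfl).trans_lt (half_lt_self hε)
    obtain ⟨B, hB⟩ := cauchySeq_tendsto_of_complete hcau
    exact ⟨⟨B, (isClosed_quasiLocalAlgebra H).mem_of_tendsto hB (Eventually.of_forall fun Λ =>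
      (hφ.isBimoduleMap_evolution hst).map_mem_quasiLocal A.2)⟩, hB⟩
  choose f hf using h1
  refine ⟨LinearMap.mkContinuous ⟨⟨f, fun A B => ?_⟩, fun a A => ?_⟩ 1 fun A => ?_, hf⟩
  · refine Subtype.ext (tendsto_nhds_unique (hf (A + B)) ?_)
    simpa using (hf A).add (hf B)
  · refine Subtype.ext (tendsto_nhds_unique (hf (a • A)) ?_)
    simpa using (hf A).const_smul a
  · rw [one_mul]
    exact le_of_tendsto (hf A).norm (Eventually.of_forall fun Λ => hφ.norm_evolution_apply_le hst _)

end IsGeneratorFamily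

/-- The infinite volume evolution: the limit of the finite volume evolutions. -/
def limitEvolution (φ : ℝ → Finset Γ → Op H →L[ℂ] Op H) (t s : ℝ) :
    quasiLocalAlgebra H →L[ℂ] quasiLocalAlgebra H :=
  Classical.epsilon fun T => ∀ A : quasiLocalAlgebra H,
    Tendsto (fun Λ : Finset Γ => evolution φ Λ t s A) atTop (𝓝 (T A : Op H))

namespace IsGeneratorFamily

theorem tendsto_limitEvolution (hφ : IsGeneratorFamily F φ c) (hF : IsDecayFunction Γ F)
    (hs : 0 ≤ s) (hst : s ≤ t) (A : quasiLocalAlgebra H) :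
    Tendsto (fun Λ : Finset Γ => evolution φ Λ t s A) atTop (𝓝 (limitEvolution φ t s A : Op H)) :=
  Classical.epsilon_spec (hφ.exists_limit hF hs hst) A

theorem limitEvolution_self (hφ : IsGeneratorFamily F φ c) (hF : IsDecayFunction Γ F)
    (hs : 0 ≤ s) : limitEvolution φ s s = ContinuousLinearMap.id ℂ (quasiLocalAlgebra H) := by
  ext1 A
  refine Subtype.ext (tendsto_nhds_unique (hφ.tendsto_limitEvolution hF hs le_rfl A) ?_)
  simp only [hφ.evolution_self]
  exact tendsto_const_nhds

theorem limitEvolution_comp (hφ : IsGeneratorFamily F φ c) (hF : IsDecayFunction Γ F)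
    (hr : 0 ≤ r) (hrs : r ≤ s) (hst : s ≤ t) :
    (limitEvolution φ t s).comp (limitEvolution (H := H) φ s r) = limitEvolution φ t r := by
  ext1 A
  refine Subtype.ext (tendsto_nhds_unique ?_
    (hφ.tendsto_limitEvolution hF hr (hrs.trans hst) A))
  have h1 := hφ.tendsto_limitEvolution hF (hr.trans hrs) hst (limitEvolution φ s r A)
  have h2 := (tendsto_iff_norm_sub_tendsto_zero.1 (hφ.tendsto_limitEvolution hF hr hrs A))
  have h3 : Tendsto (fun Λ : Finset Γ => evolution φ Λ t r (A : Op H) -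
      evolution φ Λ t s (limitEvolution φ s r A : Op H)) atTop (𝓝 0) := by
    refine squeeze_zero_norm (fun Λ => ?_) h2
    rw [← hφ.evolution_comp hrs hst, ← map_sub]
    exact hφ.norm_evolution_apply_le hst _
  simpa using h3.add h1

theorem continuousOn_limitEvolution (hφ : IsGeneratorFamily F φ c) (hF : IsDecayFunction Γ F)
    (A : quasiLocalAlgebra H) : ContinuousOn (fun p : ℝ × ℝ => limitEvolution φ p.1 p.2 A)
      {p | 0 ≤ p.2 ∧ p.2 ≤ p.1} := by
  rintro ⟨t₀, s₀⟩ ⟨hs₀, hst₀⟩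
  simp only at hs₀ hst₀
  refine Metric.tendsto_nhds.2 fun ε hε => ?_
  obtain ⟨Λ, hΛ⟩ := hφ.exists_volume hF (t₀ + 1) A (ε / 4) (by positivity)
  obtain ⟨M, hM, hc⟩ := hφ.decay (t₀ + 1)
  set m : ℝ := Λ.card * (M * F 0) with hm
  have h1 : ∀ s t, 0 ≤ s → s ≤ t → t ≤ t₀ + 1 →
      ‖(limitEvolution φ t s A : Op H) - evolution φ Λ t s A‖ ≤ ε / 4 := fun s t hs hst ht => by
    refine le_of_tendsto ((hφ.tendsto_limitEvolution hF hs hst A).sub_const _).norm ?_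
    filter_upwards [eventually_ge_atTop Λ] with Λ' hΛ'
    exact hΛ Λ' hΛ' s t hs hst ht
  have h2 : Tendsto (fun p : ℝ × ℝ => (|p.1 - t₀| + |p.2 - s₀|) * (m * ‖(A : Op H)‖))
      (𝓝[{p | 0 ≤ p.2 ∧ p.2 ≤ p.1}] (t₀, s₀)) (𝓝 0) := by
    have : Continuous fun p : ℝ × ℝ => (|p.1 - t₀| + |p.2 - s₀|) * (m * ‖(A : Op H)‖) := by
      fun_prop
    have h : Tendsto _ (𝓝[{p : ℝ × ℝ | 0 ≤ p.2 ∧ p.2 ≤ p.1}] (t₀, s₀)) _ :=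
      (this.tendsto (t₀, s₀)).mono_left nhdsWithin_le_nhds
    simpa using h
  have h3 : ∀ᶠ p : ℝ × ℝ in 𝓝[{p | 0 ≤ p.2 ∧ p.2 ≤ p.1}] (t₀, s₀), p.1 < t₀ + 1 :=
    nhdsWithin_le_nhds ((continuous_fst.tendsto (t₀, s₀)).eventually_lt_const (by simp))
  filter_upwards [h2.eventually_lt_const (show 0 < ε / 4 by positivity), h3,
    self_mem_nhdsWithin] with ⟨t, s⟩ h4 h5 ⟨hs, hst⟩
  simp only at h4 h5 hs hst
  have h6 := hφ.norm_evolution_sub_evolution_le (Λ := Λ) (T := t₀ + 1) (m := m)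
    (fun r hr => (hc r hr).sum_le_card subset_rfl) hst hst₀ h5.le (by linarith) (A : Op H)
  have h7 := h1 s t hs hst h5.le
  have h8 := h1 s₀ t₀ hs₀ hst₀ (by linarith)
  rw [norm_sub_rev] at h8
  rw [Subtype.dist_eq, dist_eq_norm]
  calc ‖(limitEvolution φ t s A : Op H) - (limitEvolution φ t₀ s₀ A : Op H)‖
      ≤ ‖(limitEvolution φ t s A : Op H) - evolution φ Λ t s A‖ +
        ‖evolution φ Λ t s (A : Op H) - evolution φ Λ t₀ s₀ A‖ +
        ‖evolution φ Λ t₀ s₀ (A : Op H) - limitEvolution φ t₀ s₀ A‖ := by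
        refine (norm_sub_le_norm_sub_add_norm_sub _ (evolution φ Λ t₀ s₀ (A : Op H)) _).trans ?_
        gcongr
        exact norm_sub_le_norm_sub_add_norm_sub _ _ _
    _ < ε := by linarith

theorem limitEvolution_one (hφ : IsGeneratorFamily F φ c) (hF : IsDecayFunction Γ F)
    (hs : 0 ≤ s) (hst : s ≤ t) : limitEvolution φ t s (1 : quasiLocalAlgebra H) = 1 := by
  refine Subtype.ext (tendsto_nhds_unique (hφ.tendsto_limitEvolution hF hs hst 1) ?_)
  have h : ∀ Λ, evolution φ Λ t s ((1 : quasiLocalAlgebra H) : Op H) = 1 := fun Λ =>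
    hφ.evolution_one hst
  simp only [h]
  exact tendsto_const_nhds

theorem isCompletelyPositive_limitEvolution [Countable Γ] (hφ : IsGeneratorFamily F φ c)
    (hF : IsDecayFunction Γ F) (hs : 0 ≤ s) (hst : s ≤ t) :
    IsCompletelyPositive (limitEvolution (H := H) φ t s) := by
  obtain ⟨Λ, hΛ⟩ := exists_seq_tendsto (atTop : Filter (Finset Γ))
  exact isCompletelyPositive_of_tendsto (φ := fun n => evolution φ (Λ n) t s)
    (fun n => hφ.isCPMap_evolution hst)
    fun A => (hφ.tendsto_limitEvolution hF hs hst A).comp hΛ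

end IsGeneratorFamily

end InfiniteVolume

end OpenLattice

end

open OpenLattice in
theorem theorem2p3 {Γ : Type*} [Countable Γ] [MetricSpace Γ]
    (H : Γ → Type*) [∀ x, NormedAddCommGroup (H x)] [∀ x, InnerProductSpace ℂ (H x)]
    [∀ x, CompleteSpace (H x)] [∀ x, Nontrivial (H x)]
    (F : ℝ → ℝ) (hF : IsDecayFunction Γ F)
    (S : LatticeSystem H) (hS : S.SeriesConverge)
    (hcont : S.NormContinuous)
    (hdecay : ∃ μ : ℝ, 0 < μ ∧ ∀ t : ℝ, S.decayNorm F t μ < ⊤) :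
    ∃ γ : ℝ → ℝ → (quasiLocalAlgebra H →L[ℂ] quasiLocalAlgebra H),
      -- cocycle
      (∀ s, 0 ≤ s → γ s s = ContinuousLinearMap.id ℂ (quasiLocalAlgebra H)) ∧
      (∀ r s t, 0 ≤ r → r ≤ s → s ≤ t → (γ t s).comp (γ s r) = γ t r) ∧
      -- strong continuity
      (∀ A : quasiLocalAlgebra H,
        ContinuousOn (fun p : ℝ × ℝ => γ p.1 p.2 A) {p | 0 ≤ p.2 ∧ p.2 ≤ p.1}) ∧
      -- unit preserving and completely positive
      (∀ s t, 0 ≤ s → s ≤ t → γ t s 1 = 1 ∧ IsCompletelyPositive (γ t s)) ∧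
      -- thermodynamic limit
      (∀ s t, 0 ≤ s → s ≤ t → ∀ Λ : ℕ → Finset Γ, Monotone Λ → (∀ x, ∃ n, x ∈ Λ n) →
        ∀ A : quasiLocalAlgebra H,
          Tendsto (fun n => ‖S.finiteVolumeEvolution (Λ n) t s A - γ t s A‖) atTop (𝓝 0)) := by
  obtain ⟨μ, hμ, hfin⟩ := hdecay
  obtain ⟨φ, hφ, hgen⟩ := S.exists_isGeneratorFamily hF hμ hfin hS hcont
  refine ⟨limitEvolution φ, fun s hs => hφ.limitEvolution_self hF hs,
    fun r s t hr hrs hst => hφ.limitEvolution_comp hF hr hrs hst,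
    hφ.continuousOn_limitEvolution hF,
    fun s t hs hst => ⟨hφ.limitEvolution_one hF hs hst,
      hφ.isCompletelyPositive_limitEvolution hF hs hst⟩,
    fun s t hs hst Λ hΛ hex A => ?_⟩
  have h1 := (hφ.tendsto_limitEvolution hF hs hst A).comp
    (tendsto_atTop_finset_of_monotone hΛ hex)
  refine (tendsto_iff_norm_sub_tendsto_zero.1 h1).congr fun n => ?_
  rw [Function.comp_apply, ← hφ.finiteVolumeEvolution_apply hgen hs hst]
  rfl
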